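/- **Setting.** Let $N\ge 1$, $k\ge 0$, $m=N+k$, and let $J=\mathrm{diag}(\epsilon_1,\dots,\epsilon_N)$ be either $I_N$ (Euclidean case) or $\mathrm{diag}(1,\dots,1,-1)$ (Lorentzian case; there $N=n+1$). Write $O(J)=\{B: B^tJB=J\}$, i.e. $O(N)$ resp. $O(N-1,1)$, and $\langle z,z\rangle=\sum_j\epsilon_jz_j^2$ for $z\in\mathbb R^N$. Let $C_i$ be the $N\times N$ matrix and $D_i$ the $m\times N$ matrix whose only non-zero entry is a $1$ at $(i,i)$, and for a real $m\times N$ matrix $\xi$ put $$a_i=\begin{pmatrix}0&-D_iJ\\ D_i^t&0\end{pmatrix},\qquad v_\xi=\begin{pmatrix}0&\xi\\-J\xi^t&0\end{pmatrix}.$$ Let $U\subset\mathbb R^N$ be open and let $\xi=\binom FG$ be a smooth solution on $U$, with $F=(f_{ij})$ of size $N\times N$, $G=(g_{ij})$ of size $k\times N$ and $f_{ii}=0$, of the system $[a_i,v_{x_j}]-[a_j,v_{x_i}]=[[a_i,v],[a_j,v]]$, $v=v_\xi$ (the $G_{m,N}$-system, resp. the $G^1_{m,N-1}$-system). Let $E(x,\lambda)$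 be a frame of $\xi$: smooth in $(x,\lambda)\in U\times\mathbb C$, holomorphic in $\lambda\in\mathbb C$, with $E^{-1}dE=\sum_i(\lambda a_i+[a_i,v])dx_i$ and $$\overline{E(x,\bar\lambda)}=E(x,\lambda),\quad \begin{pmatrix}I_m&0\\0&-I_N\end{pmatrix}E(x,\lambda)\begin{pmatrix}I_m&0\\0&-I_N\end{pmatrix}=E(x,-\lambda),\quad E^t\begin{pmatrix}I_m&0\\0&J\end{pmatrix}E=\begin{pmatrix}I_m&0\\0&J\end{pmatrix}.$$ Then $E(x,0)=\mathrm{diag}(A(x),B(x))$ with $A\in O(m)$, $B\in O(J)$. A triple $(F,G,B)$ with $f_{ii}=0$, $B\in O(J)$ is a solution of *system II* if $(f_{ij})_{x_i}+(f_{ji})_{x_j}+\sum_lf_{li}f_{lj}+\sum_lg_{li}g_{lj}=0$ for $i\ne j$, $(f_{ij})_{x_l}=f_{il}f_{lj}$ for distinct $i,j,l$, and $(b_{ij})_{x_l}=f_{lj}b_{il}$, $(g_{ij})_{x_l}=f_{lj}g_{il}$ for $j\neq l$. A smooth $m\times N$ matrix $X=(X_1,\dots,X_N)$ *corresponds* to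 the solution $(F,G,B)$ of system II through $A=(A_1,A_2)\in O(m)$ (where $A_1$ is $m\times N$) if $$A^{-1}dA=\sum_i\begin{pmatrix}-FC_i+C_iF^t&C_iG^t\\-GC_i&0\end{pmatrix}dx_i,\qquad dX=-\sum_iA_1C_iB^tJ\,dx_i .$$ **The action.** Let $s\in\mathbb R\setminus\{0\}$, $W\in\mathbb R^m$, $Z\in\mathbb R^N$ with $\|W\|=1$, $\langle Z,Z\rangle=1$. Put $\binom{\tilde W}{i\tilde Z}(x)=E(x,-is)^{-1}\binom{W}{iZ}$; in the Lorentzian case assume $\tilde W(x)\neq0$ for $x\in U$. Let $\hat W=\tilde W/\|\tilde W\|$ and $\hat Z=\tilde Z/\langle\tilde Z,\tilde Z\rangle^{1/2}$, let $\tilde\pi(x)$ be the orthogonal projection onto $\mathbb C\binom{\tilde W}{i\tilde Z}(x)$ for the sesquilinear form with matrix $\mathrm{diag}(I_m,J)$, and let $$g_{s,\pi}(\lambda)=\Big(\pi+\tfrac{\lambda-is}{\lambda+is}(I-\pi)\Big)\Big(\bar\pi+\tfrac{\lambda+is}{\lambda-is}(I-\bar\pi)\Big),\qquad \tilde E^\natural(x,\lambda)=E(x,\lambda)\,g_{s,\tilde\pi(x)}(\lambda)^{-1}.$$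 Define $\tilde A^\natural,\tilde B^\natural$ by $\tilde E^\natural(x,0)=\mathrm{diag}(\tilde A^\natural,\tilde B^\natural)$, and $\tilde F,\tilde G$ by $\binom{\tilde F}{\tilde G}=\binom FG-2s(\hat W\hat Z^tJ)_*$, where $(\cdot)_*$ replaces the entries $(i,i)$, $1\le i\le N$, by $0$. Let $e_i$, $\tilde e_i$ be the $i$-th columns of $A$, $\tilde A^\natural$. **Tuples.** $N$ smooth immersions $Y_1,\dots,Y_N$ of an open set $V\subset\mathbb R^N$ into $\mathbb R^m$ form an *$N$-tuple of type $O(J)$* if their normal spaces at each $x$ are parallel, they have a common orthonormal normal frame $(\eta_a)_{1\le a\le k}$, parallel for each of them, and their fundamental forms are $I_j=\sum_i\beta_{ji}^2dx_i^2$, $II_j=\sum_{i,a}\beta_{ji}\gamma_{ai}\,dx_i^2\,\eta_a$ for smooth $\beta$ with values in $O(J)$ and smooth $\gamma$. It is *non-degenerate* if for each $j$ and $x$ the space of shape operators of $Y_j$ at $x$ has dimension $N$. **Ribaucour transformations.** Let $Y,\tilde Y:V\to\mathbb R^m$ be immersions. Two lines $p+\mathbb Rv$, $q+\mathbb Rw$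 are said to *meet equidistantly* if they have a common point which is equidistant from $p$ and $q$, or if they are parallel (meet at infinity). A smooth vector bundle isomorphism $P$ from the normal bundle of $Y$ to that of $\tilde Y$, covering $Y(x)\mapsto\tilde Y(x)$, is a *Ribaucour transformation* if (a) it maps parallel normal fields to parallel normal fields; (b) for each non-zero normal vector $\eta$ at $x$ the lines $Y(x)+\mathbb R\eta$ and $\tilde Y(x)+\mathbb RP(\eta)$ meet equidistantly; (c) if $dY_x(u)$ spans an eigenspace of the shape operator $A_\eta$ of $Y$, then $d\tilde Y_x(u)$ is an eigenvector of the shape operator $A_{P(\eta)}$ of $\tilde Y$, and the lines $Y(x)+\mathbb R\,dY_x(u)$, $\tilde Y(x)+\mathbb R\,d\tilde Y_x(u)$ meet equidistantly; (d) for each $x$ there is a basis $u_1,\dots,u_N$ of $\mathbb R^N$, orthogonal for both first fundamental forms at $x$, such that for each $i$ the vector $dY_x(u_i)$ is an eigenvector of $A_\eta$ and $d\tilde Y_x(u_i)$ one of $A_{P(\eta)}$ for all normal $\eta$, and the lines $Y(x)+\mathbb R\,dY_x(u_i)$, $\tilde Y(x)+\mathbb R\,d\tilde Y_x(u_i)$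 meet equidistantly. **Theorem.** (0) $\tilde W,\tilde Z$ are real, $\|\tilde W\|^2=\langle\tilde Z,\tilde Z\rangle\neq0$, $\tilde E^\natural(x,0)$ is indeed real and block-diagonal, $\tilde A^\natural=A(I-2\hat W\hat W^t)$ and $\tilde B^\natural=B(I-2\hat Z\hat Z^tJ)$. (i) There are $X,\tilde X$ with $$\frac{\partial E}{\partial\lambda}(x,0)E(x,0)^{-1}=\begin{pmatrix}0&X\\-JX^t&0\end{pmatrix},\qquad\frac{\partial\tilde E^\natural}{\partial\lambda}(x,0)\tilde E^\natural(x,0)^{-1}=\begin{pmatrix}0&\tilde X\\-J\tilde X^t&0\end{pmatrix};$$ moreover $\tilde X=X+\frac2sA\hat W\hat Z^tB^tJ$, and $X$ corresponds to the solution $(F,G,B)$ of system II through $A$. Now let $X$ be any map which corresponds to $(F,G,B)$ through $A$ (for instance that of (i)), and let $\tilde X=X+\frac2sA\hat W\hat Z^tB^tJ$. (ii) On every open $V\subset U$ on which no entry of $B$ vanishes, $(X_1,\dots,X_N)$ is an $N$-tuple in $\mathbb R^m$ of type $O(J)$ with common parallel normal frame $(e_\alpha)_{N+1\le\alpha\le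 m}$ and $\beta=JB$, $\gamma=G$; it is non-degenerate if and only if $G$ has rank $N$ at every point of $V$. On every open $V\subset U$ on which no entry of $\tilde B^\natural$ vanishes, the same holds for $\tilde X$, $(\tilde e_\alpha)_{N+1\le\alpha\le m}$, $\beta=J\tilde B^\natural$, $\gamma=\tilde G$. (iii) $(\tilde F,\tilde G,\tilde B^\natural)$ is a solution of system II, and $\tilde X$ corresponds to it through $\tilde A^\natural$. (iv) For each $1\le j\le N$, on every open $V\subset U$ on which the entries of the $j$-th rows of $B$ and of $\tilde B^\natural$ do not vanish, the bundle map $P(e_\alpha(x))=\tilde e_\alpha(x)$, $N+1\le\alpha\le m$, is a Ribaucour transformation covering $X_j(x)\mapsto\tilde X_j(x)$. (v) For $1\le i\le m$ and $1\le j\le N$ there is a smooth function $\phi_{ij}$ on $\{x\in U:\hat w_i(x)\ne0\}$ with $X_j+\phi_{ij}e_i=\tilde X_j+\phi_{ij}\tilde e_i$ there; at the points where $\hat w_i=0$ one has $\tilde e_i=e_i$. -/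

import Mathlib

open Matrix
open scoped ContDiff

noncomputable section

namespace RibaucourDressing

/-! ## Conventions

`N` is the number of independent variables `x₁, …, x_N`, and `m = N + k`; the index set of `ℝ^m` is
`Fin N ⊕ Fin k`, where `Sum.inl i` stands for `i` and `Sum.inr a` for the index `N + a`.
A sign vector `ε : Fin N → ℝ` selects the bilinear form `∑ εᵢ zᵢ²` on `ℝ^N`: Euclidean (`O(N)`)
or Lorentzian (`O(N-1,1)`), and `J = diag ε`. -/

/-- All signs are `+1`: the Euclidean form. -/
def euclideanSign (N : ℕ) : Fin N → ℝ := fun _ => 1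

/-- The signs `(1, …, 1, -1)`: the Lorentzian form on `ℝ^{N-1,1}`. -/
def lorentzSign (N : ℕ) : Fin N → ℝ := fun i => if (i : ℕ) + 1 = N then -1 else 1

/-- The index set of `ℝ^m`, `m = N + k`. -/
abbrev MIdx (N k : ℕ) := Fin N ⊕ Fin k

/-- The index set of `ℝ^{m+N}`. -/
abbrev FIdx (N k : ℕ) := MIdx N k ⊕ Fin N

/-- Euclidean `ℝ^m`. -/
abbrev Amb (N k : ℕ) := EuclideanSpace ℝ (MIdx N k)

/-- The partial derivative `∂f/∂xᵢ`. -/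
def pd {N : ℕ} {V : Type*} [NormedAddCommGroup V] [NormedSpace ℝ V] (i : Fin N)
    (f : (Fin N → ℝ) → V) (x : Fin N → ℝ) : V :=
  fderiv ℝ f x (Pi.single i 1)

/-- Smoothness of a real matrix-valued map, entry by entry. -/
def SmoothMat {N : ℕ} {a b : Type*} (U : Set (Fin N → ℝ))
    (M : (Fin N → ℝ) → Matrix a b ℝ) : Prop :=
  ∀ p q, ContDiffOn ℝ ∞ (fun x => M x p q) U

/-- The entrywise partial derivative of a matrix-valued map. -/
def pdMat {N : ℕ} {a b : Type*} {𝕂 : Type*} [NormedAddCommGroup 𝕂] [NormedSpace ℝ 𝕂]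
    (i : Fin N) (M : (Fin N → ℝ) → Matrix a b 𝕂) (x : Fin N → ℝ) : Matrix a b 𝕂 :=
  Matrix.of fun p q => pd i (fun y => M y p q) x

/-- A real matrix regarded as a complex one. -/
def cplx {a b : Type*} (M : Matrix a b ℝ) : Matrix a b ℂ := M.map fun r => (r : ℂ)

/-! ## The first order systems and their frames -/

section Systems

variable {N k : ℕ}

/-- `Cᵢ`: the `N × N` matrix with a single `1` at `(i,i)`. -/
def matC (i : Fin N) : Matrix (Fin N) (Fin N) ℝ := Matrix.single i i 1

/-- `Dᵢ`: the `m × N` matrix with a single `1` at `(i,i)`. -/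
def matD (k : ℕ) (i : Fin N) : Matrix (MIdx N k) (Fin N) ℝ := Matrix.single (Sum.inl i) i 1

/-- The basis element `aᵢ = (0, -Dᵢ J; Dᵢᵗ, 0)` of the maximal abelian subalgebra. -/
def matA (k : ℕ) (ε : Fin N → ℝ) (i : Fin N) : Matrix (FIdx N k) (FIdx N k) ℝ :=
  Matrix.fromBlocks 0 (-(matD k i * Matrix.diagonal ε)) (matD k i)ᵀ 0

/-- The element `(0, ξ; -J ξᵗ, 0)` of `𝒫`. -/
def matP (ε : Fin N → ℝ) (ξ : Matrix (MIdx N k) (Fin N) ℝ) : Matrix (FIdx N k) (FIdx N k) ℝ :=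
  Matrix.fromBlocks 0 ξ (-(Matrix.diagonal ε * ξᵀ)) 0

/-- The commutator of two matrices. -/
def matComm {a : Type*} [Fintype a] (P Q : Matrix a a ℝ) : Matrix a a ℝ := P * Q - Q * P

/-- `ξ = (F; G)`. -/
def stack (F : (Fin N → ℝ) → Matrix (Fin N) (Fin N) ℝ) (G : (Fin N → ℝ) → Matrix (Fin k) (Fin N) ℝ)
    (x : Fin N → ℝ) : Matrix (MIdx N k) (Fin N) ℝ :=
  Matrix.fromRows (F x) (G x)

/-- `ξ = (F; G)` is a smooth solution on `U` of the system of the symmetric space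
`O(m+N)/(O(m)×O(N))`, resp. `O(m+N-1,1)/(O(m)×O(N-1,1))`:
`[aᵢ, v_{x_j}] - [a_j, v_{x_i}] = [[aᵢ, v], [a_j, v]]` with `v = (0, ξ; -J ξᵗ, 0)`, `ξᵢᵢ = 0`. -/
structure IsSystem (ε : Fin N → ℝ) (U : Set (Fin N → ℝ))
    (F : (Fin N → ℝ) → Matrix (Fin N) (Fin N) ℝ)
    (G : (Fin N → ℝ) → Matrix (Fin k) (Fin N) ℝ) : Prop where
  smoothF : SmoothMat U F
  smoothG : SmoothMat U G
  diag_zero : ∀ x ∈ U, ∀ i, F x i i = 0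
  eqn : ∀ x ∈ U, ∀ i j,
    matComm (matA k ε i) (matP ε (pdMat j (stack F G) x)) -
        matComm (matA k ε j) (matP ε (pdMat i (stack F G) x)) =
      matComm (matComm (matA k ε i) (matP ε (stack F G x))) (matComm (matA k ε j) (matP ε (stack F G x)))

/-- `(F, G, B)` is a smooth solution on `U` of the system II of the same symmetric space. -/
structure IsSystemII (ε : Fin N → ℝ) (U : Set (Fin N → ℝ))
    (F : (Fin N → ℝ) → Matrix (Fin N) (Fin N) ℝ)
    (G : (Fin N → ℝ) → Matrix (Fin k) (Fin N) ℝ)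
    (B : (Fin N → ℝ) → Matrix (Fin N) (Fin N) ℝ) : Prop where
  smoothF : SmoothMat U F
  smoothG : SmoothMat U G
  smoothB : SmoothMat U B
  diag_zero : ∀ x ∈ U, ∀ i, F x i i = 0
  orth : ∀ x ∈ U, (B x)ᵀ * Matrix.diagonal ε * B x = Matrix.diagonal ε
  eqn_gauss : ∀ x ∈ U, ∀ i j, i ≠ j →
    pd i (fun y => F y i j) x + pd j (fun y => F y j i) x +
      ∑ l, F x l i * F x l j + ∑ a, G x a i * G x a j = 0
  eqn_F : ∀ x ∈ U, ∀ i j l, i ≠ j → i ≠ l → j ≠ l →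
    pd l (fun y => F y i j) x = F x i l * F x l j
  eqn_B : ∀ x ∈ U, ∀ i j l, j ≠ l → pd l (fun y => B y i j) x = F x l j * B x i l
  eqn_G : ∀ x ∈ U, ∀ a j l, j ≠ l → pd l (fun y => G y a j) x = F x l j * G x a l

/-- The coefficient of `dxᵢ` in the Lax connection, `λ aᵢ + [aᵢ, v]`. -/
def lax (ε : Fin N → ℝ) (ξ : Matrix (MIdx N k) (Fin N) ℝ) (l : ℂ) (i : Fin N) :
    Matrix (FIdx N k) (FIdx N k) ℂ :=
  l • cplx (matA k ε i) + cplx (matComm (matA k ε i) (matP ε ξ))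

/-- The matrix `diag(I_m, J)` of the bilinear form on `ℝ^{m+N}`. -/
def formJ (k : ℕ) (ε : Fin N → ℝ) : Matrix (FIdx N k) (FIdx N k) ℝ :=
  Matrix.fromBlocks 1 0 0 (Matrix.diagonal ε)

/-- The matrix `diag(I_m, -I_N)` of the involution. -/
def invol (N k : ℕ) : Matrix (FIdx N k) (FIdx N k) ℝ := Matrix.fromBlocks 1 0 0 (-1)

/-- The reality condition for a map `g : ℂ → GL(m+N, ℂ)`. -/
structure Reality (ε : Fin N → ℝ) (g : ℂ → Matrix (FIdx N k) (FIdx N k) ℂ) : Prop where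
  real : ∀ l, (g (starRingEnd ℂ l)).map (starRingEnd ℂ) = g l
  twist : ∀ l, cplx (invol N k) * g l * cplx (invol N k) = g (-l)
  orth : ∀ l, (g l)ᵀ * cplx (formJ k ε) * g l = cplx (formJ k ε)

/-- `E(x, λ)` is a frame of `ξ = (F; G)` on `U`: a trivialization `E⁻¹ dE = θ_λ` of the Lax
connection for every `λ ∈ ℂ` which satisfies the reality condition, smooth in `(x, λ)` and
holomorphic in `λ ∈ ℂ`. -/
structure IsFrame (ε : Fin N → ℝ) (U : Set (Fin N → ℝ))
    (F : (Fin N → ℝ) → Matrix (Fin N) (Fin N) ℝ)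
    (G : (Fin N → ℝ) → Matrix (Fin k) (Fin N) ℝ)
    (E : (Fin N → ℝ) → ℂ → Matrix (FIdx N k) (FIdx N k) ℂ) : Prop where
  smooth : ∀ p q,
    ContDiffOn ℝ ∞ (fun z : (Fin N → ℝ) × ℂ => E z.1 z.2 p q) (U ×ˢ Set.univ)
  holo : ∀ x ∈ U, ∀ p q, Differentiable ℂ fun l => E x l p q
  triv : ∀ x ∈ U, ∀ l i, pdMat i (fun y => E y l) x = E x l * lax ε (stack F G x) l i
  reality : ∀ x ∈ U, Reality ε (E x)

/-- The block `A` in `E(x, 0) = diag(A, B)`. -/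
def blockA (E : (Fin N → ℝ) → ℂ → Matrix (FIdx N k) (FIdx N k) ℂ) (x : Fin N → ℝ) :
    Matrix (MIdx N k) (MIdx N k) ℝ :=
  (E x 0).toBlocks₁₁.map Complex.re

/-- The block `B` in `E(x, 0) = diag(A, B)`. -/
def blockB (E : (Fin N → ℝ) → ℂ → Matrix (FIdx N k) (FIdx N k) ℂ) (x : Fin N → ℝ) :
    Matrix (Fin N) (Fin N) ℝ :=
  (E x 0).toBlocks₂₂.map Complex.re

/-- The matrix `(∂E/∂λ)(x, 0) E(x, 0)⁻¹`. -/
def sym (E : (Fin N → ℝ) → ℂ → Matrix (FIdx N k) (FIdx N k) ℂ) (x : Fin N → ℝ) :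
    Matrix (FIdx N k) (FIdx N k) ℂ :=
  (Matrix.of fun p q => deriv (fun l => E x l p q) 0) * (E x 0)⁻¹

end Systems

/-! ## The action of the rational map with two simple poles -/

section Dressing

variable {N k : ℕ}

/-- The complex vector `(W; iZ)`. -/
def isoVec (W : MIdx N k → ℝ) (Z : Fin N → ℝ) : FIdx N k → ℂ :=
  Sum.elim (fun a => (W a : ℂ)) (fun j => Complex.I * (Z j : ℂ))

/-- The orthogonal projection of `ℂ^{m+N}` onto `ℂ u` with respect to the sesquilinear form
`⟨v, w⟩ = v* diag(I_m, J) w`, that is `w ↦ (⟨u, w⟩ / ⟨u, u⟩) u`. -/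
def proj (ε : Fin N → ℝ) (u : FIdx N k → ℂ) : Matrix (FIdx N k) (FIdx N k) ℂ :=
  (star u ⬝ᵥ (cplx (formJ k ε) *ᵥ u))⁻¹ • (Matrix.vecMulVec u (star u) * cplx (formJ k ε))

/-- The rational map
`g_{s,π}(λ) = (π + (λ-is)/(λ+is) (I-π)) (π̄ + (λ+is)/(λ-is) (I-π̄))`. -/
def simpleElt (s : ℝ) (π : Matrix (FIdx N k) (FIdx N k) ℂ) (l : ℂ) :
    Matrix (FIdx N k) (FIdx N k) ℂ :=
  (π + ((l - Complex.I * s) / (l + Complex.I * s)) • (1 - π)) *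
    (π.map (starRingEnd ℂ) +
      ((l + Complex.I * s) / (l - Complex.I * s)) • (1 - π.map (starRingEnd ℂ)))

/-- The vector `(W̃; iZ̃)(x) = E(x, -is)⁻¹ (W; iZ)`. -/
def tildeVec (E : (Fin N → ℝ) → ℂ → Matrix (FIdx N k) (FIdx N k) ℂ) (s : ℝ)
    (W : MIdx N k → ℝ) (Z : Fin N → ℝ) (x : Fin N → ℝ) : FIdx N k → ℂ :=
  (E x (-(Complex.I * s)))⁻¹ *ᵥ isoVec W Z

/-- `W̃`. -/
def tildeW (E : (Fin N → ℝ) → ℂ → Matrix (FIdx N k) (FIdx N k) ℂ) (s : ℝ)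
    (W : MIdx N k → ℝ) (Z : Fin N → ℝ) (x : Fin N → ℝ) : MIdx N k → ℝ :=
  fun a => (tildeVec E s W Z x (Sum.inl a)).re

/-- `Z̃`. -/
def tildeZ (E : (Fin N → ℝ) → ℂ → Matrix (FIdx N k) (FIdx N k) ℂ) (s : ℝ)
    (W : MIdx N k → ℝ) (Z : Fin N → ℝ) (x : Fin N → ℝ) : Fin N → ℝ :=
  fun j => (tildeVec E s W Z x (Sum.inr j)).im

/-- `Ŵ = W̃ / ‖W̃‖`. -/
def hatW (E : (Fin N → ℝ) → ℂ → Matrix (FIdx N k) (FIdx N k) ℂ) (s : ℝ)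
    (W : MIdx N k → ℝ) (Z : Fin N → ℝ) (x : Fin N → ℝ) : MIdx N k → ℝ :=
  (√(∑ a, tildeW E s W Z x a ^ 2))⁻¹ • tildeW E s W Z x

/-- `Ẑ = Z̃ / ‖Z̃‖`, the norm being that of the form `∑ εⱼ zⱼ²`. -/
def hatZ (ε : Fin N → ℝ) (E : (Fin N → ℝ) → ℂ → Matrix (FIdx N k) (FIdx N k) ℂ) (s : ℝ)
    (W : MIdx N k → ℝ) (Z : Fin N → ℝ) (x : Fin N → ℝ) : Fin N → ℝ :=
  (√(∑ j, ε j * tildeZ E s W Z x j ^ 2))⁻¹ • tildeZ E s W Z x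

/-- The new frame `Ẽ♮(x, λ) = E(x, λ) g_{s,π̃(x)}(λ)⁻¹`, where `π̃(x)` is the projection onto
`ℂ (W̃; iZ̃)(x)`. -/
def newFrame (ε : Fin N → ℝ) (E : (Fin N → ℝ) → ℂ → Matrix (FIdx N k) (FIdx N k) ℂ) (s : ℝ)
    (W : MIdx N k → ℝ) (Z : Fin N → ℝ) (x : Fin N → ℝ) (l : ℂ) :
    Matrix (FIdx N k) (FIdx N k) ℂ :=
  E x l * (simpleElt s (proj ε (tildeVec E s W Z x)) l)⁻¹

/-- `F̃`: the first block of `ξ̃ = ξ - 2s (Ŵ Ẑᵗ J)_*`, where `(·)_*` replaces the entries `(i,i)`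
by zero. -/
def newF (ε : Fin N → ℝ) (F : (Fin N → ℝ) → Matrix (Fin N) (Fin N) ℝ)
    (E : (Fin N → ℝ) → ℂ → Matrix (FIdx N k) (FIdx N k) ℂ) (s : ℝ)
    (W : MIdx N k → ℝ) (Z : Fin N → ℝ) (x : Fin N → ℝ) : Matrix (Fin N) (Fin N) ℝ :=
  Matrix.of fun i j =>
    F x i j - 2 * s * (if i = j then 0 else hatW E s W Z x (Sum.inl i) * hatZ ε E s W Z x j * ε j)

/-- `G̃`: the second block of `ξ̃ = ξ - 2s (Ŵ Ẑᵗ J)_*`. -/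
def newG (ε : Fin N → ℝ) (G : (Fin N → ℝ) → Matrix (Fin k) (Fin N) ℝ)
    (E : (Fin N → ℝ) → ℂ → Matrix (FIdx N k) (FIdx N k) ℂ) (s : ℝ)
    (W : MIdx N k → ℝ) (Z : Fin N → ℝ) (x : Fin N → ℝ) : Matrix (Fin k) (Fin N) ℝ :=
  Matrix.of fun a j =>
    G x a j - 2 * s * (hatW E s W Z x (Sum.inr a) * hatZ ε E s W Z x j * ε j)

/-- `Ã♮`, from `Ẽ♮(x, 0) = diag(Ã♮, B̃♮)`. -/
def newA (ε : Fin N → ℝ) (E : (Fin N → ℝ) → ℂ → Matrix (FIdx N k) (FIdx N k) ℂ) (s : ℝ)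
    (W : MIdx N k → ℝ) (Z : Fin N → ℝ) (x : Fin N → ℝ) : Matrix (MIdx N k) (MIdx N k) ℝ :=
  blockA (newFrame ε E s W Z) x

/-- `B̃♮`, from `Ẽ♮(x, 0) = diag(Ã♮, B̃♮)`. -/
def newB (ε : Fin N → ℝ) (E : (Fin N → ℝ) → ℂ → Matrix (FIdx N k) (FIdx N k) ℂ) (s : ℝ)
    (W : MIdx N k → ℝ) (Z : Fin N → ℝ) (x : Fin N → ℝ) : Matrix (Fin N) (Fin N) ℝ :=
  blockB (newFrame ε E s W Z) x

/-- `X̃ = X + (2/s) A Ŵ Ẑᵗ Bᵗ J`. -/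
def newX (ε : Fin N → ℝ) (E : (Fin N → ℝ) → ℂ → Matrix (FIdx N k) (FIdx N k) ℂ) (s : ℝ)
    (W : MIdx N k → ℝ) (Z : Fin N → ℝ) (X : (Fin N → ℝ) → Matrix (MIdx N k) (Fin N) ℝ)
    (x : Fin N → ℝ) : Matrix (MIdx N k) (Fin N) ℝ :=
  X x + (2 / s) • (blockA E x * Matrix.vecMulVec (hatW E s W Z x) (hatZ ε E s W Z x) *
    (blockB E x)ᵀ * Matrix.diagonal ε)

end Dressing

/-! ## Submanifolds of Euclidean space, given by an immersion `Y : U ⊆ ℝ^N → ℝ^m` -/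

section Submanifolds

variable {N k : ℕ}

/-- `Y` is a smooth immersion of `U`. -/
def IsImmersionOn (U : Set (Fin N → ℝ)) (Y : (Fin N → ℝ) → Amb N k) : Prop :=
  ContDiffOn ℝ ∞ Y U ∧ ∀ x ∈ U, Function.Injective (fderiv ℝ Y x)

/-- The tangent space at `Y(x)`. -/
def tangentSpace (Y : (Fin N → ℝ) → Amb N k) (x : Fin N → ℝ) : Submodule ℝ (Amb N k) :=
  LinearMap.range (fderiv ℝ Y x).toLinearMap

/-- The normal space at `Y(x)`. -/
def normalSpace (Y : (Fin N → ℝ) → Amb N k) (x : Fin N → ℝ) : Submodule ℝ (Amb N k) :=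
  (tangentSpace Y x)ᗮ

/-- The first fundamental form, in the coordinates `x`. -/
def firstForm (Y : (Fin N → ℝ) → Amb N k) (x u v : Fin N → ℝ) : ℝ :=
  inner ℝ (fderiv ℝ Y x u) (fderiv ℝ Y x v)

/-- The vector-valued second fundamental form, in the coordinates `x`: the normal part of the
second derivative. -/
def secondForm (Y : (Fin N → ℝ) → Amb N k) (x u v : Fin N → ℝ) : Amb N k :=
  (tangentSpace Y x)ᗮ.starProjection (fderiv ℝ (fun y => fderiv ℝ Y y v) x u)

/-- The shape operator `A_η`, determined by `I(A_η u, v) = ⟨II(u, v), η⟩`, as a matrix in the basis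
`∂/∂x₁, …, ∂/∂x_N` of the tangent space. -/
def shape (Y : (Fin N → ℝ) → Amb N k) (x : Fin N → ℝ) (η : Amb N k) :
    Matrix (Fin N) (Fin N) ℝ :=
  (Matrix.of fun i j => firstForm Y x (Pi.single i 1) (Pi.single j 1))⁻¹ *
    Matrix.of fun i j => inner ℝ (secondForm Y x (Pi.single i 1) (Pi.single j 1)) η

/-- `η` is a smooth parallel normal field on `U`: `∇^⊥ η = 0`. -/
def IsParallelNormal (U : Set (Fin N → ℝ)) (Y η : (Fin N → ℝ) → Amb N k) : Prop :=
  ContDiffOn ℝ ∞ η U ∧ ∀ x ∈ U, η x ∈ normalSpace Y x ∧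
    ∀ u, (tangentSpace Y x)ᗮ.starProjection (fderiv ℝ η x u) = 0

/-- The normal bundle is non-degenerate at `x`: the space of shape operators has dimension `N`. -/
def NondegenerateAt (Y : (Fin N → ℝ) → Amb N k) (x : Fin N → ℝ) : Prop :=
  Module.finrank ℝ
    (Submodule.span ℝ (shape Y x '' (normalSpace Y x : Set (Amb N k)))) = N

/-- All of the definition of an `N`-tuple `(Y₁, …, Y_N)` in `ℝ^m` of type `O(N)` (`ε` Euclidean),
resp. of type `O(N-1,1)` (`ε` Lorentzian), except the non-degeneracy of the normal bundles.
`e` is the common parallel orthonormal normal frame (so that the normal bundles are flat), and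
`B`, `G` are the maps which occur in the fundamental forms. -/
structure IsPreTuple (ε : Fin N → ℝ) (U : Set (Fin N → ℝ))
    (Y : Fin N → (Fin N → ℝ) → Amb N k) (e : Fin k → (Fin N → ℝ) → Amb N k)
    (B : (Fin N → ℝ) → Matrix (Fin N) (Fin N) ℝ)
    (G : (Fin N → ℝ) → Matrix (Fin k) (Fin N) ℝ) : Prop where
  immersion : ∀ j, IsImmersionOn U (Y j)
  common_normal : ∀ i j, ∀ x ∈ U, normalSpace (Y i) x = normalSpace (Y j) x
  orthonormal : ∀ x ∈ U, Orthonormal ℝ fun a => e a x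
  parallel : ∀ j a, IsParallelNormal U (Y j) (e a)
  smoothB : SmoothMat U B
  smoothG : SmoothMat U G
  orth : ∀ x ∈ U, (B x)ᵀ * Matrix.diagonal ε * B x = Matrix.diagonal ε
  first : ∀ j, ∀ x ∈ U, ∀ u v, firstForm (Y j) x u v = ∑ i, B x j i ^ 2 * u i * v i
  second : ∀ j, ∀ x ∈ U, ∀ u v,
    secondForm (Y j) x u v = ∑ i, ∑ a, (B x j i * G x a i * u i * v i) • e a x

/-- `(Y₁, …, Y_N)` is an `N`-tuple in `ℝ^m` of type `O(N)`, resp. `O(N-1,1)`, with common parallel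
normal frame `e` and fundamental forms given by `B`, `G`. -/
structure IsTuple (ε : Fin N → ℝ) (U : Set (Fin N → ℝ))
    (Y : Fin N → (Fin N → ℝ) → Amb N k) (e : Fin k → (Fin N → ℝ) → Amb N k)
    (B : (Fin N → ℝ) → Matrix (Fin N) (Fin N) ℝ)
    (G : (Fin N → ℝ) → Matrix (Fin k) (Fin N) ℝ) : Prop extends IsPreTuple ε U Y e B G where
  nondegenerate : ∀ j, ∀ x ∈ U, NondegenerateAt (Y j) x

/-- The lines `p + ℝ v` and `q + ℝ w` meet at a point equidistant from `p` and `q`, or they are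
parallel (they meet at infinity). -/
def MeetEquidistant (p v q w : Amb N k) : Prop :=
  (∃ t t' : ℝ, p + t • v = q + t' • w ∧ ‖t • v‖ = ‖t' • w‖) ∨ ∃ c : ℝ, c ≠ 0 ∧ w = c • v

/-- The bundle map `P(x) : ν(Y)_x → ν(Y')_x` is a Ribaucour transformation which covers
`Y(x) ↦ Y'(x)`. Tangent vectors are written in the coordinates `x`, in which the covered map is the
identity, so that its differential maps `dY_x(u)` to `dY'_x(u)`. A principal direction `u` of
`A_η` is one that spans an eigenspace of `A_η`; moreover, at each point there is a basis of common
principal directions with the required properties. -/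
structure IsRibaucour (U : Set (Fin N → ℝ)) (Y Y' : (Fin N → ℝ) → Amb N k)
    (P : (Fin N → ℝ) → (Amb N k →L[ℝ] Amb N k)) : Prop where
  immersion : IsImmersionOn U Y
  immersion' : IsImmersionOn U Y'
  smooth : ContDiffOn ℝ ∞ P U
  bij : ∀ x ∈ U, Set.BijOn (P x) (normalSpace Y x) (normalSpace Y' x)
  parallel : ∀ V ⊆ U, IsOpen V → ∀ η, IsParallelNormal V Y η →
    IsParallelNormal V Y' fun x => P x (η x)
  normal_lines : ∀ x ∈ U, ∀ η ∈ normalSpace Y x, η ≠ 0 → MeetEquidistant (Y x) η (Y' x) (P x η)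
  principal : ∀ x ∈ U, ∀ η ∈ normalSpace Y x, ∀ (c : ℝ) (u : Fin N → ℝ), u ≠ 0 →
    shape Y x η *ᵥ u = c • u → (∀ v, shape Y x η *ᵥ v = c • v → ∃ r : ℝ, v = r • u) →
    (∃ c' : ℝ, shape Y' x (P x η) *ᵥ u = c' • u) ∧
      MeetEquidistant (Y x) (fderiv ℝ Y x u) (Y' x) (fderiv ℝ Y' x u)
  principal_basis : ∀ x ∈ U, ∃ b : Module.Basis (Fin N) ℝ (Fin N → ℝ),
    (∀ i j, i ≠ j → firstForm Y x (b i) (b j) = 0 ∧ firstForm Y' x (b i) (b j) = 0) ∧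
    ∀ i, (∀ η ∈ normalSpace Y x, (∃ c : ℝ, shape Y x η *ᵥ b i = c • b i) ∧
        ∃ c' : ℝ, shape Y' x (P x η) *ᵥ b i = c' • b i) ∧
      MeetEquidistant (Y x) (fderiv ℝ Y x (b i)) (Y' x) (fderiv ℝ Y' x (b i))

/-- The `j`-th column of `M(x)`, as a vector of Euclidean `ℝ^m`. -/
def colVec {b : Type*} (M : (Fin N → ℝ) → Matrix (MIdx N k) b ℝ) (j : b) (x : Fin N → ℝ) :
    Amb N k :=
  WithLp.toLp 2 fun a => M x a j

/-- The columns `e_{N+1}, …, e_m` of `A`. -/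
def normalFrame (A : (Fin N → ℝ) → Matrix (MIdx N k) (MIdx N k) ℝ) (a : Fin k) :
    (Fin N → ℝ) → Amb N k :=
  colVec A (Sum.inr a)

/-- The bundle map with `P(e_α) = ẽ_α` for `N + 1 ≤ α ≤ m`, where `e_i`, `ẽ_i` are the columns of
`A`, `A'` (extended by zero to the orthogonal complement of the `e_α`). -/
def frameMap (A A' : (Fin N → ℝ) → Matrix (MIdx N k) (MIdx N k) ℝ) (x : Fin N → ℝ) :
    Amb N k →L[ℝ] Amb N k :=
  ∑ a, (innerSL ℝ (normalFrame A a x)).smulRight (normalFrame A' a x)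

/-- `X` corresponds to the solution `(F, G, B)` of the system II through the adapted frame `A`:
`A⁻¹ dA = ∑ (-F Cᵢ + Cᵢ Fᵗ, Cᵢ Gᵗ; -G Cᵢ, 0) dxᵢ` and `dX = -∑ A₁ Cᵢ Bᵗ J dxᵢ`, where
`A = (A₁, A₂)` is orthogonal. -/
structure Corresponds (ε : Fin N → ℝ) (U : Set (Fin N → ℝ))
    (F : (Fin N → ℝ) → Matrix (Fin N) (Fin N) ℝ)
    (G : (Fin N → ℝ) → Matrix (Fin k) (Fin N) ℝ)
    (B : (Fin N → ℝ) → Matrix (Fin N) (Fin N) ℝ)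
    (A : (Fin N → ℝ) → Matrix (MIdx N k) (MIdx N k) ℝ)
    (X : (Fin N → ℝ) → Matrix (MIdx N k) (Fin N) ℝ) : Prop where
  system : IsSystemII ε U F G B
  smoothA : SmoothMat U A
  smoothX : SmoothMat U X
  orthA : ∀ x ∈ U, (A x)ᵀ * A x = 1
  eqA : ∀ x ∈ U, ∀ i, pdMat i A x = A x *
    Matrix.fromBlocks (-(F x * matC i) + matC i * (F x)ᵀ) (matC i * (G x)ᵀ) (-(G x * matC i)) 0
  eqX : ∀ x ∈ U, ∀ i,
    pdMat i X x = -((A x).toCols₁ * matC i * (B x)ᵀ * Matrix.diagonal ε)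

end Submanifolds

end RibaucourDressing

end

/-! Everything produced by the dressing depends on E at three places only: its value at λ = -is, its
value at λ = 0, and its λ-derivative at 0. The reality conditions make E(x, -is) commute with an
antilinear involution whose fixed vectors are the (w; iz) with w, z real, and preserve the complex
bilinear form diag(I, J). So the pole vector stays of this shape and stays isotropic, which is the
equality of the two squared norms (`IsFrame.tildeVec_eq`, `IsFrame.sum_tildeW_sq`). Differentiating
E(x, -is) (W̃; iZ̃) = const and normalizing gives a closed first order system for the pair (ŵ, ẑ),
recorded in `IsPolePair`.

Write the projection as π = (S + iT)/2 with S, T real. Then S² = S, ST = TS = T and T² = -S, so g⁻¹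
is an explicit rational combination of 1, S, T (`simpleElt_inv`), with value 1 - 2S and derivative
(2/s)T at λ = 0. Hence A and B are multiplied by reflections, and (∂E/∂λ)E⁻¹ changes by a rank one
term (`IsFrame.sym_newFrame`). That the original X corresponds to (F, G, B) is Sym's formula
(`IsFrame.corresponds`): at λ = 0 the derivative of (∂E/∂λ)E⁻¹ along x_i is E a_i E⁻¹.

The new system II and the new correspondence are checked directly from the pole system, without
using that the new frame trivializes a Lax connection (`IsPolePair.corresponds`). Therefore any X
that corresponds to (F, G, B) may be transformed.

The geometry of a corresponding X is read off its frame: dX_j is diagonal in e_1, …, e_N, and the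
derivatives of e_{N+1}, …, e_m are tangential with coefficients G. Thus the x_i are curvature line
coordinates (`Corresponds.shape_eq`) and the rank of G is the dimension of the space of shape
operators. Finally, with n = Aŵ, both ẽ_p - e_p and X̃_j - X_j are multiples of n. Two corresponding
lines therefore lie in a common plane and meet equidistantly or are parallel;
`Corresponds.isRibaucour` needs nothing else. -/

namespace RibaucourDressing

/-! ### Rules for partial derivatives. -/

section Calculus

variable {N : ℕ} {x : Fin N → ℝ} (i : Fin N) {f g : (Fin N → ℝ) → ℝ}

theorem pd_add (hf : DifferentiableAt ℝ f x) (hg : DifferentiableAt ℝ g x) :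
    pd i (fun y => f y + g y) x = pd i f x + pd i g x := by
  simp [pd, fderiv_fun_add hf hg]

theorem pd_sub (hf : DifferentiableAt ℝ f x) (hg : DifferentiableAt ℝ g x) :
    pd i (fun y => f y - g y) x = pd i f x - pd i g x := by
  simp [pd, fderiv_fun_sub hf hg]

theorem pd_mul {𝔸 : Type*} [NormedCommRing 𝔸] [NormedAlgebra ℝ 𝔸] {f g : (Fin N → ℝ) → 𝔸}
    (hf : DifferentiableAt ℝ f x) (hg : DifferentiableAt ℝ g x) :
    pd i (fun y => f y * g y) x = pd i f x * g x + f x * pd i g x := by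
  simp [pd, fderiv_fun_mul hf hg]; ring

theorem pd_const_mul (c : ℝ) (hf : DifferentiableAt ℝ f x) :
    pd i (fun y => c * f y) x = c * pd i f x := by
  simp [pd, fderiv_const_mul hf]

theorem pd_mul_const (c : ℝ) (hf : DifferentiableAt ℝ f x) :
    pd i (fun y => f y * c) x = pd i f x * c := by
  rw [show (fun y => f y * c) = fun y => c * f y from funext fun y => mul_comm _ _,
    pd_const_mul i c hf, mul_comm]

theorem pd_sum {V : Type*} [NormedAddCommGroup V] [NormedSpace ℝ V] {ι : Type*} (t : Finset ι)
    {h : ι → (Fin N → ℝ) → V}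
    (hh : ∀ a ∈ t, DifferentiableAt ℝ (h a) x) :
    pd i (fun y => ∑ a ∈ t, h a y) x = ∑ a ∈ t, pd i (h a) x := by
  simp [pd, fderiv_fun_sum hh]

theorem pd_clm {V V' : Type*} [NormedAddCommGroup V] [NormedSpace ℝ V] [NormedAddCommGroup V']
    [NormedSpace ℝ V'] (L : V →L[ℝ] V') {f : (Fin N → ℝ) → V} (hf : DifferentiableAt ℝ f x) :
    pd i (fun y => L (f y)) x = L (pd i f x) := by
  have := (L.hasFDerivAt.comp x hf.hasFDerivAt).fderiv
  rw [pd, show (fun y => L (f y)) = L ∘ f from rfl, this]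
  rfl

theorem pd_comp_scalar {g : ℝ → ℝ} {g' : ℝ} (hg : HasDerivAt g g' (f x))
    (hf : DifferentiableAt ℝ f x) : pd i (fun y => g (f y)) x = g' * pd i f x := by
  rw [pd, show (fun y => g (f y)) = g ∘ f from rfl,
    (hg.comp_hasFDerivAt x hf.hasFDerivAt).fderiv]
  rfl

theorem pd_congr {V : Type*} [NormedAddCommGroup V] [NormedSpace ℝ V] {U : Set (Fin N → ℝ)}
    (hU : IsOpen U) (hx : x ∈ U) {f g : (Fin N → ℝ) → V} (h : ∀ y ∈ U, f y = g y) :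
    pd i f x = pd i g x := by
  have : f =ᶠ[nhds x] g := Filter.eventuallyEq_of_mem (hU.mem_nhds hx) h
  simp [pd, this.fderiv_eq]

theorem fderiv_apply_eq_sum_pd {V : Type*} [NormedAddCommGroup V] [NormedSpace ℝ V]
    (f : (Fin N → ℝ) → V) (x u : Fin N → ℝ) : fderiv ℝ f x u = ∑ i, u i • pd i f x := by
  conv_lhs => rw [pi_eq_sum_univ' u]
  simp only [map_sum, map_smul, pd]

end Calculus

theorem _root_.ContDiffOn.differentiableAt_of_isOpen {E F : Type*} [NormedAddCommGroup E]
    [NormedSpace ℝ E] [NormedAddCommGroup F] [NormedSpace ℝ F] {f : E → F} {U : Set E} {x : E}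
    (hf : ContDiffOn ℝ ∞ f U) (hU : IsOpen U) (hx : x ∈ U) : DifferentiableAt ℝ f x :=
  (hf.contDiffAt (hU.mem_nhds hx)).differentiableAt (by simp)

/-! ### The λ-independent part [a_i, v] of the connection and its curvature equation. -/

section Connection

variable {N k : ℕ}

/-- The `O(m)`-block of `[aᵢ, v]`. -/
def connA (ξ : Matrix (MIdx N k) (Fin N) ℝ) (i : Fin N) : Matrix (MIdx N k) (MIdx N k) ℝ :=
  Matrix.of fun p q => (if p = Sum.inl i then ξ q i else 0) - if q = Sum.inl i then ξ p i else 0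

/-- The `O(J)`-block of `[aᵢ, v]`. -/
def connB (ε : Fin N → ℝ) (ξ : Matrix (MIdx N k) (Fin N) ℝ) (i : Fin N) :
    Matrix (Fin N) (Fin N) ℝ :=
  Matrix.of fun p q => (if p = i then ξ (Sum.inl i) q else 0) -
    if q = i then ε p * ξ (Sum.inl i) p * ε i else 0

theorem sign_mul_self {ε : Fin N → ℝ} (hε : ε = euclideanSign N ∨ ε = lorentzSign N) (i : Fin N) :
    ε i * ε i = 1 := by
  rcases hε with rfl | rfl
  · simp [euclideanSign]
  · simp only [lorentzSign]; split_ifs <;> norm_num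

/-- Both matrices are off-diagonal, so their products are block-diagonal. The relation J² = 1 enters
only in the upper block, where the two factors J meet. -/
theorem matComm_matA_matP {ε : Fin N → ℝ} (hε : ∀ i, ε i * ε i = 1)
    (ξ : Matrix (MIdx N k) (Fin N) ℝ) (i : Fin N) :
    matComm (matA k ε i) (matP ε ξ) = Matrix.fromBlocks (connA ξ i) 0 0 (connB ε ξ i) := by
  have hJ : Matrix.diagonal ε * Matrix.diagonal ε = 1 := by
    rw [Matrix.diagonal_mul_diagonal]; simp [hε]
  have h1 : matD k i * ξᵀ - ξ * (matD k i)ᵀ = connA ξ i := by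
    ext p q
    simp [matD, connA, Matrix.mul_apply, Matrix.single_apply, ite_and, eq_comm]
  have h2 : (matD k i)ᵀ * ξ - Matrix.diagonal ε * ξᵀ * matD k i * Matrix.diagonal ε =
      connB ε ξ i := by
    ext p q
    simp [matD, connB, Matrix.mul_apply, Matrix.single_apply, ite_and, Matrix.diagonal_apply,
      Finset.sum_ite_eq, eq_comm]
    by_cases h : q = i
    · simp [h]
    · simp [Ne.symm h]
  rw [matComm, matA, matP, Matrix.fromBlocks_multiply, Matrix.fromBlocks_multiply, sub_eq_add_neg,
    Matrix.fromBlocks_neg, Matrix.fromBlocks_add, ← h1, ← h2]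
  congr 1
  · have : -(matD k i * Matrix.diagonal ε) * -(Matrix.diagonal ε * ξᵀ) = matD k i * ξᵀ := by
      rw [Matrix.neg_mul, Matrix.mul_neg, neg_neg, Matrix.mul_assoc, ← Matrix.mul_assoc (Matrix.diagonal ε), hJ, Matrix.one_mul]
    rw [this]; simp [sub_eq_add_neg]
  · simp
  · simp
  · simp [sub_eq_add_neg, Matrix.mul_assoc]

theorem connA_eq_fromBlocks (F : Matrix (Fin N) (Fin N) ℝ) (G : Matrix (Fin k) (Fin N) ℝ)
    (i : Fin N) : connA (Matrix.fromRows F G) i =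
      Matrix.fromBlocks (-(F * matC i) + matC i * Fᵀ) (matC i * Gᵀ) (-(G * matC i)) 0 := by
  ext p q
  rcases p with p | p <;> rcases q with q | q <;>
    simp [connA, matC, Matrix.mul_apply, Matrix.single_apply, ite_and, eq_comm] 
  ring

/-- `connA ξ i` lives on one row and one column. Away from that column a product with it is a single
term, and that is where the equations of system II are read off. -/
theorem mul_connA_apply {a : Type*} (M : Matrix a (MIdx N k) ℝ) (ξ : Matrix (MIdx N k) (Fin N) ℝ)
    (i : Fin N) (p : a) (q : MIdx N k) : (M * connA ξ i) p q =
      M p (Sum.inl i) * ξ q i - if q = Sum.inl i then ∑ r, M p r * ξ r i else 0 := by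
  by_cases h : q = Sum.inl i <;>
  simp [connA, Matrix.mul_apply, mul_sub, Finset.sum_sub_distrib, h]

theorem mul_connB_apply {a : Type*} (ε : Fin N → ℝ) (M : Matrix a (Fin N) ℝ)
    (ξ : Matrix (MIdx N k) (Fin N) ℝ) (i : Fin N) (p : a) (q : Fin N) : (M * connB ε ξ i) p q =
      M p i * ξ (Sum.inl i) q -
        if q = i then ε i * ∑ r, M p r * ε r * ξ (Sum.inl i) r else 0 := by
  by_cases h : q = i
  · simp [connB, Matrix.mul_apply, mul_sub, Finset.sum_sub_distrib, h, Finset.mul_sum]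
    exact Finset.sum_congr rfl fun r _ => by ring
  · simp [connB, Matrix.mul_apply, h]

theorem connA_mulVec (ξ : Matrix (MIdx N k) (Fin N) ℝ) (i : Fin N) (w : MIdx N k → ℝ)
    (p : MIdx N k) : (connA ξ i *ᵥ w) p =
      (if p = Sum.inl i then ∑ r, ξ r i * w r else 0) - ξ p i * w (Sum.inl i) := by
  by_cases h : p = Sum.inl i <;>
  simp [connA, Matrix.mulVec, dotProduct, sub_mul, Finset.sum_sub_distrib, h]

theorem connB_mulVec (ε : Fin N → ℝ) (ξ : Matrix (MIdx N k) (Fin N) ℝ) (i : Fin N) (z : Fin N → ℝ)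
    (p : Fin N) : (connB ε ξ i *ᵥ z) p =
      (if p = i then ∑ r, ξ (Sum.inl i) r * z r else 0) - ε p * ξ (Sum.inl i) p * (ε i * z i) := by
  by_cases h : p = i <;>
  simp [connB, Matrix.mulVec, dotProduct, sub_mul, Finset.sum_sub_distrib, h, mul_assoc]

variable {ε : Fin N → ℝ} {U : Set (Fin N → ℝ)} {F : (Fin N → ℝ) → Matrix (Fin N) (Fin N) ℝ}
  {G : (Fin N → ℝ) → Matrix (Fin k) (Fin N) ℝ}

/-- The O(m) block of the system, which is flatness of A⁻¹dA. It already contains every equation of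
system II for F and G; those for B will come from the frame. -/
theorem IsSystem.curvature (h : IsSystem ε U F G) (hε : ∀ i, ε i * ε i = 1) {x : Fin N → ℝ}
    (hx : x ∈ U) (i j : Fin N) :
    connA (pdMat j (stack F G) x) i - connA (pdMat i (stack F G) x) j =
      connA (stack F G x) i * connA (stack F G x) j -
        connA (stack F G x) j * connA (stack F G x) i := by
  have := congrArg Matrix.toBlocks₁₁ (h.eqn x hx i j)
  simp only [matComm_matA_matP hε] at this
  ext p q
  have := congrFun (congrFun this p) q
  simpa [Matrix.toBlocks₁₁, matComm, Matrix.fromBlocks_multiply] using this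

theorem IsSystem.pd_stack (h : IsSystem ε U F G) (hε : ∀ i, ε i * ε i = 1) {x : Fin N → ℝ}
    (hx : x ∈ U) {p : MIdx N k} {j l : Fin N} (hp : p ≠ Sum.inl l) (hj : p ≠ Sum.inl j)
    (hjl : j ≠ l) :
    pd l (fun y => stack F G y p j) x = stack F G x p l * F x l j := by
  -- Curvature in the (l, j) plane, in a row p different from both indices: one derivative and one
  -- product survive. Rows of F and of G are treated together.
  have := congrFun (congrFun (h.curvature hε hx l j) p) (Sum.inl j)
  rw [Matrix.sub_apply, Matrix.sub_apply, mul_connA_apply, mul_connA_apply] at this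
  have h3 := h.diag_zero x hx
  simpa [connA, hp, hj, hjl, hjl.symm, stack, pdMat, h3] using this

theorem IsSystem.gauss (h : IsSystem ε U F G) (hε : ∀ i, ε i * ε i = 1) {x : Fin N → ℝ}
    (hx : x ∈ U) {i j : Fin N} (hij : i ≠ j) :
    pd i (fun y => F y i j) x + pd j (fun y => F y j i) x +
      ∑ l, F x l i * F x l j + ∑ a, G x a i * G x a j = 0 := by
  have := congrFun (congrFun (h.curvature hε hx i j) (Sum.inl i)) (Sum.inl j)
  rw [Matrix.sub_apply, Matrix.sub_apply, mul_connA_apply, mul_connA_apply] at this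
  have h3 := h.diag_zero x hx
  simp [connA, hij, hij.symm, stack, pdMat, h3] at this
  linarith

end Connection

/-! ### Columns of matrix-valued maps as vectors of Euclidean space. -/

section Columns

variable {N k : ℕ} {b : Type*} {U : Set (Fin N → ℝ)} {x : Fin N → ℝ}

theorem contDiffOn_colVec {M : (Fin N → ℝ) → Matrix (MIdx N k) b ℝ} (hM : SmoothMat U M) (j : b) :
    ContDiffOn ℝ ∞ (colVec M j) U :=
  contDiffOn_euclidean.2 fun a => hM a j

theorem inner_colVec {c : Type*} (M : (Fin N → ℝ) → Matrix (MIdx N k) b ℝ)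
    (M' : (Fin N → ℝ) → Matrix (MIdx N k) c ℝ) (p : b) (q : c) :
    inner ℝ (colVec M p x) (colVec M' q x) = ((M x)ᵀ * M' x) p q := by
  simp [colVec, PiLp.inner_apply, Matrix.mul_apply, mul_comm]

theorem pd_apply_euclidean {f : (Fin N → ℝ) → Amb N k} (hf : DifferentiableAt ℝ f x) (i : Fin N)
    (a : MIdx N k) : pd i f x a = pd i (fun y => f y a) x :=
  (pd_clm i (EuclideanSpace.proj (𝕜 := ℝ) (ι := MIdx N k) a) hf).symm

end Columns

/-! ### Fundamental forms and shape operators of the columns of a corresponding X. -/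

section Geometry

variable {N k : ℕ} {ε : Fin N → ℝ} {U : Set (Fin N → ℝ)}
  {F : (Fin N → ℝ) → Matrix (Fin N) (Fin N) ℝ} {G : (Fin N → ℝ) → Matrix (Fin k) (Fin N) ℝ}
  {B : (Fin N → ℝ) → Matrix (Fin N) (Fin N) ℝ}
  {A : (Fin N → ℝ) → Matrix (MIdx N k) (MIdx N k) ℝ}
  {X : (Fin N → ℝ) → Matrix (MIdx N k) (Fin N) ℝ} {x : Fin N → ℝ}

theorem Corresponds.mono {V : Set (Fin N → ℝ)} (h : Corresponds ε U F G B A X) (hV : V ⊆ U) :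
    Corresponds ε V F G B A X where
  system :=
    { smoothF := fun p q => (h.system.smoothF p q).mono hV
      smoothG := fun p q => (h.system.smoothG p q).mono hV
      smoothB := fun p q => (h.system.smoothB p q).mono hV
      diag_zero := fun x hx => h.system.diag_zero x (hV hx)
      orth := fun x hx => h.system.orth x (hV hx)
      eqn_gauss := fun x hx => h.system.eqn_gauss x (hV hx)
      eqn_F := fun x hx => h.system.eqn_F x (hV hx)
      eqn_B := fun x hx => h.system.eqn_B x (hV hx)
      eqn_G := fun x hx => h.system.eqn_G x (hV hx) }
  smoothA := fun p q => (h.smoothA p q).mono hV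
  smoothX := fun p q => (h.smoothX p q).mono hV
  orthA := fun x hx => h.orthA x (hV hx)
  eqA := fun x hx => h.eqA x (hV hx)
  eqX := fun x hx => h.eqX x (hV hx)

theorem Corresponds.pdMat_A (h : Corresponds ε U F G B A X) (hx : x ∈ U) (i : Fin N) :
    pdMat i A x = A x * connA (stack F G x) i := by
  rw [h.eqA x hx i, stack, connA_eq_fromBlocks]

theorem Corresponds.pd_A (h : Corresponds ε U F G B A X) (hx : x ∈ U) (i : Fin N)
    (p q : MIdx N k) : pd i (fun y => A y p q) x = A x p (Sum.inl i) * stack F G x q i -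
      if q = Sum.inl i then ∑ r, A x p r * stack F G x r i else 0 := by
  rw [← mul_connA_apply, ← h.pdMat_A hx]
  rfl

theorem neg_toCols_mul_matC_apply (A : Matrix (MIdx N k) (MIdx N k) ℝ) (B : Matrix (Fin N) (Fin N) ℝ)
    (i : Fin N) (p : MIdx N k) (j : Fin N) :
    (-(A.toCols₁ * matC i * Bᵀ * Matrix.diagonal ε)) p j = -(ε j * B j i * A p (Sum.inl i)) := by
  simp [Matrix.mul_apply, matC, Matrix.single_apply, ite_and, Matrix.diagonal_apply,
    Finset.sum_ite_eq]
  ring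

theorem Corresponds.pd_X (h : Corresponds ε U F G B A X) (hx : x ∈ U) (i : Fin N)
    (p : MIdx N k) (j : Fin N) :
    pd i (fun y => X y p j) x = -(ε j * B x j i * A x p (Sum.inl i)) := by
  rw [← neg_toCols_mul_matC_apply, ← h.eqX x hx]
  rfl

variable (h : Corresponds ε U F G B A X) (hU : IsOpen U) (hx : x ∈ U)

include h hx in
theorem Corresponds.inner_frame (p q : MIdx N k) :
    inner ℝ (colVec A p x) (colVec A q x) = if p = q then (1 : ℝ) else 0 := by
  rw [inner_colVec, h.orthA x hx, Matrix.one_apply]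

include h hx in
theorem Corresponds.sum_inner_frame (v : Amb N k) :
    ∑ p, inner ℝ (colVec A p x) v • colVec A p x = v := by
  have h1 : A x * (A x)ᵀ = 1 := mul_eq_one_comm.1 (h.orthA x hx)
  have h2 : A x *ᵥ ((A x)ᵀ *ᵥ v.ofLp) = v.ofLp := by
    rw [Matrix.mulVec_mulVec, h1, Matrix.one_mulVec]
  have h3 : ∀ p, inner ℝ (colVec A p x) v = ((A x)ᵀ *ᵥ v.ofLp) p := fun p => by
    simp only [colVec, PiLp.inner_apply, Matrix.mulVec, dotProduct, Matrix.transpose_apply]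
    exact Finset.sum_congr rfl fun a _ => mul_comm _ _
  simp only [h3]
  ext a
  rw [← congrFun h2 a]
  simp only [WithLp.ofLp_sum, Finset.sum_apply, PiLp.smul_apply, smul_eq_mul, colVec]
  exact Finset.sum_congr rfl fun p _ => mul_comm _ _

include h hU hx in
theorem Corresponds.pd_colVec_X (j i : Fin N) :
    pd i (colVec X j) x = -(ε j * B x j i) • colVec A (Sum.inl i) x := by
  ext a
  rw [pd_apply_euclidean
    ((contDiffOn_colVec h.smoothX j).differentiableAt_of_isOpen hU hx)]
  simpa [colVec] using h.pd_X hx i a j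

include h hU hx in
-- An index `Sum.inr a` avoids the correction column of `connA`, so the derivative is tangential.
-- This gives both the parallelism of the frame and its diagonal Weingarten maps.
theorem Corresponds.pd_normalFrame (a : Fin k) (i : Fin N) :
    pd i (normalFrame A a) x = G x a i • colVec A (Sum.inl i) x := by
  ext p
  rw [normalFrame, pd_apply_euclidean
    ((contDiffOn_colVec h.smoothA _).differentiableAt_of_isOpen hU hx)]
  simpa [colVec, stack, mul_comm] using h.pd_A hx i p (Sum.inr a)

include h hU hx in
theorem Corresponds.fderiv_X (j : Fin N) (u : Fin N → ℝ) :
    fderiv ℝ (colVec X j) x u = ∑ i, -(ε j * B x j i * u i) • colVec A (Sum.inl i) x := by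
  rw [fderiv_apply_eq_sum_pd]
  refine Finset.sum_congr rfl fun i _ => ?_
  rw [h.pd_colVec_X hU hx, smul_smul]
  congr 1; ring

include h hU hx in
theorem Corresponds.fderiv_normalFrame (a : Fin k) (u : Fin N → ℝ) :
    fderiv ℝ (normalFrame A a) x u = ∑ i, (G x a i * u i) • colVec A (Sum.inl i) x := by
  rw [fderiv_apply_eq_sum_pd]
  refine Finset.sum_congr rfl fun i _ => ?_
  rw [h.pd_normalFrame hU hx, smul_smul, mul_comm]

include h hx in
theorem Corresponds.inner_frame_sum (c : Fin N → ℝ) (i : Fin N) :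
    inner ℝ (colVec A (Sum.inl i) x) (∑ l, c l • colVec A (Sum.inl l) x) = c i := by
  simp [inner_sum, inner_smul_right, h.inner_frame hx]

include h hx in
theorem Corresponds.inner_normalFrame_sum (c : Fin N → ℝ) (a : Fin k) :
    inner ℝ (normalFrame A a x) (∑ l, c l • colVec A (Sum.inl l) x) = 0 := by
  simp [inner_sum, inner_smul_right, normalFrame, h.inner_frame hx]

include h hx in
theorem Corresponds.inner_sum_sum (c d : Fin N → ℝ) :
    inner ℝ (∑ l, c l • colVec A (Sum.inl l) x) (∑ l, d l • colVec A (Sum.inl l) x) =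
      ∑ l, c l * d l := by
  rw [sum_inner]
  refine Finset.sum_congr rfl fun i _ => ?_
  rw [real_inner_smul_left, h.inner_frame_sum hx]

variable {j : Fin N} (hε : ∀ i, ε i * ε i = 1) (hb : ∀ i, B x j i ≠ 0)

theorem sign_ne_zero (hε : ∀ i, ε i * ε i = 1) (i : Fin N) : ε i ≠ 0 :=
  left_ne_zero_of_mul_eq_one (hε i)

include h hU hx in
theorem Corresponds.firstForm_eq (u v : Fin N → ℝ) :
    firstForm (colVec X j) x u v = ∑ i, (ε j * B x j i) ^ 2 * u i * v i := by
  rw [firstForm, h.fderiv_X hU hx, h.fderiv_X hU hx, h.inner_sum_sum hx]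
  exact Finset.sum_congr rfl fun i _ => by ring

include h hU hx hε hb in
theorem Corresponds.injective_fderiv : Function.Injective (fderiv ℝ (colVec X j) x) := by
  rw [injective_iff_map_eq_zero]
  intro u hu
  rw [h.fderiv_X hU hx] at hu
  ext i
  have := h.inner_frame_sum hx (fun i => -(ε j * B x j i * u i)) i
  rw [hu, inner_zero_right] at this
  simpa [hb i, sign_ne_zero hε] using this

include h hU hx hε hb in
-- Since no entry of row j of B vanishes, dX_j maps the coordinate vectors to non-zero multiples of
-- e_1, …, e_N. The tangent space is therefore their span, the same for every j.
theorem Corresponds.mem_tangentSpace {v : Amb N k} :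
    v ∈ tangentSpace (colVec X j) x ↔ ∀ a, inner ℝ (normalFrame A a x) v = 0 := by
  constructor
  · rintro ⟨u, rfl⟩ a
    change inner ℝ _ (fderiv ℝ (colVec X j) x u) = 0
    rw [h.fderiv_X hU hx, h.inner_normalFrame_sum hx]
  · intro hv
    -- Solves -ε_j b_{ji} u_i = ⟨e_i, v⟩ for u_i, with ε_j its own inverse.
    refine ⟨fun i => -(ε j * inner ℝ (colVec A (Sum.inl i) x) v / B x j i), ?_⟩
    change fderiv ℝ (colVec X j) x _ = v
    have h0 : ∀ a, inner ℝ (colVec A (Sum.inr a) x) v = 0 := hv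
    have h1 := h.sum_inner_frame hx v
    simp only [Fintype.sum_sum_type, h0, zero_smul, Finset.sum_const_zero, add_zero] at h1
    rw [h.fderiv_X hU hx]
    conv_rhs => rw [← h1]
    refine Finset.sum_congr rfl fun i _ => ?_
    congr 1
    have := hb i
    field_simp
    linear_combination (inner ℝ (colVec A (Sum.inl i) x) v) * hε j

include h hU hx hε hb in
theorem Corresponds.mem_normalSpace {v : Amb N k} :
    v ∈ normalSpace (colVec X j) x ↔ ∀ i, inner ℝ (colVec A (Sum.inl i) x) v = 0 := by
  rw [normalSpace, Submodule.mem_orthogonal]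
  constructor
  · intro hv i
    refine hv _ ((h.mem_tangentSpace hU hx hε hb).2 fun a => ?_)
    rw [normalFrame, h.inner_frame hx, if_neg (by simp)]
  · rintro hv _ ⟨u, rfl⟩
    change inner ℝ (fderiv ℝ (colVec X j) x u) v = 0
    rw [h.fderiv_X hU hx, sum_inner]
    simp [real_inner_smul_left, hv]

include h hU hx hε hb in
theorem Corresponds.sum_inner_normalFrame {v : Amb N k} (hv : v ∈ normalSpace (colVec X j) x) :
    ∑ a, inner ℝ (normalFrame A a x) v • normalFrame A a x = v := by
  conv_rhs => rw [← h.sum_inner_frame hx v, Fintype.sum_sum_type]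
  rw [h.mem_normalSpace hU hx hε hb] at hv
  simp [hv, normalFrame]

include h hU hx hε hb in
theorem Corresponds.normalFrame_sum_mem (c : Fin k → ℝ) :
    ∑ a, c a • normalFrame A a x ∈ normalSpace (colVec X j) x := by
  rw [h.mem_normalSpace hU hx hε hb]
  intro i
  simp [inner_sum, inner_smul_right, normalFrame, h.inner_frame hx]

include h hU hx hε hb in
theorem Corresponds.starProjection_eq (v : Amb N k) :
    (tangentSpace (colVec X j) x)ᗮ.starProjection v =
      ∑ a, inner ℝ (normalFrame A a x) v • normalFrame A a x := by
  refine Submodule.eq_starProjection_of_mem_of_inner_eq_zero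
    (h.normalFrame_sum_mem hU hx hε hb _) fun w hw => ?_
  refine (Submodule.mem_orthogonal _ _).1 hw _ ((h.mem_tangentSpace hU hx hε hb).2 fun a => ?_)
  simp [inner_sub_right, inner_sum, inner_smul_right, normalFrame, h.inner_frame hx]

include h hU hx in
-- Differentiate ⟨e_a, dX_j(v)⟩ = 0: the second derivative of X_j is traded for the first derivative
-- of e_a, which is known.
theorem Corresponds.inner_second (u v : Fin N → ℝ) (a : Fin k) :
    inner ℝ (normalFrame A a x) (fderiv ℝ (fun y => fderiv ℝ (colVec X j) y v) x u) =
      ∑ i, ε j * B x j i * G x a i * u i * v i := by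
  have hY := contDiffOn_colVec h.smoothX j
  have hdY : DifferentiableAt ℝ (fun y => fderiv ℝ (colVec X j) y v) x := by
    have := (hY.fderiv_of_isOpen (m := ∞) hU (by simp)).differentiableAt_of_isOpen hU hx
    exact this.clm_apply (differentiableAt_const v)
  have he : DifferentiableAt ℝ (normalFrame A a) x :=
    (contDiffOn_colVec h.smoothA _).differentiableAt_of_isOpen hU hx
  have h0 : fderiv ℝ (fun y => inner ℝ (normalFrame A a y) (fderiv ℝ (colVec X j) y v)) x = 0 := by
    have : (fun y => inner ℝ (normalFrame A a y) (fderiv ℝ (colVec X j) y v)) =ᶠ[nhds x]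
        fun _ => (0 : ℝ) := by
      filter_upwards [hU.mem_nhds hx] with y hy
      rw [h.fderiv_X hU hy, h.inner_normalFrame_sum hy]
    rw [this.fderiv_eq]; simp
  have := fderiv_inner_apply ℝ he hdY u
  rw [h0, h.fderiv_normalFrame hU hx, h.fderiv_X hU hx, h.inner_sum_sum hx] at this
  have h1 : ∑ i, ε j * B x j i * G x a i * u i * v i =
      -∑ i, G x a i * u i * -(ε j * B x j i * v i) := by
    rw [← Finset.sum_neg_distrib]
    exact Finset.sum_congr rfl fun i _ => by ring
  rw [h1]
  simp only [_root_.zero_apply] at this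
  linarith

include h hU hx hε hb in
theorem Corresponds.secondForm_eq (u v : Fin N → ℝ) :
    secondForm (colVec X j) x u v =
      ∑ a, (∑ i, ε j * B x j i * G x a i * u i * v i) • normalFrame A a x := by
  rw [secondForm, h.starProjection_eq hU hx hε hb]
  simp only [h.inner_second hU hx]

include h hU hx hε hb in
-- Both fundamental forms are diagonal in the coordinates, so the coordinate directions are
-- principal for all normals at once.
theorem Corresponds.shape_eq (η : Amb N k) :
    shape (colVec X j) x η = Matrix.diagonal fun i =>
      (∑ a, G x a i * inner ℝ (normalFrame A a x) η) / (ε j * B x j i) := by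
  have h1 : (Matrix.of fun i l => firstForm (colVec X j) x (Pi.single i 1) (Pi.single l 1)) =
      Matrix.diagonal fun i => (ε j * B x j i) ^ 2 := by
    ext i l
    rw [Matrix.of_apply, h.firstForm_eq hU hx, Matrix.diagonal_apply]
    rcases eq_or_ne i l with rfl | hil
    · simp [Pi.single_apply]
    · simp [Pi.single_apply, hil, hil.symm]
  have h2 : (Matrix.of fun i l =>
      inner ℝ (secondForm (colVec X j) x (Pi.single i 1) (Pi.single l 1)) η) =
      Matrix.diagonal fun i => ε j * B x j i * ∑ a, G x a i * inner ℝ (normalFrame A a x) η := by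
    ext i l
    rw [Matrix.of_apply, h.secondForm_eq hU hx hε hb, Matrix.diagonal_apply]
    rcases eq_or_ne i l with rfl | hil
    · simp [Pi.single_apply, sum_inner, real_inner_smul_left, Finset.mul_sum, mul_assoc]
    · simp [Pi.single_apply, hil, hil.symm]
  have h3 : (Matrix.diagonal fun i => (ε j * B x j i) ^ 2)⁻¹ =
      Matrix.diagonal fun i => ((ε j * B x j i) ^ 2)⁻¹ := by
    refine Matrix.inv_eq_right_inv ?_
    rw [Matrix.diagonal_mul_diagonal, ← Matrix.diagonal_one]
    congr 1
    ext i
    exact mul_inv_cancel₀ (pow_ne_zero _ (mul_ne_zero (sign_ne_zero hε j) (hb i)))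
  rw [shape, h1, h2, h3, Matrix.diagonal_mul_diagonal]
  congr 1
  ext i
  have := mul_ne_zero (sign_ne_zero hε j) (hb i)
  field_simp

include h hU hx hε hb in
-- The injective linear map c ↦ diag(c_i / (ε_j b_{ji})) carries the range of Gᵗ onto the set of
-- shape operators. That set is thus already a subspace, and its dimension is the rank of G.
theorem Corresponds.nondegenerateAt_iff :
    NondegenerateAt (colVec X j) x ↔ (G x).rank = N := by
  let D : (Fin N → ℝ) →ₗ[ℝ] Matrix (Fin N) (Fin N) ℝ :=
    { toFun := fun c => Matrix.diagonal fun i => c i / (ε j * B x j i)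
      map_add' := fun c d => by rw [Matrix.diagonal_add]; simp [add_div]
      map_smul' := fun r c => by rw [← Matrix.diagonal_smul]; congr 1; ext i; simp [mul_div_assoc] }
  have hD : Function.Injective D := by
    rw [injective_iff_map_eq_zero]
    intro c hc
    ext i
    have := congrFun (congrFun hc i) i
    simpa [D, hb i, sign_ne_zero hε] using this
  have h1 : shape (colVec X j) x '' (normalSpace (colVec X j) x : Set (Amb N k)) =
      ((LinearMap.range (G x)ᵀ.mulVecLin).map D : Submodule ℝ (Matrix (Fin N) (Fin N) ℝ)) := by
    ext M
    simp only [Set.mem_image, SetLike.mem_coe, Submodule.mem_map, LinearMap.mem_range]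
    constructor
    · rintro ⟨η, -, rfl⟩
      refine ⟨_, ⟨fun a => inner ℝ (normalFrame A a x) η, rfl⟩, ?_⟩
      rw [h.shape_eq hU hx hε hb]
      rfl
    · rintro ⟨_, ⟨c, rfl⟩, rfl⟩
      refine ⟨_, h.normalFrame_sum_mem hU hx hε hb c, ?_⟩
      rw [h.shape_eq hU hx hε hb]
      simp only [D, LinearMap.coe_mk, AddHom.coe_mk]
      congr 1
      ext i
      simp [inner_sum, inner_smul_right, normalFrame, h.inner_frame hx, Matrix.vecMul, dotProduct, mul_comm]
  rw [NondegenerateAt, h1, Submodule.span_eq,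
    ← (Submodule.equivMapOfInjective D hD _).finrank_eq, ← Matrix.rank_transpose]
  rfl

include h hU hε in
theorem Corresponds.isImmersionOn (hb : ∀ x ∈ U, ∀ i, B x j i ≠ 0) :
    IsImmersionOn U (colVec X j) :=
  ⟨contDiffOn_colVec h.smoothX j, fun x hx => h.injective_fderiv hU hx hε (hb x hx)⟩

include h hU hε in
theorem Corresponds.isParallelNormal (hb : ∀ x ∈ U, ∀ i, B x j i ≠ 0) (a : Fin k) :
    IsParallelNormal U (colVec X j) (normalFrame A a) := by
  refine ⟨contDiffOn_colVec h.smoothA _, fun x hx => ⟨?_, fun u => ?_⟩⟩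
  · rw [h.mem_normalSpace hU hx hε (hb x hx)]
    intro i
    rw [normalFrame, h.inner_frame hx, if_neg (by simp)]
  · rw [h.starProjection_eq hU hx hε (hb x hx), h.fderiv_normalFrame hU hx]
    simp [h.inner_normalFrame_sum hx]

include h hU hε in
-- The sign ε_j in dX_j is invisible in the first fundamental form but survives in the second, which
-- is why the tuple is described by J B and not by B.
theorem Corresponds.isPreTuple (hb : ∀ x ∈ U, ∀ j i, B x j i ≠ 0) :
    IsPreTuple ε U (colVec X) (normalFrame A) (fun x => Matrix.diagonal ε * B x) G where
  immersion j := h.isImmersionOn hU hε fun x hx => hb x hx j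
  common_normal i j x hx := by
    ext v
    rw [h.mem_normalSpace hU hx hε (hb x hx i), h.mem_normalSpace hU hx hε (hb x hx j)]
  orthonormal x hx := by
    rw [orthonormal_iff_ite]
    intro a c
    simp [normalFrame, h.inner_frame hx]
  parallel j a := h.isParallelNormal hU hε (fun x hx => hb x hx j) a
  smoothB p q := by
    simp only [Matrix.diagonal_mul]
    exact contDiffOn_const.mul (h.system.smoothB p q)
  smoothG := h.system.smoothG
  orth x hx := by
    have hJ : Matrix.diagonal ε * Matrix.diagonal ε = 1 := by
      rw [Matrix.diagonal_mul_diagonal]; simp [hε]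
    have : (Matrix.diagonal ε * B x)ᵀ * Matrix.diagonal ε * (Matrix.diagonal ε * B x) =
        (B x)ᵀ * (Matrix.diagonal ε * Matrix.diagonal ε) * Matrix.diagonal ε * B x := by
      simp only [Matrix.transpose_mul, Matrix.diagonal_transpose, Matrix.mul_assoc]
    rw [this, hJ, Matrix.mul_one, h.system.orth x hx]
  first j x hx u v := by
    simp only [Matrix.diagonal_mul]
    exact h.firstForm_eq hU hx u v
  second j x hx u v := by
    rw [h.secondForm_eq hU hx hε (hb x hx j), Finset.sum_comm]
    simp only [Matrix.diagonal_mul, Finset.sum_smul]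

include h hU hε in
theorem Corresponds.isTuple_iff [Nonempty (Fin N)] (hb : ∀ x ∈ U, ∀ j i, B x j i ≠ 0) :
    IsTuple ε U (colVec X) (normalFrame A) (fun x => Matrix.diagonal ε * B x) G ↔
      ∀ x ∈ U, (G x).rank = N := by
  constructor
  · intro t x hx
    -- Each member of the tuple gives the same rank condition, so any one of them may be used.
    obtain ⟨j⟩ := ‹Nonempty (Fin N)›
    exact (h.nondegenerateAt_iff hU hx hε (hb x hx j)).1 (t.nondegenerate j x hx)
  · intro hr
    exact { h.isPreTuple hU hε hb with
      nondegenerate := fun j x hx =>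
        (h.nondegenerateAt_iff hU hx hε (hb x hx j)).2 (hr x hx) }

end Geometry

/-! ### Reflections 1 - 2Q for idempotent Q. -/

section Reflections

variable {a : Type*} [Fintype a] [DecidableEq a]

theorem reflection_mul_self {Q : Matrix a a ℝ} (hQ : Q * Q = Q) :
    (1 - (2 : ℝ) • Q) * (1 - (2 : ℝ) • Q) = 1 := by
  simp only [sub_mul, mul_sub, one_mul, mul_one, smul_mul_assoc, mul_smul_comm, hQ]
  module

/-- Q is self-adjoint for the form J, hence so is 1 - 2Q; being an involution, it is then an
isometry of J. -/
theorem reflection_transpose_mul {Q J : Matrix a a ℝ} (hQ : Q * Q = Q) (hJ : Qᵀ * J = J * Q) :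
    (1 - (2 : ℝ) • Q)ᵀ * J * (1 - (2 : ℝ) • Q) = J := by
  have : (1 - (2 : ℝ) • Q)ᵀ * J = J * (1 - (2 : ℝ) • Q) := by
    simp only [Matrix.transpose_sub, Matrix.transpose_one, Matrix.transpose_smul, sub_mul, mul_sub,
      one_mul, mul_one, smul_mul_assoc, mul_smul_comm, hJ]
  rw [this, Matrix.mul_assoc, reflection_mul_self hQ, Matrix.mul_one]

theorem vecMulVec_diagonal_mul_self {ε z : a → ℝ} (hz : ∑ j, ε j * z j ^ 2 = 1) :
    (Matrix.vecMulVec z z * Matrix.diagonal ε) * (Matrix.vecMulVec z z * Matrix.diagonal ε) =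
      Matrix.vecMulVec z z * Matrix.diagonal ε := by
  have h : (z ᵥ* Matrix.diagonal ε) ⬝ᵥ z = 1 := by
    rw [← hz]
    simp only [dotProduct, Matrix.vecMul_diagonal]
    exact Finset.sum_congr rfl fun i _ => by ring
  rw [Matrix.vecMulVec_mul, Matrix.vecMulVec_mul_vecMulVec, h, one_smul]

theorem vecMulVec_diagonal_transpose_mul (ε z : a → ℝ) :
    (Matrix.vecMulVec z z * Matrix.diagonal ε)ᵀ * Matrix.diagonal ε =
      Matrix.diagonal ε * (Matrix.vecMulVec z z * Matrix.diagonal ε) := by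
  rw [Matrix.transpose_mul, Matrix.diagonal_transpose, Matrix.transpose_vecMulVec, Matrix.mul_assoc]

omit [DecidableEq a] in
theorem vecMulVec_mul_self {w : a → ℝ} (hw : ∑ j, w j ^ 2 = 1) :
    Matrix.vecMulVec w w * Matrix.vecMulVec w w = Matrix.vecMulVec w w := by
  have h : w ⬝ᵥ w = 1 := by
    rw [← hw]
    exact Finset.sum_congr rfl fun i _ => by ring
  rw [Matrix.vecMulVec_mul_vecMulVec, h, one_smul]

/-- Row of Ã times column l of the new potential. Here a₀ is a row of A, n the matching entry of Aw,
y = ε_l z_l, and c restores the diagonal entry that (·)_* sets to zero. -/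
theorem sum_reflection_mul {a₀ w ξ : a → ℝ} {n s y c : ℝ} (l : a) (hn : ∑ r, a₀ r * w r = n)
    (hw : ∑ r, w r ^ 2 = 1) :
    ∑ r, (a₀ r - 2 * n * w r) * (ξ r - 2 * s * (w r * y) + if r = l then c else 0) =
      ∑ r, a₀ r * ξ r + 2 * s * y * n - 2 * n * ∑ r, ξ r * w r + (a₀ l - 2 * n * w l) * c := by
  have h1 : ∀ r, (a₀ r - 2 * n * w r) * (ξ r - 2 * s * (w r * y) + if r = l then c else 0) =
      a₀ r * ξ r - 2 * s * y * (a₀ r * w r) - 2 * n * (ξ r * w r) + 4 * n * s * y * w r ^ 2 +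
        if r = l then (a₀ r - 2 * n * w r) * c else 0 := fun r => by split_ifs <;> ring
  simp only [h1, Finset.sum_add_distrib, Finset.sum_sub_distrib, ← Finset.mul_sum, hn, hw,
    Finset.sum_ite_eq', Finset.mem_univ, if_true]
  ring

end Reflections

/-! ### The pole system and the transformation of corresponding triples. -/

section Transform

variable {N k : ℕ}

/-- Normalized solutions `(ŵ, ẑ)` of the linear system that governs the poles of the dressing. -/
structure IsPolePair (ε : Fin N → ℝ) (U : Set (Fin N → ℝ))
    (F : (Fin N → ℝ) → Matrix (Fin N) (Fin N) ℝ) (G : (Fin N → ℝ) → Matrix (Fin k) (Fin N) ℝ)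
    (s : ℝ) (w : (Fin N → ℝ) → MIdx N k → ℝ) (z : (Fin N → ℝ) → Fin N → ℝ) : Prop where
  smooth_w : ∀ p, ContDiffOn ℝ ∞ (fun x => w x p) U
  smooth_z : ∀ j, ContDiffOn ℝ ∞ (fun x => z x j) U
  norm_w : ∀ x ∈ U, ∑ p, w x p ^ 2 = 1
  norm_z : ∀ x ∈ U, ∑ j, ε j * z x j ^ 2 = 1
  pd_w : ∀ x ∈ U, ∀ l p, pd l (fun y => w y p) x = -(connA (stack F G x) l *ᵥ w x) p +
    (if p = Sum.inl l then s * (ε l * z x l) else 0) - s * w x (Sum.inl l) * (ε l * z x l) * w x p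
  pd_z : ∀ x ∈ U, ∀ l j, pd l (fun y => z y j) x = -(connB ε (stack F G x) l *ᵥ z x) j +
    (if j = l then s * w x (Sum.inl l) else 0) - s * w x (Sum.inl l) * (ε l * z x l) * z x j

variable {ε : Fin N → ℝ} {U : Set (Fin N → ℝ)}
  {F : (Fin N → ℝ) → Matrix (Fin N) (Fin N) ℝ} {G : (Fin N → ℝ) → Matrix (Fin k) (Fin N) ℝ}
  {B : (Fin N → ℝ) → Matrix (Fin N) (Fin N) ℝ}
  {A : (Fin N → ℝ) → Matrix (MIdx N k) (MIdx N k) ℝ}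
  {X : (Fin N → ℝ) → Matrix (MIdx N k) (Fin N) ℝ} {x : Fin N → ℝ} {s : ℝ}
  {w : (Fin N → ℝ) → MIdx N k → ℝ} {z : (Fin N → ℝ) → Fin N → ℝ}

theorem Corresponds.stack_diag (h : Corresponds ε U F G B A X) (hx : x ∈ U) (l : Fin N) :
    stack F G x (Sum.inl l) l = 0 := h.system.diag_zero x hx l

theorem Corresponds.pd_stack (h : Corresponds ε U F G B A X) (hx : x ∈ U) {p : MIdx N k}
    {j l : Fin N} (hp : p ≠ Sum.inl l) (hj : p ≠ Sum.inl j) (hjl : j ≠ l) :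
    pd l (fun y => stack F G y p j) x = stack F G x p l * F x l j := by
  rcases p with p | p
  · exact h.system.eqn_F x hx p j l (by simpa using hj) (by simpa using hp) hjl
  · rw [mul_comm]
    exact h.system.eqn_G x hx p j l hjl

theorem Corresponds.smooth_stack (h : Corresponds ε U F G B A X) : SmoothMat U (stack F G) := by
  rintro (p | p) j
  · exact h.system.smoothF p j
  · exact h.system.smoothG p j

variable (hw : IsPolePair ε U F G s w z) (hU : IsOpen U) (hx : x ∈ U)

include hw hU hx in
theorem IsPolePair.diff_w (p : MIdx N k) : DifferentiableAt ℝ (fun y => w y p) x :=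
  (hw.smooth_w p).differentiableAt_of_isOpen hU hx

include hw hU hx in
theorem IsPolePair.diff_z (j : Fin N) : DifferentiableAt ℝ (fun y => z y j) x :=
  (hw.smooth_z j).differentiableAt_of_isOpen hU hx

theorem SmoothMat.differentiableAt {a b : Type*} {M : (Fin N → ℝ) → Matrix a b ℝ}
    (hM : SmoothMat U M) (hU : IsOpen U) (hx : x ∈ U) (p : a) (q : b) :
    DifferentiableAt ℝ (fun y => M y p q) x :=
  (hM p q).differentiableAt_of_isOpen hU hx

theorem smooth_mulVec {a b : Type*} [Fintype b] {M : (Fin N → ℝ) → Matrix a b ℝ}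
    {v : (Fin N → ℝ) → b → ℝ} (hM : SmoothMat U M) (hv : ∀ q, ContDiffOn ℝ ∞ (fun x => v x q) U)
    (p : a) : ContDiffOn ℝ ∞ (fun x => (M x *ᵥ v x) p) U :=
  ContDiffOn.sum fun q _ => (hM p q).mul (hv q)

theorem pd_mulVec {𝔸 : Type*} [NormedCommRing 𝔸] [NormedAlgebra ℝ 𝔸] {a b : Type*} [Fintype b]
    {M : (Fin N → ℝ) → Matrix a b 𝔸} {v : (Fin N → ℝ) → b → 𝔸} (l : Fin N) (p : a)
    (hM : ∀ q, DifferentiableAt ℝ (fun y => M y p q) x)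
    (hv : ∀ q, DifferentiableAt ℝ (fun y => v y q) x) :
    pd l (fun y => (M y *ᵥ v y) p) x =
      (pdMat l M x *ᵥ v x) p + ∑ q, M x p q * pd l (fun y => v y q) x := by
  simp only [Matrix.mulVec, dotProduct]
  rw [pd_sum l _ fun q _ => (hM q).fun_mul (hv q), ← Finset.sum_add_distrib]
  exact Finset.sum_congr rfl fun q _ => pd_mul l (hM q) (hv q)

/-- Shared by Aw and Bz: for d the connection matrix applied to v, the term -M d cancels the
contribution of the derivative of M. -/
theorem sum_mul_pole_derivative {a b : Type*} [Fintype b] [DecidableEq b] (M : Matrix a b ℝ)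
    (v d : b → ℝ) (p : a) (i : b) (c e : ℝ) :
    ∑ q, M p q * (-d q + (if q = i then c else 0) - e * v q) =
      -(M *ᵥ d) p + c * M p i - e * (M *ᵥ v) p := by
  simp only [Matrix.mulVec, dotProduct, mul_sub, mul_add, Finset.sum_sub_distrib,
    Finset.sum_add_distrib, mul_neg, Finset.sum_neg_distrib, mul_ite, mul_zero,
    Finset.sum_ite_eq', Finset.mem_univ, if_true, Finset.mul_sum]
  congr 2
  · ring
  · funext q; ring

include hw hU hx in
-- In the moving frame the connection drops out: with n = Aw and y_l = ε_l z_l, the derivative is s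
-- y_l times the projection e_l - w_l n of e_l orthogonally to n.
theorem IsPolePair.pd_n (h : Corresponds ε U F G B A X) (l : Fin N) (p : MIdx N k) :
    pd l (fun y => (A y *ᵥ w y) p) x = s * (ε l * z x l) * A x p (Sum.inl l) -
      s * w x (Sum.inl l) * (ε l * z x l) * (A x *ᵥ w x) p := by
  rw [pd_mulVec l p (h.smoothA.differentiableAt hU hx p) (hw.diff_w hU hx), h.pdMat_A hx]
  simp only [hw.pd_w x hx]
  rw [sum_mul_pole_derivative, Matrix.mulVec_mulVec]
  ring

include hw hU hx in
theorem IsPolePair.pd_b (hB : SmoothMat U B)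
    (hdB : ∀ x ∈ U, ∀ l, pdMat l B x = B x * connB ε (stack F G x) l) (l : Fin N) (p : Fin N) :
    pd l (fun y => (B y *ᵥ z y) p) x = s * w x (Sum.inl l) * B x p l -
      s * w x (Sum.inl l) * (ε l * z x l) * (B x *ᵥ z x) p := by
  rw [pd_mulVec l p (hB.differentiableAt hU hx p) (hw.diff_z hU hx), hdB x hx]
  simp only [hw.pd_z x hx]
  rw [sum_mul_pole_derivative, Matrix.mulVec_mulVec]
  ring

theorem mul_reflection_apply {a b : Type*} [Fintype b] [DecidableEq b] (M : Matrix a b ℝ)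
    (v : b → ℝ) (p : a) (q : b) :
    (M * (1 - (2 : ℝ) • Matrix.vecMulVec v v : Matrix b b ℝ)) p q = M p q - 2 * (M *ᵥ v) p * v q := by
  rw [Matrix.mul_sub, Matrix.mul_one, Matrix.mul_smul, Matrix.mul_vecMulVec]
  simp [Matrix.vecMulVec_apply, mul_assoc]

theorem mul_reflection_diagonal_apply {a b : Type*} [Fintype b] [DecidableEq b] (M : Matrix a b ℝ)
    (v ε : b → ℝ) (p : a) (q : b) :
    (M * (1 - (2 : ℝ) • Matrix.vecMulVec v v * Matrix.diagonal ε : Matrix b b ℝ)) p q =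
      M p q - 2 * (M *ᵥ v) p * (ε q * v q) := by
  rw [Matrix.mul_sub, Matrix.mul_one, Matrix.smul_mul, Matrix.mul_smul, ← Matrix.mul_assoc,
    Matrix.mul_vecMulVec]
  simp [Matrix.vecMulVec_apply]
  ring

theorem mul_vecMulVec_mul_apply (A : Matrix (MIdx N k) (MIdx N k) ℝ) (B : Matrix (Fin N) (Fin N) ℝ)
    (w : MIdx N k → ℝ) (z : Fin N → ℝ) (p : MIdx N k) (j : Fin N) :
    (A * Matrix.vecMulVec w z * Bᵀ * Matrix.diagonal ε) p j =
      (A *ᵥ w) p * (B *ᵥ z) j * ε j := by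
  rw [Matrix.mul_diagonal, Matrix.mul_vecMulVec, Matrix.vecMulVec_mul, Matrix.vecMulVec_apply,
    Matrix.vecMul_transpose]

/-- The entry `(p, j)` of the new potential `ξ - 2s (ŵ ẑᵗ J)_*`. -/
theorem new_stack_apply (p : MIdx N k) (j : Fin N) :
    stack (fun x => Matrix.of fun i j =>
        F x i j - 2 * s * (if i = j then 0 else w x (Sum.inl i) * z x j * ε j))
      (fun x => Matrix.of fun a j => G x a j - 2 * s * (w x (Sum.inr a) * z x j * ε j)) x p j =
      stack F G x p j - 2 * s * (w x p * (ε j * z x j)) +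
        if p = Sum.inl j then 2 * s * w x p * (ε j * z x j) else 0 := by
  rcases p with p | p
  · by_cases h : p = j
    · simp [stack, h]; ring
    · simp [stack, h]; left; ring
  · simp [stack]; left; ring

include hw hU hx in
-- After lowering the index, z obeys the linear equation that system II imposes on the rows of B and
-- G, up to the scaling term due to the normalization.
theorem IsPolePair.pd_y (hε : ∀ i, ε i * ε i = 1) {j l : Fin N} (hjl : j ≠ l) :
    pd l (fun y => ε j * z y j) x = F x l j * (ε l * z x l) -
      s * w x (Sum.inl l) * (ε l * z x l) * (ε j * z x j) := by
  rw [pd_const_mul _ _ (hw.diff_z hU hx j), hw.pd_z x hx, connB_mulVec, if_neg hjl, if_neg hjl]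
  have : stack F G x (Sum.inl l) j = F x l j := rfl
  rw [this]
  linear_combination F x l j * (ε l * z x l) * hε j

include hw hx in
theorem IsPolePair.pd_w_of_ne {p : MIdx N k} {l : Fin N} (hp : p ≠ Sum.inl l) :
    pd l (fun y => w y p) x = stack F G x p l * w x (Sum.inl l) -
      s * w x (Sum.inl l) * (ε l * z x l) * w x p := by
  rw [hw.pd_w x hx, connA_mulVec, if_neg hp, if_neg hp]
  ring

include hw hU in
-- With y_j = ε_j z_j, n = Aw and b = Bz, all new objects are rank one changes: ξ - 2s w yᵗ off the
-- diagonal, A - 2n wᵗ, B - 2b yᵗ, X + (2/s) n bᵗ J. The scaling terms in the pole system supply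
-- exactly the quadratic terms that make the new equations factor.
theorem IsPolePair.corresponds (hε : ∀ i, ε i * ε i = 1) (hs : s ≠ 0)
    (h : Corresponds ε U F G B A X)
    (hdB : ∀ x ∈ U, ∀ l, pdMat l B x = B x * connB ε (stack F G x) l)
    {A' : (Fin N → ℝ) → Matrix (MIdx N k) (MIdx N k) ℝ}
    {B' : (Fin N → ℝ) → Matrix (Fin N) (Fin N) ℝ}
    (hA' : ∀ x ∈ U, A' x = A x * (1 - (2 : ℝ) • Matrix.vecMulVec (w x) (w x)))
    (hB' : ∀ x ∈ U, B' x =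
      B x * (1 - (2 : ℝ) • Matrix.vecMulVec (z x) (z x) * Matrix.diagonal ε)) :
    Corresponds ε U
      (fun x => Matrix.of fun i j =>
        F x i j - 2 * s * (if i = j then 0 else w x (Sum.inl i) * z x j * ε j))
      (fun x => Matrix.of fun a j => G x a j - 2 * s * (w x (Sum.inr a) * z x j * ε j)) B' A'
      (fun x => X x + (2 / s) • (A x * Matrix.vecMulVec (w x) (z x) * (B x)ᵀ *
        Matrix.diagonal ε)) := by
  set F' : (Fin N → ℝ) → Matrix (Fin N) (Fin N) ℝ := fun x => Matrix.of fun i j =>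
    F x i j - 2 * s * (if i = j then 0 else w x (Sum.inl i) * z x j * ε j) with hF'
  set G' : (Fin N → ℝ) → Matrix (Fin k) (Fin N) ℝ := fun x => Matrix.of fun a j =>
    G x a j - 2 * s * (w x (Sum.inr a) * z x j * ε j) with hG'
  have hξ : ∀ x p j, stack F' G' x p j = stack F G x p j - 2 * s * (w x p * (ε j * z x j)) +
      if p = Sum.inl j then 2 * s * w x p * (ε j * z x j) else 0 := fun x p j => new_stack_apply p j
  have hξne : ∀ {p : MIdx N k} {j}, p ≠ Sum.inl j → ∀ x, stack F' G' x p j =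
      stack F G x p j - 2 * s * (w x p * (ε j * z x j)) := fun hp x => by
    rw [hξ, if_neg hp, add_zero]
  have hFne : ∀ {i j : Fin N}, i ≠ j → ∀ x, F' x i j =
      F x i j - 2 * s * (w x (Sum.inl i) * (ε j * z x j)) := fun {i j} hp x =>
    hξne (p := Sum.inl i) (by simpa using hp) x
  have hAe : ∀ x ∈ U, ∀ p q, A' x p q = A x p q - 2 * (A x *ᵥ w x) p * w x q :=
    fun x hx p q => by rw [hA' x hx, mul_reflection_apply]
  have hBe : ∀ x ∈ U, ∀ p q, B' x p q = B x p q - 2 * (B x *ᵥ z x) p * (ε q * z x q) :=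
    fun x hx p q => by rw [hB' x hx, mul_reflection_diagonal_apply]
  have sn := smooth_mulVec h.smoothA hw.smooth_w
  have sb := smooth_mulVec h.system.smoothB hw.smooth_z
  have sy : ∀ j, ContDiffOn ℝ ∞ (fun x => ε j * z x j) U :=
    fun j => contDiffOn_const.mul (hw.smooth_z j)
  have sξ := h.smooth_stack
  -- The derivative becomes (ξ_{pl} - 2s w_p y_l)(F_{lj} - 2s w_l y_j). The product term 4s² w_p y_l
  -- w_l y_j comes from the scaling terms of w and y, one half from each.
  have hstack : ∀ x ∈ U, ∀ (p : MIdx N k) (j l : Fin N), p ≠ Sum.inl j → p ≠ Sum.inl l → j ≠ l →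
      pd l (fun y => stack F' G' y p j) x = stack F' G' x p l * F' x l j := by
    intro x hx p j l hpj hpl hjl
    simp only [hξne hpj, hξne hpl, hFne hjl.symm]
    have dw := hw.diff_w hU hx p
    have dy := (sy j).differentiableAt_of_isOpen hU hx
    rw [pd_sub l (sξ.differentiableAt hU hx p j) ((dw.fun_mul dy).const_mul (2 * s)),
      pd_const_mul l _ (dw.fun_mul dy), pd_mul l dw dy, h.pd_stack hx hpl hpj hjl,
      hw.pd_y hU hx hε hjl, hw.pd_w_of_ne hx hpl]
    ring
  have sξ' : SmoothMat U (stack F' G') := by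
    intro p j
    simp only [hξ]
    refine ((sξ p j).sub (contDiffOn_const.mul ((hw.smooth_w p).mul (sy j)))).add ?_
    split_ifs
    · exact (contDiffOn_const.mul (hw.smooth_w p)).mul (sy j)
    · exact contDiffOn_const
  refine
    { system :=
        { smoothF := fun p q => sξ' (Sum.inl p) q
          smoothG := fun p q => sξ' (Sum.inr p) q
          smoothB := fun p q => ?_
          diag_zero := fun x hx i => ?_
          orth := fun x hx => ?_
          eqn_gauss := fun x hx i j hij => ?_
          eqn_F := fun x hx i j l hij hil hjl =>
            hstack x hx (Sum.inl i) j l (by simpa using hij) (by simpa using hil) hjl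
          eqn_B := fun x hx i j l hjl => ?_
          eqn_G := fun x hx a j l hjl => ?_ }
      smoothA := fun p q => ?_
      smoothX := fun p q => ?_
      orthA := fun x hx => ?_
      eqA := fun x hx l => ?_
      eqX := fun x hx l => ?_ }
  · exact ((h.system.smoothB p q).sub ((contDiffOn_const.mul (sb p)).mul (sy q))).congr
      fun x hx => hBe x hx p q
  · simp [hF', h.system.diag_zero x hx i]
  · rw [hB' x hx, Matrix.transpose_mul]
    have h1 := h.system.orth x hx
    have h2 := reflection_transpose_mul (vecMulVec_diagonal_mul_self (hw.norm_z x hx))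
      (vecMulVec_diagonal_transpose_mul ε (z x))
    rw [← smul_mul_assoc] at h2
    have h3 : (1 - (2 : ℝ) • Matrix.vecMulVec (z x) (z x) * Matrix.diagonal ε)ᵀ * (B x)ᵀ *
        Matrix.diagonal ε * (B x * (1 - (2 : ℝ) • Matrix.vecMulVec (z x) (z x) *
          Matrix.diagonal ε)) =
        (1 - (2 : ℝ) • Matrix.vecMulVec (z x) (z x) * Matrix.diagonal ε)ᵀ *
          ((B x)ᵀ * Matrix.diagonal ε * B x) *
          (1 - (2 : ℝ) • Matrix.vecMulVec (z x) (z x) * Matrix.diagonal ε) := by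
      simp only [Matrix.mul_assoc]
    rw [h3, h1, h2]
  · have hji := hij.symm
    have hs1 : ∑ l, F' x l i * F' x l j + ∑ a, G' x a i * G' x a j =
        ∑ r, stack F' G' x r i * stack F' G' x r j := by
      rw [Fintype.sum_sum_type]; rfl
    have hs2 : ∑ l, F x l i * F x l j + ∑ a, G x a i * G x a j =
        ∑ r, stack F G x r i * stack F G x r j := by
      rw [Fintype.sum_sum_type]; rfl
    have hg := h.system.eqn_gauss x hx i j hij
    rw [add_assoc, hs2] at hg
    rw [add_assoc, hs1]
    -- Differentiating w_i along x_i itself brings in the whole column sum Σ_r ξ_{ri} w_r; `hsum`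
    -- produces the opposite term.
    have hd : ∀ {i j : Fin N}, i ≠ j → pd i (fun y => F' y i j) x =
        pd i (fun y => F y i j) x - 2 * s *
          ((-(∑ r, stack F G x r i * w x r) + s * (ε i * z x i) -
            s * w x (Sum.inl i) * (ε i * z x i) * w x (Sum.inl i)) * (ε j * z x j) +
          w x (Sum.inl i) * (F x i j * (ε i * z x i) -
            s * w x (Sum.inl i) * (ε i * z x i) * (ε j * z x j))) := by
      intro i j hij
      simp only [hFne hij]
      have dw := hw.diff_w hU hx (Sum.inl i)
      have dy := (sy j).differentiableAt_of_isOpen hU hx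
      rw [pd_sub i (h.system.smoothF.differentiableAt hU hx i j)
          ((dw.fun_mul dy).const_mul (2 * s)),
        pd_const_mul i _ (dw.fun_mul dy), pd_mul i dw dy, hw.pd_y hU hx hε hij.symm, hw.pd_w x hx,
        connA_mulVec, if_pos rfl, if_pos rfl, h.stack_diag hx]
      ring
    -- The full rank one change is expanded using |w| = 1; the zeroed diagonal entries are then
    -- corrected in rows r = i and r = j.
    have hsum : ∑ r, stack F' G' x r i * stack F' G' x r j =
        ∑ r, stack F G x r i * stack F G x r j
        - 2 * s * (ε j * z x j) * ∑ r, stack F G x r i * w x r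
        - 2 * s * (ε i * z x i) * ∑ r, stack F G x r j * w x r
        + 4 * s ^ 2 * (ε i * z x i) * (ε j * z x j)
        + 2 * s * w x (Sum.inl i) * (ε i * z x i) *
          (F x i j - 2 * s * (w x (Sum.inl i) * (ε j * z x j)))
        + 2 * s * w x (Sum.inl j) * (ε j * z x j) *
          (F x j i - 2 * s * (w x (Sum.inl j) * (ε i * z x i))) := by
      have h1 : ∀ r, stack F' G' x r i * stack F' G' x r j =
          stack F G x r i * stack F G x r j
          - 2 * s * (ε j * z x j) * (stack F G x r i * w x r)
          - 2 * s * (ε i * z x i) * (stack F G x r j * w x r)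
          + 4 * s ^ 2 * (ε i * z x i) * (ε j * z x j) * w x r ^ 2
          + (if r = Sum.inl i then 2 * s * w x r * (ε i * z x i) *
              (stack F G x r j - 2 * s * (w x r * (ε j * z x j))) else 0)
          + (if r = Sum.inl j then 2 * s * w x r * (ε j * z x j) *
              (stack F G x r i - 2 * s * (w x r * (ε i * z x i))) else 0) := by
        intro r
        rw [hξ, hξ]
        by_cases h1 : r = Sum.inl i
        · have h2 : r ≠ Sum.inl j := by rw [h1]; simpa using hij
          rw [if_pos h1, if_neg h2, if_pos h1, if_neg h2]; ring
        · by_cases h2 : r = Sum.inl j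
          · rw [if_neg h1, if_pos h2, if_neg h1, if_pos h2]; ring
          · rw [if_neg h1, if_neg h2, if_neg h1, if_neg h2]; ring
      simp only [h1, Finset.sum_add_distrib, Finset.sum_sub_distrib, ← Finset.mul_sum,
        hw.norm_w x hx, Finset.sum_ite_eq', Finset.mem_univ, if_true, mul_one]
      rfl
    rw [hsum, hd hij, hd hji]
    linear_combination hg
  · have hc : pd l (fun y => B' y i j) x =
        pd l (fun y => B y i j - 2 * (B y *ᵥ z y) i * (ε j * z y j)) x :=
      pd_congr l hU hx fun y hy => hBe y hy i j
    have db : DifferentiableAt ℝ (fun y => (B y *ᵥ z y) i) x :=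
      (sb i).differentiableAt_of_isOpen hU hx
    have dy := (sy j).differentiableAt_of_isOpen hU hx
    rw [hc, pd_sub l (h.system.smoothB.differentiableAt hU hx i j) ((db.const_mul 2).fun_mul dy),
      pd_mul l (db.const_mul 2) dy, pd_const_mul l _ db, hw.pd_b hU hx h.system.smoothB hdB,
      hw.pd_y hU hx hε hjl, h.system.eqn_B x hx i j l hjl, hBe x hx, hFne hjl.symm]
    ring
  · rw [mul_comm]
    exact hstack x hx (Sum.inr a) j l (by simp) (by simp) hjl
  · exact ((h.smoothA p q).sub ((contDiffOn_const.mul (sn p)).mul (hw.smooth_w q))).congr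
      fun x hx => hAe x hx p q
  · simp only [Matrix.add_apply, Matrix.smul_apply, mul_vecMulVec_mul_apply, smul_eq_mul]
    exact (h.smoothX p q).add (contDiffOn_const.mul (((sn p).mul (sb q)).mul contDiffOn_const))
  · rw [hA' x hx, Matrix.transpose_mul]
    have h2 := reflection_transpose_mul (J := 1) (vecMulVec_mul_self (hw.norm_w x hx))
      (by rw [Matrix.transpose_vecMulVec, Matrix.mul_one, Matrix.one_mul])
    rw [Matrix.mul_one] at h2
    rw [← Matrix.mul_assoc, Matrix.mul_assoc _ (A x)ᵀ, h.orthA x hx, Matrix.mul_one, h2]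
  · rw [← connA_eq_fromBlocks]
    ext p q
    rw [mul_connA_apply]
    change pd l (fun y => A' y p q) x = A' x p (Sum.inl l) * stack F' G' x q l -
      if q = Sum.inl l then ∑ r, A' x p r * stack F' G' x r l else 0
    have hc : pd l (fun y => A' y p q) x =
        pd l (fun y => A y p q - 2 * (A y *ᵥ w y) p * w y q) x :=
      pd_congr l hU hx fun y hy => hAe y hy p q
    have dn : DifferentiableAt ℝ (fun y => (A y *ᵥ w y) p) x :=
      (sn p).differentiableAt_of_isOpen hU hx
    have dw := hw.diff_w hU hx q
    have h1 : ∀ r, A' x p r * stack F' G' x r l =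
        (A x p r - 2 * (A x *ᵥ w x) p * w x r) *
          (stack F G x r l - 2 * s * (w x r * (ε l * z x l)) +
            if r = Sum.inl l then 2 * s * w x (Sum.inl l) * (ε l * z x l) else 0) := by
      intro r
      rw [hAe x hx, hξ]
      by_cases hr : r = Sum.inl l <;> simp [hr]
    have hsum := (Finset.sum_congr rfl fun r _ => h1 r).trans
      (sum_reflection_mul (Sum.inl l) rfl (hw.norm_w x hx))
    rw [hc, pd_sub l (h.smoothA.differentiableAt hU hx p q) ((dn.const_mul 2).fun_mul dw),
      pd_mul l (dn.const_mul 2) dw, pd_const_mul l _ dn, hw.pd_n hU hx h, hw.pd_w x hx,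
      connA_mulVec, h.pd_A hx, hsum, hAe x hx, hξ]
    by_cases hq : q = Sum.inl l
    · simp only [hq, if_true, h.stack_diag hx]
      ring
    · simp only [if_neg hq]
      ring
  -- The factors s cancel against 2/s, and the derivative of X̃_j along x_l factors as -ε_j (b_{jl}
  -- - 2 b_j y_l)(e_l - 2 w_l n), a product of entries of the new B and A.
  · ext p j
    rw [neg_toCols_mul_matC_apply]
    change pd l (fun y => (X y + (2 / s) • (A y * Matrix.vecMulVec (w y) (z y) * (B y)ᵀ *
        Matrix.diagonal ε)) p j) x = _
    simp only [Matrix.add_apply, Matrix.smul_apply, mul_vecMulVec_mul_apply, smul_eq_mul]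
    have dn : DifferentiableAt ℝ (fun y => (A y *ᵥ w y) p) x :=
      (sn p).differentiableAt_of_isOpen hU hx
    have db : DifferentiableAt ℝ (fun y => (B y *ᵥ z y) j) x :=
      (sb j).differentiableAt_of_isOpen hU hx
    rw [pd_add l (h.smoothX.differentiableAt hU hx p j) (((dn.fun_mul db).mul_const _).const_mul _),
      pd_const_mul l _ ((dn.fun_mul db).mul_const _), pd_mul_const l _ (dn.fun_mul db), pd_mul l dn db,
      hw.pd_n hU hx h, hw.pd_b hU hx h.system.smoothB hdB, h.pd_X hx, hAe x hx, hBe x hx]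
    field_simp
    ring

end Transform

/-! ### Real matrices inside complex ones. -/

section Complexification

variable {a b c : Type*}

theorem cplx_apply (M : Matrix a b ℝ) (p : a) (q : b) : cplx M p q = (M p q : ℂ) := rfl

theorem cplx_mul [Fintype b] (M : Matrix a b ℝ) (M' : Matrix b c ℝ) :
    cplx (M * M') = cplx M * cplx M' :=
  Matrix.map_mul (f := Complex.ofRealHom)

theorem cplx_add (M M' : Matrix a b ℝ) : cplx (M + M') = cplx M + cplx M' := by
  ext; simp [cplx]

theorem cplx_sub (M M' : Matrix a b ℝ) : cplx (M - M') = cplx M - cplx M' := by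
  ext; simp [cplx]

theorem cplx_neg (M : Matrix a b ℝ) : cplx (-M) = -cplx M := by
  ext; simp [cplx]

theorem cplx_smul (r : ℝ) (M : Matrix a b ℝ) : cplx (r • M) = (r : ℂ) • cplx M := by
  ext; simp [cplx]

theorem cplx_one [DecidableEq a] : cplx (1 : Matrix a a ℝ) = 1 := by
  ext i j; by_cases h : i = j <;> simp [cplx, Matrix.one_apply, h]

theorem cplx_transpose (M : Matrix a b ℝ) : (cplx M)ᵀ = cplx Mᵀ := rfl

theorem cplx_injective : Function.Injective (cplx : Matrix a b ℝ → Matrix a b ℂ) := by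
  intro M M' h
  ext p q
  exact Complex.ofReal_injective (congrFun (congrFun h p) q)

theorem cplx_map_conj (M : Matrix a b ℝ) : (cplx M).map (starRingEnd ℂ) = cplx M := by
  ext; simp [cplx]

theorem exists_cplx_of_map_conj {M : Matrix a b ℂ} (h : M.map (starRingEnd ℂ) = M) :
    M = cplx (M.map Complex.re) := by
  ext p q
  have := congrFun (congrFun h p) q
  simp only [Matrix.map_apply] at this
  simpa [cplx] using (Complex.conj_eq_iff_re.1 this).symm

end Complexification

/-! ### The form diag(I, J) and the involution diag(I, -I) as diagonal sign matrices. -/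

section FormMatrices

variable {N k : ℕ} {ε : Fin N → ℝ}

theorem diagonal_sign_mul_self (hε : ∀ i, ε i * ε i = 1) :
    Matrix.diagonal ε * Matrix.diagonal ε = 1 := by
  rw [Matrix.diagonal_mul_diagonal]; simp [hε]

theorem formJ_mul_self (hε : ∀ i, ε i * ε i = 1) : formJ k ε * formJ k ε = 1 := by
  simp [formJ, Matrix.fromBlocks_multiply, diagonal_sign_mul_self hε]

theorem cplx_formJ_mul_self (hε : ∀ i, ε i * ε i = 1) :
    cplx (formJ k ε) * cplx (formJ k ε) = 1 := by
  rw [← cplx_mul, formJ_mul_self hε, cplx_one]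

theorem cplx_invol_mul_self : cplx (invol N k) * cplx (invol N k) = 1 := by
  rw [← cplx_mul, ← cplx_one]
  congr 1
  simp [invol, Matrix.fromBlocks_multiply]

theorem invol_eq_diagonal :
    invol N k = Matrix.diagonal (Sum.elim (fun _ => (1 : ℝ)) fun _ => -1) := by
  rw [← Matrix.fromBlocks_diagonal]
  simp [invol, ← Matrix.diagonal_neg]

theorem formJ_eq_diagonal : formJ k ε = Matrix.diagonal (Sum.elim (fun _ => (1 : ℝ)) ε) := by
  rw [← Matrix.fromBlocks_diagonal]
  simp [formJ]

theorem invol_conj_apply (M : Matrix (FIdx N k) (FIdx N k) ℂ) (p q : FIdx N k) :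
    (cplx (invol N k) * M * cplx (invol N k)) p q =
      ((Sum.elim (fun _ => (1 : ℝ)) (fun _ => -1) p : ℝ) : ℂ) * M p q *
        ((Sum.elim (fun _ => (1 : ℝ)) (fun _ => -1) q : ℝ) : ℂ) := by
  have : cplx (invol N k) = Matrix.diagonal fun p =>
      ((Sum.elim (fun _ => (1 : ℝ)) (fun _ => -1) p : ℝ) : ℂ) := by
    rw [invol_eq_diagonal, cplx, Matrix.diagonal_map (by simp)]
  rw [this, Matrix.mul_diagonal, Matrix.diagonal_mul]

theorem formJ_conj_apply (M : Matrix (FIdx N k) (FIdx N k) ℂ) (p q : FIdx N k) :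
    (cplx (formJ k ε) * M * cplx (formJ k ε)) p q =
      ((Sum.elim (fun _ => (1 : ℝ)) ε p : ℝ) : ℂ) * M p q *
        ((Sum.elim (fun _ => (1 : ℝ)) ε q : ℝ) : ℂ) := by
  have : cplx (formJ k ε) = Matrix.diagonal fun p =>
      ((Sum.elim (fun _ => (1 : ℝ)) ε p : ℝ) : ℂ) := by
    rw [formJ_eq_diagonal, cplx, Matrix.diagonal_map (by simp)]
  rw [this, Matrix.mul_diagonal, Matrix.diagonal_mul]

end FormMatrices

/-! ### Pointwise consequences of the reality conditions. -/

section RealityConsequences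

variable {N k : ℕ} {ε : Fin N → ℝ} {g : ℂ → Matrix (FIdx N k) (FIdx N k) ℂ}

theorem Reality.left_inv (h : Reality ε g) (hε : ∀ i, ε i * ε i = 1) (l : ℂ) :
    cplx (formJ k ε) * (g l)ᵀ * cplx (formJ k ε) * g l = 1 := by
  rw [Matrix.mul_assoc, Matrix.mul_assoc, ← Matrix.mul_assoc (g l)ᵀ, h.orth, cplx_formJ_mul_self hε]

/-- Orthogonality expresses the inverse linearly in the entries of g, so smoothness in x passes to
E⁻¹ at once. -/
theorem Reality.inv_eq (h : Reality ε g) (hε : ∀ i, ε i * ε i = 1) (l : ℂ) :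
    (g l)⁻¹ = cplx (formJ k ε) * (g l)ᵀ * cplx (formJ k ε) :=
  Matrix.inv_eq_left_inv (h.left_inv hε l)

theorem Reality.inv_mul (h : Reality ε g) (hε : ∀ i, ε i * ε i = 1) (l : ℂ) :
    (g l)⁻¹ * g l = 1 := by
  rw [h.inv_eq hε, h.left_inv hε]

theorem Reality.mul_inv (h : Reality ε g) (hε : ∀ i, ε i * ε i = 1) (l : ℂ) :
    g l * (g l)⁻¹ = 1 := mul_eq_one_comm.1 (h.inv_mul hε l)

/-- λ = 0 is fixed by λ ↦ λ̄ and by λ ↦ -λ. The value there is thus real and commutes with diag(I,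
-I), which kills the off-diagonal blocks. -/
theorem Reality.zero_eq (h : Reality ε g) :
    g 0 = cplx (Matrix.fromBlocks ((g 0).toBlocks₁₁.map Complex.re) 0 0
      ((g 0).toBlocks₂₂.map Complex.re)) := by
  have h1 : g 0 = cplx ((g 0).map Complex.re) :=
    exists_cplx_of_map_conj (by simpa using h.real 0)
  have h2 := h.twist 0
  rw [neg_zero] at h2
  have h3 : ∀ p q, _ := fun p q => congrFun (congrFun h2 p) q
  simp only [invol_conj_apply] at h3
  conv_lhs => rw [h1]
  congr 1
  ext p q
  rcases p with p | p <;> rcases q with q | q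
  · rfl
  · have := congrArg Complex.re (h3 (Sum.inl p) (Sum.inr q))
    simp at this
    simp; linarith
  · have := congrArg Complex.re (h3 (Sum.inr p) (Sum.inl q))
    simp at this
    simp; linarith
  · rfl

/-- The twisted conjugation symmetry at a purely imaginary point. -/
theorem Reality.imag (h : Reality ε g) {l : ℂ} (hl : starRingEnd ℂ l = -l) :
    cplx (invol N k) * (g l).map (starRingEnd ℂ) * cplx (invol N k) = g l := by
  have h1 := h.real l
  rw [hl, ← h.twist] at h1
  have hm : ∀ M M' : Matrix (FIdx N k) (FIdx N k) ℂ, (M * M').map (starRingEnd ℂ) =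
    M.map (starRingEnd ℂ) * M'.map (starRingEnd ℂ) := fun M M' => Matrix.map_mul
  simpa only [hm, cplx_map_conj] using h1

end RealityConsequences

/-! ### The frame at λ = 0 and system II. -/

section FrameAtZero

variable {N k : ℕ} {ε : Fin N → ℝ} {U : Set (Fin N → ℝ)}
  {F : (Fin N → ℝ) → Matrix (Fin N) (Fin N) ℝ} {G : (Fin N → ℝ) → Matrix (Fin k) (Fin N) ℝ}
  {E : (Fin N → ℝ) → ℂ → Matrix (FIdx N k) (FIdx N k) ℂ} {x : Fin N → ℝ}

theorem lax_eq (hε : ∀ i, ε i * ε i = 1) (ξ : Matrix (MIdx N k) (Fin N) ℝ) (l : ℂ) (i : Fin N) :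
    lax ε ξ l i = l • cplx (matA k ε i) +
      cplx (Matrix.fromBlocks (connA ξ i) 0 0 (connB ε ξ i)) := by
  rw [lax, matComm_matA_matP hε]

theorem IsFrame.zero_eq (h : IsFrame ε U F G E) (hx : x ∈ U) :
    E x 0 = cplx (Matrix.fromBlocks (blockA E x) 0 0 (blockB E x)) :=
  (h.reality x hx).zero_eq

theorem IsFrame.orth_zero (h : IsFrame ε U F G E) (hx : x ∈ U) :
    (blockA E x)ᵀ * blockA E x = 1 ∧
      (blockB E x)ᵀ * Matrix.diagonal ε * blockB E x = Matrix.diagonal ε := by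
  have h1 := (h.reality x hx).orth 0
  rw [h.zero_eq hx, cplx_transpose, ← cplx_mul, ← cplx_mul] at h1
  have h2 := cplx_injective h1
  simp only [formJ, Matrix.fromBlocks_transpose, Matrix.fromBlocks_multiply,
    Matrix.fromBlocks_inj] at h2
  simpa using And.intro h2.1 h2.2.2.2

/-- The inverse of `E(x, 0)`. -/
theorem IsFrame.inv_zero (h : IsFrame ε U F G E) (hε : ∀ i, ε i * ε i = 1) (hx : x ∈ U) :
    (E x 0)⁻¹ = cplx (Matrix.fromBlocks (blockA E x)ᵀ 0 0
      (Matrix.diagonal ε * (blockB E x)ᵀ * Matrix.diagonal ε)) := by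
  rw [(h.reality x hx).inv_eq hε, h.zero_eq hx, cplx_transpose, ← cplx_mul, ← cplx_mul]
  congr 1
  simp [formJ, Matrix.fromBlocks_transpose, Matrix.fromBlocks_multiply]

theorem IsFrame.smooth_at (h : IsFrame ε U F G E) (l : ℂ) (p q : FIdx N k) :
    ContDiffOn ℝ ∞ (fun x => E x l p q) U :=
  (h.smooth p q).comp (contDiffOn_id.prodMk contDiffOn_const) fun _ hx => ⟨hx, Set.mem_univ _⟩

theorem IsFrame.smoothA (h : IsFrame ε U F G E) : SmoothMat U (blockA E) := fun p q =>
  Complex.reCLM.contDiff.comp_contDiffOn (h.smooth_at 0 (Sum.inl p) (Sum.inl q))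

theorem IsFrame.smoothB (h : IsFrame ε U F G E) : SmoothMat U (blockB E) := fun p q =>
  Complex.reCLM.contDiff.comp_contDiffOn (h.smooth_at 0 (Sum.inr p) (Sum.inr q))

/-- At λ = 0 only the block-diagonal part [a_i, v] of the Lax connection remains, so A and B satisfy
separate linear systems. -/
theorem IsFrame.pdMat_zero (h : IsFrame ε U F G E) (hε : ∀ i, ε i * ε i = 1) (hx : x ∈ U)
    (i : Fin N) : pdMat i (fun y => E y 0) x = cplx (Matrix.fromBlocks
      (blockA E x * connA (stack F G x) i) 0 0 (blockB E x * connB ε (stack F G x) i)) := by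
  rw [h.triv x hx 0 i, lax_eq hε, h.zero_eq hx, zero_smul, zero_add, ← cplx_mul]
  congr 1
  simp [Matrix.fromBlocks_multiply]

theorem IsFrame.pdMat_A (h : IsFrame ε U F G E) (hε : ∀ i, ε i * ε i = 1) (hU : IsOpen U)
    (hx : x ∈ U) (i : Fin N) :
    pdMat i (blockA E) x = blockA E x * connA (stack F G x) i := by
  ext p q
  have h1 := congrFun (congrFun (h.pdMat_zero hε hx i) (Sum.inl p)) (Sum.inl q)
  have h2 := pd_clm i Complex.reCLM
    ((h.smooth_at 0 (Sum.inl p) (Sum.inl q)).differentiableAt_of_isOpen hU hx)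
  have h3 : pd i (fun y => E y 0 (Sum.inl p) (Sum.inl q)) x =
    (((blockA E x * connA (stack F G x) i) p q : ℝ) : ℂ) := h1
  rw [h3] at h2
  exact h2

theorem IsFrame.pdMat_B (h : IsFrame ε U F G E) (hε : ∀ i, ε i * ε i = 1) (hU : IsOpen U)
    (hx : x ∈ U) (i : Fin N) :
    pdMat i (blockB E) x = blockB E x * connB ε (stack F G x) i := by
  ext p q
  have h1 := congrFun (congrFun (h.pdMat_zero hε hx i) (Sum.inr p)) (Sum.inr q)
  have h2 := pd_clm i Complex.reCLM
    ((h.smooth_at 0 (Sum.inr p) (Sum.inr q)).differentiableAt_of_isOpen hU hx)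
  have h3 : pd i (fun y => E y 0 (Sum.inr p) (Sum.inr q)) x =
    (((blockB E x * connB ε (stack F G x) i) p q : ℝ) : ℂ) := h1
  rw [h3] at h2
  exact h2

theorem IsFrame.isSystemII (h : IsFrame ε U F G E) (hFG : IsSystem ε U F G)
    (hε : ∀ i, ε i * ε i = 1) (hU : IsOpen U) : IsSystemII ε U F G (blockB E) where
  smoothF := hFG.smoothF
  smoothG := hFG.smoothG
  smoothB := h.smoothB
  diag_zero := hFG.diag_zero
  orth x hx := (h.orth_zero hx).2
  eqn_gauss x hx i j hij := hFG.gauss hε hx hij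
  eqn_F x hx i j l hij hil hjl :=
    hFG.pd_stack hε hx (p := Sum.inl i) (by simpa using hil) (by simpa using hij) hjl
  eqn_B x hx i j l hjl := by
    have h1 := congrFun (congrFun (h.pdMat_B hε hU hx l) i) j
    rw [mul_connB_apply, if_neg hjl, sub_zero, mul_comm] at h1
    exact h1
  eqn_G x hx a j l hjl := by
    rw [mul_comm]
    exact hFG.pd_stack hε hx (p := Sum.inr a) (by simp) (by simp) hjl

end FrameAtZero

/-! ### The vector E(x, -is)⁻¹(W; iZ): reality, isotropy, non-vanishing. -/

section PoleVector

variable {N k : ℕ} {ε : Fin N → ℝ} {U : Set (Fin N → ℝ)}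
  {F : (Fin N → ℝ) → Matrix (Fin N) (Fin N) ℝ} {G : (Fin N → ℝ) → Matrix (Fin k) (Fin N) ℝ}
  {E : (Fin N → ℝ) → ℂ → Matrix (FIdx N k) (FIdx N k) ℂ} {x : Fin N → ℝ}
  {s : ℝ} {W : MIdx N k → ℝ} {Z : Fin N → ℝ}

theorem conj_isoVec (w : MIdx N k → ℝ) (z : Fin N → ℝ) :
    cplx (invol N k) *ᵥ (starRingEnd ℂ ∘ isoVec w z) = isoVec w z := by
  ext p
  rw [invol_eq_diagonal, cplx, Matrix.diagonal_map (by simp), Matrix.mulVec_diagonal]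
  rcases p with p | p <;> simp [isoVec]

/-- The real (w; iz) are exactly the fixed vectors of the antilinear involution u ↦ diag(I, -I) ū;
the converse half is `conj_isoVec`. -/
theorem isoVec_of_conj {u : FIdx N k → ℂ}
    (h : cplx (invol N k) *ᵥ (starRingEnd ℂ ∘ u) = u) :
    u = isoVec (fun a => (u (Sum.inl a)).re) fun j => (u (Sum.inr j)).im := by
  ext p
  have h1 := congrFun h p
  rw [invol_eq_diagonal, cplx, Matrix.diagonal_map (by simp), Matrix.mulVec_diagonal] at h1
  rcases p with p | p
  · have := congrArg Complex.im h1
    simp at this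
    apply Complex.ext
    · simp [isoVec]
    · simp [isoVec]; linarith
  · have := congrArg Complex.re h1
    simp at this
    apply Complex.ext
    · simp [isoVec]; linarith
    · simp [isoVec]

theorem isoVec_form (w : MIdx N k → ℝ) (z : Fin N → ℝ) :
    isoVec w z ⬝ᵥ (cplx (formJ k ε) *ᵥ isoVec w z) =
      ((∑ a, w a ^ 2 - ∑ j, ε j * z j ^ 2 : ℝ) : ℂ) := by
  have : cplx (formJ k ε) = Matrix.diagonal fun p =>
      ((Sum.elim (fun _ => (1 : ℝ)) ε p : ℝ) : ℂ) := by
    rw [formJ_eq_diagonal, cplx, Matrix.diagonal_map (by simp)]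
  simp only [this, dotProduct, Matrix.mulVec_diagonal]
  rw [Fintype.sum_sum_type, Complex.ofReal_sub, sub_eq_add_neg, Complex.ofReal_sum,
    Complex.ofReal_sum, ← Finset.sum_neg_distrib]
  congr 1
  · exact Finset.sum_congr rfl fun a _ => by simp [isoVec]; ring
  · refine Finset.sum_congr rfl fun j _ => ?_
    simp only [isoVec, Sum.elim_inr]
    push_cast
    linear_combination (ε j : ℂ) * (z j : ℂ) ^ 2 * Complex.I_mul_I

theorem isoVec_injective {w w' : MIdx N k → ℝ} {z z' : Fin N → ℝ}
    (h : isoVec w z = isoVec w' z') : w = w' ∧ z = z' := by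
  constructor
  · ext a; simpa [isoVec] using congrFun h (Sum.inl a)
  · ext a; simpa [isoVec] using congrFun h (Sum.inr a)

theorem IsFrame.mulVec_tildeVec (h : IsFrame ε U F G E) (hε : ∀ i, ε i * ε i = 1) (hx : x ∈ U) :
    E x (-(Complex.I * s)) *ᵥ tildeVec E s W Z x = isoVec W Z := by
  rw [tildeVec, Matrix.mulVec_mulVec, (h.reality x hx).mul_inv hε, Matrix.one_mulVec]

/-- -is is purely imaginary, so E(x, -is) commutes with the antilinear involution, and the preimage
of a fixed vector is fixed. -/
theorem IsFrame.tildeVec_eq (h : IsFrame ε U F G E) (hε : ∀ i, ε i * ε i = 1) (hx : x ∈ U) :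
    tildeVec E s W Z x = isoVec (tildeW E s W Z x) (tildeZ E s W Z x) := by
  refine isoVec_of_conj ?_
  set u := tildeVec E s W Z x with hu
  set c : ℂ := -(Complex.I * s) with hc
  have hcc : starRingEnd ℂ c = -c := by simp [hc]
  have h1 : E x c *ᵥ u = isoVec W Z := h.mulVec_tildeVec hε hx
  have h2 := (h.reality x hx).imag hcc
  have h3 : (E x c).map (starRingEnd ℂ) *ᵥ (starRingEnd ℂ ∘ u) = starRingEnd ℂ ∘ isoVec W Z := by
    rw [← h1]
    ext i
    exact ((starRingEnd ℂ).map_mulVec (E x c) u i).symm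
  have h4 : E x c *ᵥ (cplx (invol N k) *ᵥ (starRingEnd ℂ ∘ u)) = isoVec W Z := by
    rw [← h2, Matrix.mulVec_mulVec, Matrix.mul_assoc, cplx_invol_mul_self, Matrix.mul_one,
      ← Matrix.mulVec_mulVec, h3, conj_isoVec]
  have h5 : u = (E x c)⁻¹ *ᵥ isoVec W Z := rfl
  rw [← h4, Matrix.mulVec_mulVec, (h.reality x hx).inv_mul hε, Matrix.one_mulVec] at h5
  exact h5.symm

/-- (W; iZ) is isotropic for the bilinear form, not the sesquilinear one, and E(x, -is) preserves
the bilinear form. -/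
theorem IsFrame.sum_tildeW_sq (h : IsFrame ε U F G E) (hε : ∀ i, ε i * ε i = 1) (hx : x ∈ U)
    (hW : ∑ a, W a ^ 2 = 1) (hZ : ∑ j, ε j * Z j ^ 2 = 1) :
    ∑ a, tildeW E s W Z x a ^ 2 = ∑ j, ε j * tildeZ E s W Z x j ^ 2 := by
  have h1 := isoVec_form (k := k) (ε := ε) W Z
  rw [hW, hZ, sub_self, ← h.mulVec_tildeVec (s := s) (x := x) hε hx, Matrix.mulVec_mulVec,
    Matrix.dotProduct_mulVec, ← Matrix.vecMul_transpose, Matrix.vecMul_vecMul,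
    ← Matrix.mul_assoc, (h.reality x hx).orth, ← Matrix.dotProduct_mulVec,
    h.tildeVec_eq hε hx, isoVec_form] at h1
  exact sub_eq_zero.1 (Complex.ofReal_injective h1)

/-- For a definite form, W̃ = 0 forces Z̃ = 0 by equality of the squared norms, hence (W; iZ) = 0,
against |W| = 1. In the Lorentzian case Z̃ could be null, and the property is assumed. -/
theorem IsFrame.tildeW_ne_zero (h : IsFrame ε U F G E)
    (hε : ε = euclideanSign N ∨ ε = lorentzSign N) (hx : x ∈ U)
    (hW : ∑ a, W a ^ 2 = 1) (hZ : ∑ j, ε j * Z j ^ 2 = 1)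
    (hreg : ε = lorentzSign N → tildeW E s W Z x ≠ 0) : tildeW E s W Z x ≠ 0 := by
  rcases hε with he | he
  · intro h0
    have hs := sign_mul_self (Or.inl he)
    have h1 := h.sum_tildeW_sq (s := s) hs hx hW hZ
    have hz : tildeZ E s W Z x = 0 := by
      rw [h0] at h1
      simp only [he, euclideanSign, one_mul, Pi.zero_apply] at h1
      have h2 : ∑ j, tildeZ E s W Z x j ^ 2 = 0 := by rw [← h1]; simp
      rw [Finset.sum_eq_zero_iff_of_nonneg fun _ _ => sq_nonneg _] at h2
      ext j
      simpa using h2 j (Finset.mem_univ j)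
    have h3 := h.mulVec_tildeVec (s := s) (W := W) (Z := Z) hs hx
    rw [h.tildeVec_eq hs hx, h0, hz] at h3
    have h4 : isoVec (0 : MIdx N k → ℝ) (0 : Fin N → ℝ) = 0 := by
      ext p; rcases p with p | p <;> simp [isoVec]
    rw [h4, Matrix.mulVec_zero, ← h4] at h3
    rw [← (isoVec_injective h3).1] at hW
    simp at hW
  · exact hreg he

end PoleVector

/-! ### The differential equations of the pole vector and their normalization. -/

section PoleEquation

variable {N k : ℕ} {ε : Fin N → ℝ} {U : Set (Fin N → ℝ)}
  {F : (Fin N → ℝ) → Matrix (Fin N) (Fin N) ℝ} {G : (Fin N → ℝ) → Matrix (Fin k) (Fin N) ℝ}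
  {E : (Fin N → ℝ) → ℂ → Matrix (FIdx N k) (FIdx N k) ℂ} {x : Fin N → ℝ}
  {s : ℝ} {W : MIdx N k → ℝ} {Z : Fin N → ℝ}

theorem IsFrame.smooth_tildeVec (h : IsFrame ε U F G E) (hε : ∀ i, ε i * ε i = 1)
    (p : FIdx N k) : ContDiffOn ℝ ∞ (fun x => tildeVec E s W Z x p) U := by
  have h1 : ∀ x ∈ U, tildeVec E s W Z x p =
      ∑ q, ((Sum.elim (fun _ => (1 : ℝ)) ε p : ℝ) : ℂ) * E x (-(Complex.I * s)) q p *
        ((Sum.elim (fun _ => (1 : ℝ)) ε q : ℝ) : ℂ) * isoVec W Z q := by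
    intro x hx
    rw [tildeVec, (h.reality x hx).inv_eq hε]
    simp only [Matrix.mulVec, dotProduct, formJ_conj_apply, Matrix.transpose_apply]
  refine ContDiffOn.congr ?_ h1
  exact ContDiffOn.sum fun q _ => ((contDiffOn_const.mul (h.smooth_at _ q p)).mul
    contDiffOn_const).mul contDiffOn_const

theorem IsFrame.smooth_tildeW (h : IsFrame ε U F G E) (hε : ∀ i, ε i * ε i = 1) (p : MIdx N k) :
    ContDiffOn ℝ ∞ (fun x => tildeW E s W Z x p) U :=
  Complex.reCLM.contDiff.comp_contDiffOn (h.smooth_tildeVec hε (Sum.inl p))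

theorem IsFrame.smooth_tildeZ (h : IsFrame ε U F G E) (hε : ∀ i, ε i * ε i = 1) (j : Fin N) :
    ContDiffOn ℝ ∞ (fun x => tildeZ E s W Z x j) U :=
  Complex.imCLM.contDiff.comp_contDiffOn (h.smooth_tildeVec hε (Sum.inr j))

/-- Differentiate the constant vector E(x, -is)(W̃; iZ̃) and cancel the invertible factor. -/
theorem IsFrame.pd_tildeVec (h : IsFrame ε U F G E) (hε : ∀ i, ε i * ε i = 1) (hU : IsOpen U)
    (hx : x ∈ U) (i : Fin N) (p : FIdx N k) :
    pd i (fun y => tildeVec E s W Z y p) x =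
      -(lax ε (stack F G x) (-(Complex.I * s)) i *ᵥ tildeVec E s W Z x) p := by
  set c : ℂ := -(Complex.I * s) with hc
  have hd : ∀ q, DifferentiableAt ℝ (fun y => tildeVec E s W Z y q) x :=
    fun q => (h.smooth_tildeVec hε q).differentiableAt_of_isOpen hU hx
  have h1 : E x c *ᵥ (lax ε (stack F G x) c i *ᵥ tildeVec E s W Z x +
      fun q => pd i (fun y => tildeVec E s W Z y q) x) = 0 := by
    ext q
    have h2 := pd_mulVec (M := fun y => E y c) (v := tildeVec E s W Z) i q
      (fun r => (h.smooth_at c q r).differentiableAt_of_isOpen hU hx) hd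
    have h3 : pd i (fun y => (E y c *ᵥ tildeVec E s W Z y) q) x = 0 := by
      rw [pd_congr i hU hx (g := fun _ => isoVec W Z q)
        fun y hy => by rw [h.mulVec_tildeVec hε hy]]
      simp [pd]
    rw [h3, h.triv x hx] at h2
    rw [Matrix.mulVec_add, Matrix.mulVec_mulVec, Pi.add_apply, Pi.zero_apply, h2]
    rfl
  have h4 := congrArg ((E x c)⁻¹ *ᵥ ·) h1
  simp only [Matrix.mulVec_mulVec, (h.reality x hx).inv_mul hε, Matrix.one_mulVec,
    Matrix.mulVec_zero] at h4
  have := congrFun h4 p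
  simp only [Pi.add_apply, Pi.zero_apply] at this
  rw [eq_neg_iff_add_eq_zero, add_comm, this]

/-- The factor -is meets the i in front of z, so that the pole contributes a real term to the first
component. -/
theorem lax_mulVec_isoVec_inl (hε : ∀ i, ε i * ε i = 1) (ξ : Matrix (MIdx N k) (Fin N) ℝ)
    (i : Fin N) (w : MIdx N k → ℝ) (z : Fin N → ℝ) (p : MIdx N k) :
    ((lax ε ξ (-(Complex.I * s)) i *ᵥ isoVec w z) (Sum.inl p)).re =
      (connA ξ i *ᵥ w) p - if p = Sum.inl i then s * (ε i * z i) else 0 := by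
  rw [lax_eq hε, Matrix.add_mulVec, Matrix.smul_mulVec, Pi.add_apply, Pi.smul_apply]
  simp only [Matrix.mulVec, dotProduct, Fintype.sum_sum_type (α₁ := MIdx N k), cplx_apply, matA,
    isoVec, Sum.elim_inl, Sum.elim_inr, Matrix.fromBlocks_apply₁₁, Matrix.fromBlocks_apply₁₂,
    Matrix.mul_diagonal, Matrix.neg_apply, matD, Matrix.single_apply, Matrix.zero_apply,
    Complex.ofReal_zero, zero_mul, Finset.sum_const_zero, add_zero, zero_add]
  by_cases hp : p = Sum.inl i
  · subst hp
    simp [-Fintype.sum_sum_type]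
    ring
  · simp [hp, Ne.symm hp, -Fintype.sum_sum_type]

theorem lax_mulVec_isoVec_inr (hε : ∀ i, ε i * ε i = 1) (ξ : Matrix (MIdx N k) (Fin N) ℝ)
    (i : Fin N) (w : MIdx N k → ℝ) (z : Fin N → ℝ) (j : Fin N) :
    ((lax ε ξ (-(Complex.I * s)) i *ᵥ isoVec w z) (Sum.inr j)).im =
      (connB ε ξ i *ᵥ z) j - if j = i then s * w (Sum.inl i) else 0 := by
  rw [lax_eq hε, Matrix.add_mulVec, Matrix.smul_mulVec, Pi.add_apply, Pi.smul_apply]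
  simp only [Matrix.mulVec, dotProduct, Fintype.sum_sum_type (α₁ := MIdx N k), cplx_apply, matA,
    isoVec, Sum.elim_inl, Sum.elim_inr, Matrix.fromBlocks_apply₂₁, Matrix.fromBlocks_apply₂₂,
    Matrix.transpose_apply, matD, Matrix.single_apply, Matrix.zero_apply,
    Complex.ofReal_zero, zero_mul, Finset.sum_const_zero, add_zero, zero_add]
  by_cases hp : j = i
  · subst hp
    simp [-Fintype.sum_sum_type]
    ring
  · simp [hp, Ne.symm hp, -Fintype.sum_sum_type]

theorem IsFrame.pd_tildeW (h : IsFrame ε U F G E) (hε : ∀ i, ε i * ε i = 1) (hU : IsOpen U)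
    (hx : x ∈ U) (l : Fin N) (p : MIdx N k) :
    pd l (fun y => tildeW E s W Z y p) x = -(connA (stack F G x) l *ᵥ tildeW E s W Z x) p +
      if p = Sum.inl l then s * (ε l * tildeZ E s W Z x l) else 0 := by
  have h1 := pd_clm l Complex.reCLM
    ((h.smooth_tildeVec (s := s) (W := W) (Z := Z) hε (Sum.inl p)).differentiableAt_of_isOpen hU hx)
  rw [h.pd_tildeVec hε hU hx, h.tildeVec_eq hε hx] at h1
  refine h1.trans ?_
  rw [map_neg, Complex.reCLM_apply, lax_mulVec_isoVec_inl hε]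
  ring

theorem IsFrame.pd_tildeZ (h : IsFrame ε U F G E) (hε : ∀ i, ε i * ε i = 1) (hU : IsOpen U)
    (hx : x ∈ U) (l : Fin N) (j : Fin N) :
    pd l (fun y => tildeZ E s W Z y j) x = -(connB ε (stack F G x) l *ᵥ tildeZ E s W Z x) j +
      if j = l then s * tildeW E s W Z x (Sum.inl l) else 0 := by
  have h1 := pd_clm l Complex.imCLM
    ((h.smooth_tildeVec (s := s) (W := W) (Z := Z) hε (Sum.inr j)).differentiableAt_of_isOpen hU hx)
  rw [h.pd_tildeVec hε hU hx, h.tildeVec_eq hε hx] at h1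
  refine h1.trans ?_
  rw [map_neg, Complex.imCLM_apply, lax_mulVec_isoVec_inr hε]
  ring

/-- `connA` is skew-symmetric, so only the pole term changes the length of W̃. -/
theorem sum_mul_connA_mulVec (ξ : Matrix (MIdx N k) (Fin N) ℝ) (i : Fin N) (w : MIdx N k → ℝ) :
    ∑ p, w p * (connA ξ i *ᵥ w) p = 0 := by
  simp only [connA_mulVec, mul_sub, mul_ite, mul_zero, Finset.sum_sub_distrib,
    Finset.sum_ite_eq', Finset.mem_univ, if_true, Finset.mul_sum]
  rw [← Finset.sum_sub_distrib]
  exact Finset.sum_eq_zero fun p _ => by ring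

/-- W̃ and Z̃ have the same squared norm q, so one factor q^(-1/2) normalizes both. Its logarithmic
derivative along x_l is -s ŵ_l ε_l ẑ_l, the common scaling term of the pole system. -/
theorem IsFrame.isPolePair (h : IsFrame ε U F G E) (hε : ∀ i, ε i * ε i = 1) (hU : IsOpen U)
    (hW : ∑ a, W a ^ 2 = 1) (hZ : ∑ j, ε j * Z j ^ 2 = 1)
    (h0 : ∀ x ∈ U, tildeW E s W Z x ≠ 0) :
    IsPolePair ε U F G s (hatW E s W Z) (hatZ ε E s W Z) := by
  set q : (Fin N → ℝ) → ℝ := fun x => ∑ a, tildeW E s W Z x a ^ 2 with hq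
  have hqZ : ∀ x ∈ U, ∑ j, ε j * tildeZ E s W Z x j ^ 2 = q x :=
    fun x hx => (h.sum_tildeW_sq hε hx hW hZ).symm
  have hqpos : ∀ x ∈ U, 0 < q x := by
    intro x hx
    obtain ⟨a, ha⟩ := Function.ne_iff.1 (h0 x hx)
    exact Finset.sum_pos' (fun _ _ => sq_nonneg _) ⟨a, Finset.mem_univ a,
      lt_of_le_of_ne' (sq_nonneg _) (pow_ne_zero 2 ha)⟩
  have sw := h.smooth_tildeW (s := s) (W := W) (Z := Z) hε
  have sz := h.smooth_tildeZ (s := s) (W := W) (Z := Z) hε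
  have sq : ContDiffOn ℝ ∞ q U := ContDiffOn.sum fun a _ => (sw a).pow 2
  have sr : ContDiffOn ℝ ∞ (fun x => (√(q x))⁻¹) U :=
    (sq.sqrt fun x hx => (hqpos x hx).ne').inv fun x hx => (Real.sqrt_pos.2 (hqpos x hx)).ne'
  have eW : ∀ p x, hatW E s W Z x p = (√(q x))⁻¹ * tildeW E s W Z x p := fun p x => rfl
  have eZ : ∀ j, ∀ x ∈ U, hatZ ε E s W Z x j = (√(q x))⁻¹ * tildeZ E s W Z x j := by
    intro j x hx
    simp only [hatZ, hqZ x hx]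
    rfl
  have hr2 : ∀ x ∈ U, (√(q x))⁻¹ ^ 2 * q x = 1 := by
    intro x hx
    rw [inv_pow, Real.sq_sqrt (hqpos x hx).le, inv_mul_cancel₀ (hqpos x hx).ne']
  have dq : ∀ x ∈ U, ∀ l, pd l q x =
      2 * (s * tildeW E s W Z x (Sum.inl l) * (ε l * tildeZ E s W Z x l)) := by
    intro x hx l
    have dw := fun a => (sw a).differentiableAt_of_isOpen hU hx
    have e1 : q = fun y => ∑ a, tildeW E s W Z y a * tildeW E s W Z y a := by
      funext y; exact Finset.sum_congr rfl fun a _ => by ring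
    rw [e1, pd_sum l _ fun a _ => (dw a).fun_mul (dw a)]
    have e2 : ∀ a, pd l (fun y => tildeW E s W Z y a * tildeW E s W Z y a) x =
        -2 * (tildeW E s W Z x a * (connA (stack F G x) l *ᵥ tildeW E s W Z x) a) +
        if a = Sum.inl l then
          2 * (s * tildeW E s W Z x (Sum.inl l) * (ε l * tildeZ E s W Z x l)) else 0 := by
      intro a
      rw [pd_mul l (dw a) (dw a), h.pd_tildeW hε hU hx]
      by_cases ha : a = Sum.inl l
      · simp only [ha, if_true]; ring
      · simp only [ha, if_false]; ring
    rw [Finset.sum_congr rfl fun a _ => e2 a, Finset.sum_add_distrib, ← Finset.mul_sum,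
      sum_mul_connA_mulVec, Finset.sum_ite_eq']
    simp
  have dr : ∀ x ∈ U, ∀ l, pd l (fun y => (√(q y))⁻¹) x = -((√(q x))⁻¹ ^ 3 *
      (s * tildeW E s W Z x (Sum.inl l) * (ε l * tildeZ E s W Z x l))) := by
    intro x hx l
    have hp := Real.sqrt_pos.2 (hqpos x hx)
    rw [pd_comp_scalar l ((Real.hasDerivAt_sqrt (hqpos x hx).ne').fun_inv hp.ne')
      (sq.differentiableAt_of_isOpen hU hx), dq x hx]
    field_simp
  refine
    { smooth_w := fun p => sr.mul (sw p)
      smooth_z := fun j => (sr.mul (sz j)).congr (eZ j)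
      norm_w := fun x hx => ?_
      norm_z := fun x hx => ?_
      pd_w := fun x hx l p => ?_
      pd_z := fun x hx l j => ?_ }
  · simp only [eW, mul_pow, ← Finset.mul_sum]
    exact hr2 x hx
  · rw [← hr2 x hx, ← hqZ x hx, Finset.mul_sum, hqZ x hx]
    exact Finset.sum_congr rfl fun j _ => by rw [eZ j x hx]; ring
  · have e : connA (stack F G x) l *ᵥ hatW E s W Z x =
        (√(q x))⁻¹ • (connA (stack F G x) l *ᵥ tildeW E s W Z x) := by
      rw [← Matrix.mulVec_smul]; rfl
    simp only [e, eW, Pi.smul_apply, smul_eq_mul, eZ l x hx]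
    rw [pd_mul l (sr.differentiableAt_of_isOpen hU hx) ((sw p).differentiableAt_of_isOpen hU hx),
      dr x hx, h.pd_tildeW hε hU hx]
    by_cases hp : p = Sum.inl l
    · simp only [hp, if_true]; ring
    · simp only [hp, if_false]; ring
  · have e0 : hatZ ε E s W Z x = (√(q x))⁻¹ • tildeZ E s W Z x := funext fun j => eZ j x hx
    have e : connB ε (stack F G x) l *ᵥ hatZ ε E s W Z x =
        (√(q x))⁻¹ • (connB ε (stack F G x) l *ᵥ tildeZ E s W Z x) := by
      rw [← Matrix.mulVec_smul, e0]
    rw [pd_congr l hU hx (eZ j),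
      pd_mul l (sr.differentiableAt_of_isOpen hU hx) ((sz j).differentiableAt_of_isOpen hU hx),
      dr x hx, h.pd_tildeZ hε hU hx, e]
    simp only [eW, Pi.smul_apply, smul_eq_mul, eZ _ x hx]
    by_cases hp : j = l
    · simp only [hp, if_true]; ring
    · simp only [hp, if_false]; ring

end PoleEquation

/-! ### Sym's formula: the λ-derivative of the frame at 0. -/

section FrameDerivative

theorem hasDerivAt_matrix_mul {a b c : Type*} [Fintype b] {M : ℂ → Matrix a b ℂ}
    {M' : ℂ → Matrix b c ℂ} {D : Matrix a b ℂ} {D' : Matrix b c ℂ} {l : ℂ}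
    (h : ∀ p q, HasDerivAt (fun l => M l p q) (D p q) l)
    (h' : ∀ p q, HasDerivAt (fun l => M' l p q) (D' p q) l) (p : a) (q : c) :
    HasDerivAt (fun l => (M l * M' l) p q) ((D * M' l + M l * D') p q) l := by
  have : HasDerivAt (fun l => ∑ r, M l p r * M' l r q)
      (∑ r, (D p r * M' l r q + M l p r * D' r q)) l :=
    HasDerivAt.fun_sum fun r _ => (h p r).fun_mul (h' r q)
  simpa only [Matrix.add_apply, Matrix.mul_apply, Finset.sum_add_distrib] using this

variable {N k : ℕ} {ε : Fin N → ℝ} {U : Set (Fin N → ℝ)}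
  {F : (Fin N → ℝ) → Matrix (Fin N) (Fin N) ℝ} {G : (Fin N → ℝ) → Matrix (Fin k) (Fin N) ℝ}
  {E : (Fin N → ℝ) → ℂ → Matrix (FIdx N k) (FIdx N k) ℂ} {x : Fin N → ℝ}

/-- `(∂E/∂λ)(x, 0)`. -/
noncomputable def frameDeriv (E : (Fin N → ℝ) → ℂ → Matrix (FIdx N k) (FIdx N k) ℂ) (x : Fin N → ℝ) :
    Matrix (FIdx N k) (FIdx N k) ℂ :=
  Matrix.of fun p q => deriv (fun l => E x l p q) 0

/-- The upper right block of `(∂E/∂λ)(x, 0)`. -/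
noncomputable def frameDerivBlock (E : (Fin N → ℝ) → ℂ → Matrix (FIdx N k) (FIdx N k) ℂ) (x : Fin N → ℝ) :
    Matrix (MIdx N k) (Fin N) ℝ :=
  (frameDeriv E x).toBlocks₁₂.map Complex.re

/-- The upper right block of `(∂E/∂λ)(x, 0) E(x, 0)⁻¹`. -/
noncomputable def symBlock (ε : Fin N → ℝ) (E : (Fin N → ℝ) → ℂ → Matrix (FIdx N k) (FIdx N k) ℂ)
    (x : Fin N → ℝ) : Matrix (MIdx N k) (Fin N) ℝ :=
  frameDerivBlock E x * (Matrix.diagonal ε * (blockB E x)ᵀ * Matrix.diagonal ε)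

theorem IsFrame.hasDerivAt (h : IsFrame ε U F G E) (hx : x ∈ U) (p q : FIdx N k) :
    HasDerivAt (fun l => E x l p q) (frameDeriv E x p q) 0 :=
  (h.holo x hx p q 0).hasDerivAt

theorem IsFrame.frameDeriv_conj (h : IsFrame ε U F G E) (hx : x ∈ U) :
    (frameDeriv E x).map (starRingEnd ℂ) = frameDeriv E x := by
  ext p q
  have h1 := (h.hasDerivAt hx p q).conj_conj
  have h2 : (starRingEnd ℂ ∘ (fun l => E x l p q) ∘ starRingEnd ℂ) = fun l => E x l p q :=
    funext fun l => congrFun (congrFun ((h.reality x hx).real l) p) q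
  rw [h2, map_zero] at h1
  exact h1.unique (h.hasDerivAt hx p q)

/-- The chain rule for λ ↦ -λ turns commutation with the involution into anticommutation: the
derivative at 0 is off-diagonal. -/
theorem IsFrame.frameDeriv_twist (h : IsFrame ε U F G E) (hx : x ∈ U) :
    cplx (invol N k) * frameDeriv E x * cplx (invol N k) = -frameDeriv E x := by
  ext p q
  rw [invol_conj_apply]
  have h0 : HasDerivAt (fun l => E x l p q) (frameDeriv E x p q) (-0) := by
    rw [neg_zero]; exact h.hasDerivAt hx p q
  have h1 := h0.scomp (0 : ℂ) (hasDerivAt_neg (0 : ℂ))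
  have h2 := ((h.hasDerivAt hx p q).const_mul
    ((Sum.elim (fun _ => (1 : ℝ)) (fun _ => -1) p : ℝ) : ℂ)).mul_const
    ((Sum.elim (fun _ => (1 : ℝ)) (fun _ => -1) q : ℝ) : ℂ)
  have h3 : (fun l => E x l p q) ∘ (fun l => -l) = fun l =>
      ((Sum.elim (fun _ => (1 : ℝ)) (fun _ => -1) p : ℝ) : ℂ) * E x l p q *
        ((Sum.elim (fun _ => (1 : ℝ)) (fun _ => -1) q : ℝ) : ℂ) := by
    funext l
    rw [← invol_conj_apply, (h.reality x hx).twist]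
    rfl
  have h4 : HasDerivAt ((fun l => E x l p q) ∘ fun l => -l) (-frameDeriv E x p q) 0 := by
    simpa using h1
  rw [h3] at h4
  exact h2.unique h4

theorem IsFrame.frameDeriv_orth (h : IsFrame ε U F G E) (hx : x ∈ U) :
    (frameDeriv E x)ᵀ * cplx (formJ k ε) * E x 0 + (E x 0)ᵀ * cplx (formJ k ε) * frameDeriv E x =
      0 := by
  ext p q
  have hE := h.hasDerivAt hx
  have hK : ∀ p q, HasDerivAt (fun _ : ℂ => cplx (formJ k ε) p q)
    ((0 : Matrix (FIdx N k) (FIdx N k) ℂ) p q) 0 := fun p q => hasDerivAt_const _ _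
  have h1 := hasDerivAt_matrix_mul (M := fun l => (E x l)ᵀ * cplx (formJ k ε))
    (hasDerivAt_matrix_mul (M := fun l => (E x l)ᵀ) (D := (frameDeriv E x)ᵀ)
      (fun p q => hE q p) hK) hE p q
  have h2 : (fun l => ((E x l)ᵀ * cplx (formJ k ε) * E x l) p q) =
      fun _ => cplx (formJ k ε) p q :=
    funext fun l => congrFun (congrFun ((h.reality x hx).orth l) p) q
  rw [h2] at h1
  simpa using h1.unique (hasDerivAt_const _ _)

theorem IsFrame.frameDeriv_eq (h : IsFrame ε U F G E) (hx : x ∈ U) :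
    frameDeriv E x = cplx (Matrix.fromBlocks 0 (frameDerivBlock E x)
      ((frameDeriv E x).toBlocks₂₁.map Complex.re) 0) := by
  have h1 := exists_cplx_of_map_conj (h.frameDeriv_conj hx)
  have h3 : ∀ p q, _ := fun p q => congrFun (congrFun (h.frameDeriv_twist hx) p) q
  simp only [invol_conj_apply] at h3
  conv_lhs => rw [h1]
  congr 1
  ext p q
  rcases p with p | p <;> rcases q with q | q
  · have := congrArg Complex.re (h3 (Sum.inl p) (Sum.inl q))
    simp at this
    simp; linarith
  · rfl
  · rfl
  · have := congrArg Complex.re (h3 (Sum.inr p) (Sum.inr q))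
    simp at this
    simp; linarith

/-- The derivative of the orthogonality relation at λ = 0 expresses the lower left block through the
upper right one, `h21` below. -/
theorem IsFrame.sym_eq (h : IsFrame ε U F G E) (hε : ∀ i, ε i * ε i = 1) (hx : x ∈ U) :
    sym E x = cplx (Matrix.fromBlocks 0 (symBlock ε E x)
      (-(Matrix.diagonal ε * (symBlock ε E x)ᵀ)) 0) := by
  have hJ := diagonal_sign_mul_self hε
  set P := frameDerivBlock E x with hP
  set Q := (frameDeriv E x).toBlocks₂₁.map Complex.re with hQ
  set A := blockA E x with hA
  set B := blockB E x with hB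
  have hD : frameDeriv E x = cplx (Matrix.fromBlocks 0 P Q 0) := h.frameDeriv_eq hx
  have ho := h.frameDeriv_orth hx
  rw [hD, h.zero_eq hx, cplx_transpose, cplx_transpose, ← cplx_mul, ← cplx_mul, ← cplx_mul,
    ← cplx_mul, ← cplx_add] at ho
  have ho' := cplx_injective (ho.trans (by ext; simp [cplx] : 0 = cplx 0))
  have h21 : Pᵀ * A + Bᵀ * Matrix.diagonal ε * Q = 0 := by
    have := congrArg Matrix.toBlocks₂₁ ho'
    simp only [formJ, Matrix.fromBlocks_transpose, Matrix.fromBlocks_multiply,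
      Matrix.fromBlocks_add, Matrix.toBlocks_fromBlocks₂₁] at this
    simpa using this.trans (rfl : _ = (0 : Matrix (Fin N) (MIdx N k) ℝ))
  have hBB : B * (Matrix.diagonal ε * Bᵀ * Matrix.diagonal ε) = 1 := by
    refine mul_eq_one_comm.1 ?_
    rw [Matrix.mul_assoc, Matrix.mul_assoc, ← Matrix.mul_assoc Bᵀ, (h.orth_zero hx).2, hJ]
  have hAA : A * Aᵀ = 1 := mul_eq_one_comm.1 (h.orth_zero hx).1
  have hQ' : Q * Aᵀ = -(B * Matrix.diagonal ε * Pᵀ) := by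
    have h1 : Bᵀ * Matrix.diagonal ε * Q = -(Pᵀ * A) := by
      rw [eq_neg_iff_add_eq_zero, add_comm, h21]
    have h2 : Q = B * Matrix.diagonal ε * (Bᵀ * Matrix.diagonal ε * Q) := by
      have : B * Matrix.diagonal ε * (Bᵀ * Matrix.diagonal ε * Q) =
          B * (Matrix.diagonal ε * Bᵀ * Matrix.diagonal ε) * Q := by simp only [Matrix.mul_assoc]
      rw [this, hBB, Matrix.one_mul]
    rw [h2, h1, Matrix.mul_neg, Matrix.neg_mul, Matrix.mul_assoc, Matrix.mul_assoc Pᵀ, hAA,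
      Matrix.mul_one]
  have hs : sym E x = frameDeriv E x * (E x 0)⁻¹ := rfl
  rw [hs, hD, h.inv_zero hε hx, ← cplx_mul]
  congr 1
  have hlow : -(Matrix.diagonal ε * (symBlock ε E x)ᵀ) = Q * Aᵀ := by
    rw [hQ', symBlock]
    congr 1
    simp only [Matrix.transpose_mul, Matrix.diagonal_transpose, Matrix.transpose_transpose]
    rw [← hP, ← hB, ← Matrix.mul_assoc, ← Matrix.mul_assoc, hJ, Matrix.one_mul]
  rw [hlow]
  simp [Matrix.fromBlocks_multiply, symBlock, ← hP, ← hB, ← hA]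

/-- The real derivative in the direction `(0, 1)` is the complex derivative in `λ`. -/
theorem IsFrame.frameDeriv_apply (h : IsFrame ε U F G E) (hU : IsOpen U) (hx : x ∈ U)
    (p q : FIdx N k) : frameDeriv E x p q =
      fderiv ℝ (fun z : (Fin N → ℝ) × ℂ => E z.1 z.2 p q) (x, 0) (0, 1) := by
  have hO : IsOpen (U ×ˢ (Set.univ : Set ℂ)) := hU.prod isOpen_univ
  have hd := ((h.smooth p q).differentiableAt_of_isOpen hO
    (x := ((x, 0) : (Fin N → ℝ) × ℂ)) ⟨hx, Set.mem_univ _⟩).hasFDerivAt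
  have h1 := hd.comp (0 : ℂ) (hasFDerivAt_prodMk_right (𝕜 := ℝ) x (0 : ℂ))
  have h2 := (h.hasDerivAt hx p q).hasFDerivAt.restrictScalars ℝ
  have h3 := congrArg (fun L : ℂ →L[ℝ] ℂ => L 1) (h2.unique h1)
  simpa using h3

/-- Interchange of ∂/∂x_i and ∂/∂λ, followed by differentiating E(λ a_i + [a_i, v]) in λ. Joint real
smoothness gives the symmetry of the second derivative. -/
theorem IsFrame.pdMat_frameDeriv (h : IsFrame ε U F G E) (hU : IsOpen U) (hx : x ∈ U)
    (i : Fin N) : pdMat i (frameDeriv E) x =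
      frameDeriv E x * lax ε (stack F G x) 0 i + E x 0 * cplx (matA k ε i) := by
  ext p q
  have hO : IsOpen (U ×ˢ (Set.univ : Set ℂ)) := hU.prod isOpen_univ
  set H : (Fin N → ℝ) × ℂ → ℂ := fun z => E z.1 z.2 p q with hH
  have sH : ContDiffOn ℝ ∞ H (U ×ˢ Set.univ) := h.smooth p q
  have hx0 : ((x, 0) : (Fin N → ℝ) × ℂ) ∈ U ×ˢ (Set.univ : Set ℂ) := ⟨hx, Set.mem_univ _⟩
  have dH : ∀ l : ℂ, DifferentiableAt ℝ H (x, l) := fun l =>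
    sH.differentiableAt_of_isOpen hO ⟨hx, Set.mem_univ _⟩
  have dF : DifferentiableAt ℝ (fderiv ℝ H) (x, 0) :=
    (sH.fderiv_of_isOpen (m := ∞) hO (by simp)).differentiableAt_of_isOpen hO hx0
  have hsymm : fderiv ℝ (fderiv ℝ H) (x, 0) (Pi.single i 1, 0) (0, 1) =
      fderiv ℝ (fderiv ℝ H) (x, 0) (0, 1) (Pi.single i 1, 0) := by
    refine ((sH.contDiffAt (hO.mem_nhds hx0)).isSymmSndFDerivAt ?_) _ _
    simpa using WithTop.coe_le_coe.2 (le_top (a := (2 : ℕ∞)))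
  have h1 : pdMat i (frameDeriv E) x p q =
      fderiv ℝ (fderiv ℝ H) (x, 0) (Pi.single i 1, 0) (0, 1) := by
    have e : pd i (fun y => frameDeriv E y p q) x =
        pd i (fun y => fderiv ℝ H (y, 0) (0, 1)) x :=
      pd_congr i hU hx fun y hy => h.frameDeriv_apply hU hy p q
    have h2 := ((dF.hasFDerivAt.comp x (hasFDerivAt_prodMk_left (𝕜 := ℝ) x (0 : ℂ))).clm_apply
      (hasFDerivAt_const ((0, 1) : (Fin N → ℝ) × ℂ) x)).fderiv
    refine e.trans ?_
    change fderiv ℝ (fun y => (fderiv ℝ H ∘ fun y => (y, (0 : ℂ))) y (0, 1)) x (Pi.single i 1) = _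
    rw [h2]
    simp
  have h2 : ∀ l : ℂ, fderiv ℝ H (x, l) (Pi.single i 1, 0) =
      (E x l * lax ε (stack F G x) l i) p q := by
    intro l
    rw [← h.triv x hx l i]
    have := ((dH l).hasFDerivAt.comp x (hasFDerivAt_prodMk_left (𝕜 := ℝ) x l)).fderiv
    change _ = fderiv ℝ (H ∘ fun y => (y, l)) x (Pi.single i 1)
    rw [this]
    simp
  have h3 : HasDerivAt (fun l => (E x l * lax ε (stack F G x) l i) p q)
      ((frameDeriv E x * lax ε (stack F G x) 0 i + E x 0 * cplx (matA k ε i)) p q) 0 := by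
    refine hasDerivAt_matrix_mul (h.hasDerivAt hx) (fun p q => ?_) p q
    have : HasDerivAt (fun l : ℂ => l * cplx (matA k ε i) p q +
        cplx (matComm (matA k ε i) (matP ε (stack F G x))) p q)
        (1 * cplx (matA k ε i) p q) 0 := ((hasDerivAt_id (0 : ℂ)).mul_const _).add_const _
    rw [one_mul] at this
    exact this
  have h4 := (dF.hasFDerivAt.comp (0 : ℂ) (hasFDerivAt_prodMk_right (𝕜 := ℝ) x (0 : ℂ))).clm_apply
      (hasFDerivAt_const ((Pi.single i 1, 0) : (Fin N → ℝ) × ℂ) (0 : ℂ))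
  -- The same function of λ is now differentiated twice over: as a slice of the real second
  -- derivative, and as a complex derivative by the product rule. Uniqueness identifies the results.
  have h5 : HasFDerivAt (fun l => (E x l * lax ε (stack F G x) l i) p q) _ (0 : ℂ) :=
    h4.congr_of_eventuallyEq (Filter.Eventually.of_forall fun l => (h2 l).symm)
  have h6 := congrArg (fun L : ℂ →L[ℝ] ℂ => L 1)
    (h5.unique (h3.hasFDerivAt.restrictScalars ℝ))
  rw [h1, hsymm]
  simpa using h6

theorem IsFrame.smooth_frameDeriv (h : IsFrame ε U F G E) (hU : IsOpen U) (p q : FIdx N k) :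
    ContDiffOn ℝ ∞ (fun x => frameDeriv E x p q) U := by
  have hO : IsOpen (U ×ˢ (Set.univ : Set ℂ)) := hU.prod isOpen_univ
  have h1 := (h.smooth p q).fderiv_of_isOpen (m := ∞) hO (by simp)
  have h2 : ContDiffOn ℝ ∞ (fun x : Fin N → ℝ => ((x, 0) : (Fin N → ℝ) × ℂ)) U :=
    contDiffOn_id.prodMk contDiffOn_const
  have h3 := (h1.comp h2 fun _ hx => ⟨hx, Set.mem_univ _⟩).clm_apply
    (contDiffOn_const (c := ((0, 1) : (Fin N → ℝ) × ℂ)))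
  exact h3.congr fun y hy => h.frameDeriv_apply hU hy p q

theorem IsFrame.smooth_frameDerivBlock (h : IsFrame ε U F G E) (hU : IsOpen U) :
    SmoothMat U (frameDerivBlock E) := fun p q =>
  Complex.reCLM.contDiff.comp_contDiffOn (h.smooth_frameDeriv hU (Sum.inl p) (Sum.inr q))

theorem IsFrame.pdMat_frameDerivBlock (h : IsFrame ε U F G E) (hε : ∀ i, ε i * ε i = 1)
    (hU : IsOpen U) (hx : x ∈ U) (i : Fin N) : pdMat i (frameDerivBlock E) x =
      frameDerivBlock E x * connB ε (stack F G x) i -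
        blockA E x * (matD k i * Matrix.diagonal ε) := by
  have h1 : pdMat i (frameDeriv E) x = cplx (Matrix.fromBlocks
      (blockA E x * 0 + 0) (frameDerivBlock E x * connB ε (stack F G x) i -
        blockA E x * (matD k i * Matrix.diagonal ε))
      ((frameDeriv E x).toBlocks₂₁.map Complex.re * connA (stack F G x) i +
        blockB E x * (matD k i)ᵀ) 0) := by
    rw [h.pdMat_frameDeriv hU hx, lax_eq hε, zero_smul, zero_add, h.zero_eq hx]
    conv_lhs => rw [h.frameDeriv_eq hx]
    rw [← cplx_mul, ← cplx_mul, ← cplx_add]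
    congr 1
    simp [matA, Matrix.fromBlocks_multiply, Matrix.fromBlocks_add, sub_eq_add_neg]
  ext p q
  have h2 := congrFun (congrFun h1 (Sum.inl p)) (Sum.inr q)
  have h3 := pd_clm i Complex.reCLM
    ((h.smooth_frameDeriv hU (Sum.inl p) (Sum.inr q)).differentiableAt_of_isOpen hU hx)
  have h4 : pd i (fun y => frameDeriv E y (Sum.inl p) (Sum.inr q)) x =
    (((frameDerivBlock E x * connB ε (stack F G x) i -
        blockA E x * (matD k i * Matrix.diagonal ε)) p q : ℝ) : ℂ) := h2
  rw [h4] at h3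
  exact h3

theorem pdMat_mul {a b c : Type*} [Fintype b] {M : (Fin N → ℝ) → Matrix a b ℝ}
    {M' : (Fin N → ℝ) → Matrix b c ℝ} (hU : IsOpen U) (hx : x ∈ U) (hM : SmoothMat U M)
    (hM' : SmoothMat U M') (i : Fin N) :
    pdMat i (fun y => M y * M' y) x = pdMat i M x * M' x + M x * pdMat i M' x := by
  ext p q
  exact pd_mulVec (v := fun y r => M' y r q) i p (fun r => hM.differentiableAt hU hx p r)
    fun r => hM'.differentiableAt hU hx r q

/-- `connB` takes values in the Lie algebra of O(J). This makes the connection terms cancel in Sym's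
formula. -/
theorem connB_mul_diagonal_add_transpose (hε : ∀ i, ε i * ε i = 1)
    (ξ : Matrix (MIdx N k) (Fin N) ℝ) (i : Fin N) :
    connB ε ξ i * Matrix.diagonal ε + Matrix.diagonal ε * (connB ε ξ i)ᵀ = 0 := by
  ext p q
  simp only [Matrix.add_apply, Matrix.mul_diagonal, Matrix.diagonal_mul, connB, Matrix.of_apply,
    Matrix.transpose_apply, Matrix.zero_apply]
  by_cases hp : p = i <;> by_cases hq : q = i
  · subst hp; subst hq; simp only [if_true]
    linear_combination (-2 * ε q * ξ (Sum.inl q) q) * hε q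
  · subst hp; simp only [if_true, if_neg hq]
    linear_combination (-ε q * ξ (Sum.inl p) q) * hε p
  · subst hq; simp only [if_true, if_neg hp]
    linear_combination (-ε p * ξ (Sum.inl q) p) * hε q
  · simp [hp, hq]

theorem toCols_mul_matC (A : Matrix (MIdx N k) (MIdx N k) ℝ) (i : Fin N) :
    A.toCols₁ * matC i = A * matD k i := by
  ext p q
  simp [Matrix.mul_apply, matC, matD, Matrix.single_apply, ite_and, Matrix.toCols₁]

/-- The connection term from ∂E/∂λ cancels that from E⁻¹, here J Bᵗ J on the relevant block; -A D_i
Bᵗ J is left. -/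
theorem IsFrame.corresponds (h : IsFrame ε U F G E) (hFG : IsSystem ε U F G)
    (hε : ∀ i, ε i * ε i = 1) (hU : IsOpen U) :
    Corresponds ε U F G (blockB E) (blockA E) (symBlock ε E) := by
  have sB' : SmoothMat U fun y => Matrix.diagonal ε * (blockB E y)ᵀ * Matrix.diagonal ε := by
    intro p q
    simp only [Matrix.mul_diagonal, Matrix.diagonal_mul, Matrix.transpose_apply]
    exact (contDiffOn_const.mul (h.smoothB q p)).mul contDiffOn_const
  exact
    { system := h.isSystemII hFG hε hU
      smoothA := h.smoothA
      smoothX := fun p q =>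
        smooth_mulVec (h.smooth_frameDerivBlock hU) (fun r => sB' r q) p
      orthA := fun x hx => (h.orth_zero hx).1
      eqA := fun x hx i => by rw [h.pdMat_A hε hU hx, stack, connA_eq_fromBlocks]
      eqX := fun x hx i => by
        have h1 : pdMat i (fun y => Matrix.diagonal ε * (blockB E y)ᵀ * Matrix.diagonal ε) x =
            Matrix.diagonal ε * (pdMat i (blockB E) x)ᵀ * Matrix.diagonal ε := by
          ext p q
          simp only [Matrix.mul_diagonal, Matrix.diagonal_mul, Matrix.transpose_apply, pdMat,
            Matrix.of_apply]
          have d := h.smoothB.differentiableAt hU hx q p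
          rw [pd_mul_const i _ (d.const_mul _), pd_const_mul i _ d]
        have h2 := connB_mul_diagonal_add_transpose hε (stack F G x) i
        have h3 : connB ε (stack F G x) i * Matrix.diagonal ε =
            -(Matrix.diagonal ε * (connB ε (stack F G x) i)ᵀ) := eq_neg_of_add_eq_zero_left h2
        change pdMat i (fun y => frameDerivBlock E y *
          (Matrix.diagonal ε * (blockB E y)ᵀ * Matrix.diagonal ε)) x = _
        rw [pdMat_mul hU hx (h.smooth_frameDerivBlock hU) sB', h1, h.pdMat_B hε hU hx,
          h.pdMat_frameDerivBlock hε hU hx, toCols_mul_matC, Matrix.transpose_mul, Matrix.sub_mul]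
        have h4 : frameDerivBlock E x * connB ε (stack F G x) i *
            (Matrix.diagonal ε * (blockB E x)ᵀ * Matrix.diagonal ε) =
            -(frameDerivBlock E x * (Matrix.diagonal ε * ((connB ε (stack F G x) i)ᵀ *
              (blockB E x)ᵀ) * Matrix.diagonal ε)) := by
          have : frameDerivBlock E x * connB ε (stack F G x) i *
            (Matrix.diagonal ε * (blockB E x)ᵀ * Matrix.diagonal ε) =
            frameDerivBlock E x * (connB ε (stack F G x) i * Matrix.diagonal ε) *
              ((blockB E x)ᵀ * Matrix.diagonal ε) := by simp only [Matrix.mul_assoc]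
          rw [this, h3]
          simp only [Matrix.mul_assoc, Matrix.mul_neg, Matrix.neg_mul]
        have h5 : blockA E x * (matD k i * Matrix.diagonal ε) *
            (Matrix.diagonal ε * (blockB E x)ᵀ * Matrix.diagonal ε) =
            blockA E x * matD k i * (blockB E x)ᵀ * Matrix.diagonal ε := by
          have : blockA E x * (matD k i * Matrix.diagonal ε) *
            (Matrix.diagonal ε * (blockB E x)ᵀ * Matrix.diagonal ε) =
            blockA E x * matD k i * (Matrix.diagonal ε * Matrix.diagonal ε) *
              (blockB E x)ᵀ * Matrix.diagonal ε := by simp only [Matrix.mul_assoc]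
          rw [this, diagonal_sign_mul_self hε, Matrix.mul_one]
        rw [h4, h5]
        abel }

end FrameDerivative

/-! ### The simple element and its inverse in terms of real matrices. -/

section Projections

/-- P and P' are complementary eigenprojections: the product acts by ν on the range of P, by μ on
that of P', and by 1 on their common kernel. Its inverse exchanges μ and ν. -/
theorem projection_factors_mul {a : Type*} [Fintype a] [DecidableEq a] {P P' : Matrix a a ℂ}
    (h1 : P * P = P) (h2 : P * P' = 0) (h3 : P' * P = 0) (h4 : P' * P' = P') {μ ν : ℂ}
    (hμν : μ * ν = 1) :
    (1 - (P + P') + (μ • P + ν • P')) * ((P + μ • (1 - P)) * (P' + ν • (1 - P'))) = 1 := by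
  have hνμ : ν * μ = 1 := by rw [mul_comm, hμν]
  have e : (P + μ • (1 - P)) * (P' + ν • (1 - P')) = 1 - (P + P') + (ν • P + μ • P') := by
    simp only [add_mul, mul_add, smul_mul_assoc, mul_smul_comm, sub_mul, mul_sub, one_mul, mul_one,
      h2, smul_smul, smul_zero, smul_sub, smul_add, hνμ, one_smul]
    module
  rw [e]
  simp only [add_mul, mul_add, smul_mul_assoc, mul_smul_comm, sub_mul, mul_sub, one_mul, mul_one,
      h1, h2, h3, h4, smul_smul, smul_zero, smul_sub, smul_add, hμν, hνμ, one_smul]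
  module

variable {N k : ℕ} {ε : Fin N → ℝ}

/-- The real part of twice the projection onto `ℂ (w; iz)`. -/
def poleReal (ε : Fin N → ℝ) (w : MIdx N k → ℝ) (z : Fin N → ℝ) : Matrix (FIdx N k) (FIdx N k) ℝ :=
  Matrix.fromBlocks (Matrix.vecMulVec w w) 0 0 (Matrix.vecMulVec z z * Matrix.diagonal ε)

/-- The imaginary part of twice the projection onto `ℂ (w; iz)`. -/
def poleImag (ε : Fin N → ℝ) (w : MIdx N k → ℝ) (z : Fin N → ℝ) : Matrix (FIdx N k) (FIdx N k) ℝ :=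
  Matrix.fromBlocks 0 (-(Matrix.vecMulVec w z * Matrix.diagonal ε)) (Matrix.vecMulVec z w) 0

theorem vecMul_diagonal_dotProduct {z : Fin N → ℝ} (hz : ∑ j, ε j * z j ^ 2 = 1) :
    (z ᵥ* Matrix.diagonal ε) ⬝ᵥ z = 1 := by
  rw [← hz]
  simp only [dotProduct, Matrix.vecMul_diagonal]
  exact Finset.sum_congr rfl fun i _ => by ring

theorem dotProduct_self_eq_one {a : Type*} [Fintype a] {w : a → ℝ} (hw : ∑ p, w p ^ 2 = 1) :
    w ⬝ᵥ w = 1 := by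
  rw [← hw]
  exact Finset.sum_congr rfl fun i _ => by ring

section Normalized

variable {w : MIdx N k → ℝ} {z : Fin N → ℝ} (hw : ∑ p, w p ^ 2 = 1) (hz : ∑ j, ε j * z j ^ 2 = 1)

include hw hz

theorem poleReal_mul_poleReal : poleReal ε w z * poleReal ε w z = poleReal ε w z := by
  have h1 := vecMul_diagonal_dotProduct hz
  have h2 := dotProduct_self_eq_one hw
  simp only [poleReal, Matrix.vecMulVec_mul _ _ (Matrix.diagonal ε)]
  simp [Matrix.fromBlocks_multiply, Matrix.vecMulVec_mul_vecMulVec, h1, h2]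

theorem poleReal_mul_poleImag : poleReal ε w z * poleImag ε w z = poleImag ε w z := by
  have h1 := vecMul_diagonal_dotProduct hz
  have h2 := dotProduct_self_eq_one hw
  simp only [poleReal, poleImag, Matrix.vecMulVec_mul _ _ (Matrix.diagonal ε)]
  simp [Matrix.fromBlocks_multiply, Matrix.vecMulVec_mul_vecMulVec, h1, h2]

theorem poleImag_mul_poleReal : poleImag ε w z * poleReal ε w z = poleImag ε w z := by
  have h1 := vecMul_diagonal_dotProduct hz
  have h2 := dotProduct_self_eq_one hw
  simp only [poleReal, poleImag, Matrix.vecMulVec_mul _ _ (Matrix.diagonal ε)]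
  simp [Matrix.fromBlocks_multiply, Matrix.vecMulVec_mul_vecMulVec, h1, h2]

/-- On the plane spanned by (w; 0) and (0; z), `poleImag` is the quarter turn (w; 0) ↦ (0; z) ↦ (-w;
0). Its eigenprojections are π and π̄. -/
theorem poleImag_mul_poleImag : poleImag ε w z * poleImag ε w z = -poleReal ε w z := by
  have h1 := vecMul_diagonal_dotProduct hz
  have h2 := dotProduct_self_eq_one hw
  simp only [poleReal, poleImag, Matrix.vecMulVec_mul _ _ (Matrix.diagonal ε)]
  simp [Matrix.fromBlocks_multiply, Matrix.vecMulVec_mul_vecMulVec, h1, h2, Matrix.fromBlocks_neg]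

end Normalized

/-- For the sesquilinear form the two factors i give +1, so (w; iz) has square norm 2q instead of 0,
and the projection exists. -/
theorem proj_isoVec {q r : ℝ} {w : MIdx N k → ℝ} {z : Fin N → ℝ} (hw : ∑ p, w p ^ 2 = q)
    (hz : ∑ j, ε j * z j ^ 2 = q) (hr : r ^ 2 * q = 1) :
    proj ε (isoVec w z) = (2⁻¹ : ℂ) • (cplx (poleReal ε (r • w) (r • z)) +
      Complex.I • cplx (poleImag ε (r • w) (r • z))) := by
  have hK : cplx (formJ k ε) = Matrix.diagonal fun p =>
      ((Sum.elim (fun _ => (1 : ℝ)) ε p : ℝ) : ℂ) := by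
    rw [formJ_eq_diagonal, cplx, Matrix.diagonal_map (by simp)]
  have hI := Complex.I_mul_I
  have hc : star (isoVec w z) ⬝ᵥ (cplx (formJ k ε) *ᵥ isoVec w z) = 2 * (q : ℂ) := by
    simp only [hK, dotProduct, Matrix.mulVec_diagonal]
    rw [Fintype.sum_sum_type, two_mul]
    congr 1
    · rw [← hw, Complex.ofReal_sum]
      exact Finset.sum_congr rfl fun a _ => by simp [isoVec]; ring
    · rw [← hz, Complex.ofReal_sum]
      refine Finset.sum_congr rfl fun j _ => ?_
      simp [isoVec]
      linear_combination (-(ε j : ℂ) * (z j : ℂ) ^ 2) * hI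
  have hq : (2 * (q : ℂ))⁻¹ = 2⁻¹ * (r : ℂ) ^ 2 := by
    have : (r : ℂ) ^ 2 * q = 1 := by exact_mod_cast hr
    have hq0 : (q : ℂ) ≠ 0 := right_ne_zero_of_mul_eq_one this
    field_simp
    linear_combination -this
  rw [proj, hc, hq, hK]
  ext p p'
  rcases p with p | p <;> rcases p' with p' | p' <;>
    simp [isoVec, poleReal, poleImag, cplx_apply, Matrix.vecMulVec_apply, Matrix.mul_diagonal]
  · ring
  · ring
  · ring
  · linear_combination (-(r : ℂ) ^ 2 * 2⁻¹ * z p * z p' * ε p') * hI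

/-- With μ = (l - is)/(l + is) and ν = 1/μ, the coefficients of S and T are (μ + ν)/2 and i(μ -
ν)/2: rational with real coefficients and regular at l = 0. -/
theorem simpleElt_inv {s : ℝ} {w : MIdx N k → ℝ} {z : Fin N → ℝ} (hw : ∑ p, w p ^ 2 = 1)
    (hz : ∑ j, ε j * z j ^ 2 = 1) {l : ℂ} (h1 : l - Complex.I * s ≠ 0)
    (h2 : l + Complex.I * s ≠ 0) :
    (simpleElt s ((2⁻¹ : ℂ) • (cplx (poleReal ε w z) + Complex.I • cplx (poleImag ε w z))) l)⁻¹ =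
      1 - cplx (poleReal ε w z) +
        (((l ^ 2 - (s : ℂ) ^ 2) / (l ^ 2 + (s : ℂ) ^ 2)) • cplx (poleReal ε w z) +
        (2 * s * l / (l ^ 2 + (s : ℂ) ^ 2)) • cplx (poleImag ε w z)) := by
  set S := cplx (poleReal ε w z) with hS
  set T := cplx (poleImag ε w z) with hT
  have hSS : S * S = S := by rw [hS, ← cplx_mul, poleReal_mul_poleReal hw hz]
  have hST : S * T = T := by rw [hS, hT, ← cplx_mul, poleReal_mul_poleImag hw hz]
  have hTS : T * S = T := by rw [hS, hT, ← cplx_mul, poleImag_mul_poleReal hw hz]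
  have hTT : T * T = -S := by rw [hS, hT, ← cplx_mul, poleImag_mul_poleImag hw hz, cplx_neg]
  have hI := Complex.I_mul_I
  have hbar : ((2⁻¹ : ℂ) • (S + Complex.I • T)).map (starRingEnd ℂ) =
      (2⁻¹ : ℂ) • (S - Complex.I • T) := by
    ext p q
    have h2 : starRingEnd ℂ 2 = 2 := map_ofNat _ 2
    simp [hS, hT, cplx_apply, h2]
    ring
  have hd : l ^ 2 + (s : ℂ) ^ 2 = (l - Complex.I * s) * (l + Complex.I * s) := by
    linear_combination (s : ℂ) ^ 2 * hI
  rw [simpleElt, hbar]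
  refine Matrix.inv_eq_left_inv ?_
  have hμν : (l - Complex.I * s) / (l + Complex.I * s) *
      ((l + Complex.I * s) / (l - Complex.I * s)) = 1 := by field_simp
  refine Eq.trans ?_ (projection_factors_mul (P := (2⁻¹ : ℂ) • (S + Complex.I • T))
    (P' := (2⁻¹ : ℂ) • (S - Complex.I • T)) ?_ ?_ ?_ ?_ hμν)
  · congr 1
    rw [hd]
    match_scalars
    · ring
    · field_simp
      ring_nf
      simp only [Complex.I_sq]
      ring
    · field_simp
      ring_nf
      simp only [Complex.I_sq]
      ring
  all_goals
    simp only [smul_mul_assoc, mul_smul_comm, add_mul, mul_add, sub_mul, mul_sub, hSS, hST, hTS,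
      hTT, smul_smul]
    match_scalars <;> (ring_nf; try (simp only [Complex.I_sq]; ring))

end Projections

/-! ### Value and λ-derivative of the new frame at 0. -/

section NewFrame

variable {N k : ℕ} {ε : Fin N → ℝ} {U : Set (Fin N → ℝ)}
  {F : (Fin N → ℝ) → Matrix (Fin N) (Fin N) ℝ} {G : (Fin N → ℝ) → Matrix (Fin k) (Fin N) ℝ}
  {E : (Fin N → ℝ) → ℂ → Matrix (FIdx N k) (FIdx N k) ℂ} {x : Fin N → ℝ}
  {s : ℝ} {W : MIdx N k → ℝ} {Z : Fin N → ℝ}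

/-- `π̃(x)` in terms of the normalized vectors. -/
theorem IsFrame.proj_tildeVec (h : IsFrame ε U F G E) (hε : ∀ i, ε i * ε i = 1)
    (hx : x ∈ U) (hW : ∑ a, W a ^ 2 = 1) (hZ : ∑ j, ε j * Z j ^ 2 = 1)
    (h0 : tildeW E s W Z x ≠ 0) :
    proj ε (tildeVec E s W Z x) =
      (2⁻¹ : ℂ) • (cplx (poleReal ε (hatW E s W Z x) (hatZ ε E s W Z x)) +
        Complex.I • cplx (poleImag ε (hatW E s W Z x) (hatZ ε E s W Z x))) := by
  have hq := h.sum_tildeW_sq (s := s) hε hx hW hZ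
  obtain ⟨a, ha⟩ := Function.ne_iff.1 h0
  have hpos : 0 < ∑ a, tildeW E s W Z x a ^ 2 :=
    Finset.sum_pos' (fun _ _ => sq_nonneg _) ⟨a, Finset.mem_univ a,
      lt_of_le_of_ne' (sq_nonneg _) (pow_ne_zero 2 ha)⟩
  rw [h.tildeVec_eq hε hx, proj_isoVec (r := (√(∑ a, tildeW E s W Z x a ^ 2))⁻¹) rfl hq.symm
    (by rw [inv_pow, Real.sq_sqrt hpos.le, inv_mul_cancel₀ hpos.ne'])]
  rw [hatW, hatZ, ← hq]

variable (h : IsFrame ε U F G E) (hε : ∀ i, ε i * ε i = 1) (hx : x ∈ U)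
  (hW : ∑ a, W a ^ 2 = 1) (hZ : ∑ j, ε j * Z j ^ 2 = 1) (h0 : tildeW E s W Z x ≠ 0)
  (hs : s ≠ 0) (hw : ∑ p, hatW E s W Z x p ^ 2 = 1)
  (hz : ∑ j, ε j * hatZ ε E s W Z x j ^ 2 = 1)

include h hε hx hW hZ h0 hw hz in
theorem IsFrame.newFrame_apply {l : ℂ} (h1 : l - Complex.I * s ≠ 0)
    (h2 : l + Complex.I * s ≠ 0) : newFrame ε E s W Z x l = E x l *
      (1 - cplx (poleReal ε (hatW E s W Z x) (hatZ ε E s W Z x)) +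
        (((l ^ 2 - (s : ℂ) ^ 2) / (l ^ 2 + (s : ℂ) ^ 2)) •
          cplx (poleReal ε (hatW E s W Z x) (hatZ ε E s W Z x)) +
        (2 * s * l / (l ^ 2 + (s : ℂ) ^ 2)) •
          cplx (poleImag ε (hatW E s W Z x) (hatZ ε E s W Z x)))) := by
  rw [newFrame, h.proj_tildeVec hε hx hW hZ h0, simpleElt_inv hw hz h1 h2]

include h hε hx hW hZ h0 hs hw hz in
theorem IsFrame.newFrame_zero : newFrame ε E s W Z x 0 = E x 0 *
    cplx (1 - (2 : ℝ) • poleReal ε (hatW E s W Z x) (hatZ ε E s W Z x)) := by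
  have hs' : (s : ℂ) ≠ 0 := by exact_mod_cast hs
  rw [h.newFrame_apply hε hx hW hZ h0 hw hz (by simpa using hs) (by simpa using hs),
    cplx_sub, cplx_one, cplx_smul]
  congr 1
  have e1 : ((0 : ℂ) ^ 2 - (s : ℂ) ^ 2) / (0 ^ 2 + (s : ℂ) ^ 2) = -1 := by
    field_simp; ring
  rw [e1, mul_zero, zero_div, zero_smul, add_zero]
  push_cast
  module

include h hε hx hW hZ h0 hs hw hz in
theorem IsFrame.newFrame_zero_eq : newFrame ε E s W Z x 0 = cplx (Matrix.fromBlocks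
    (blockA E x * (1 - (2 : ℝ) • Matrix.vecMulVec (hatW E s W Z x) (hatW E s W Z x))) 0 0
    (blockB E x * (1 - (2 : ℝ) • Matrix.vecMulVec (hatZ ε E s W Z x) (hatZ ε E s W Z x) *
      Matrix.diagonal ε))) := by
  rw [h.newFrame_zero hε hx hW hZ h0 hs hw hz, h.zero_eq hx, ← cplx_mul]
  congr 1
  have : (1 - (2 : ℝ) • poleReal ε (hatW E s W Z x) (hatZ ε E s W Z x)) = Matrix.fromBlocks
      (1 - (2 : ℝ) • Matrix.vecMulVec (hatW E s W Z x) (hatW E s W Z x)) 0 0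
      (1 - (2 : ℝ) • Matrix.vecMulVec (hatZ ε E s W Z x) (hatZ ε E s W Z x) *
      Matrix.diagonal ε) := by
    rw [← Matrix.fromBlocks_one, poleReal, Matrix.fromBlocks_smul, sub_eq_add_neg,
      Matrix.fromBlocks_neg, Matrix.fromBlocks_add]
    simp [sub_eq_add_neg]
  rw [this, Matrix.fromBlocks_multiply]
  simp

include h hε hx hW hZ h0 hs hw hz in
theorem IsFrame.newA_eq : newA ε E s W Z x = blockA E x *
    (1 - (2 : ℝ) • Matrix.vecMulVec (hatW E s W Z x) (hatW E s W Z x)) := by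
  rw [newA, RibaucourDressing.blockA, h.newFrame_zero_eq hε hx hW hZ h0 hs hw hz]
  rfl

include h hε hx hW hZ h0 hs hw hz in
theorem IsFrame.newB_eq : newB ε E s W Z x = blockB E x *
    (1 - (2 : ℝ) • Matrix.vecMulVec (hatZ ε E s W Z x) (hatZ ε E s W Z x) *
      Matrix.diagonal ε) := by
  rw [newB, RibaucourDressing.blockB, h.newFrame_zero_eq hε hx hW hZ h0 hs hw hz]
  rfl

include h hε hx hW hZ h0 hs hw hz in
-- The coefficient of S is even in λ and does not contribute to the derivative at 0; that of T is
-- odd with derivative 2/s.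
theorem IsFrame.hasDerivAt_newFrame (p q : FIdx N k) :
    HasDerivAt (fun l => newFrame ε E s W Z x l p q)
      ((frameDeriv E x *
          cplx (1 - (2 : ℝ) • poleReal ε (hatW E s W Z x) (hatZ ε E s W Z x)) +
        E x 0 * cplx ((2 / s) • poleImag ε (hatW E s W Z x) (hatZ ε E s W Z x)) :
          Matrix (FIdx N k) (FIdx N k) ℂ) p q) 0 := by
  have hs' : (s : ℂ) ≠ 0 := by exact_mod_cast hs
  set S := cplx (poleReal ε (hatW E s W Z x) (hatZ ε E s W Z x)) with hS
  set T := cplx (poleImag ε (hatW E s W Z x) (hatZ ε E s W Z x)) with hT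
  have hden : HasDerivAt (fun l : ℂ => l ^ 2 + (s : ℂ) ^ 2) 0 0 := by
    simpa using ((hasDerivAt_id (0 : ℂ)).pow 2).add_const ((s : ℂ) ^ 2)
  have hnum : HasDerivAt (fun l : ℂ => l ^ 2 - (s : ℂ) ^ 2) 0 0 := by
    simpa using ((hasDerivAt_id (0 : ℂ)).pow 2).sub_const ((s : ℂ) ^ 2)
  have hne : (0 : ℂ) ^ 2 + (s : ℂ) ^ 2 ≠ 0 := by simpa using hs
  have ha : HasDerivAt (fun l : ℂ => (l ^ 2 - (s : ℂ) ^ 2) / (l ^ 2 + (s : ℂ) ^ 2)) 0 0 := by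
    simpa using hnum.fun_div hden hne
  have hb : HasDerivAt (fun l : ℂ => 2 * (s : ℂ) * l / (l ^ 2 + (s : ℂ) ^ 2))
      ((2 : ℂ) / (s : ℂ)) 0 := by
    have h1 : HasDerivAt (fun l : ℂ => 2 * (s : ℂ) * l) (2 * (s : ℂ)) 0 := by
      simpa using (hasDerivAt_id (0 : ℂ)).const_mul (2 * (s : ℂ))
    have h2 := h1.fun_div hden hne
    have e : (2 * (s : ℂ) * (0 ^ 2 + (s : ℂ) ^ 2) - 2 * s * 0 * 0) / (0 ^ 2 + (s : ℂ) ^ 2) ^ 2 =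
        2 / s := by field_simp; ring
    rwa [e] at h2
  have h3 := hasDerivAt_matrix_mul (M' := fun l => 1 - S +
    (((l ^ 2 - (s : ℂ) ^ 2) / (l ^ 2 + (s : ℂ) ^ 2)) • S +
        (2 * s * l / (l ^ 2 + (s : ℂ) ^ 2)) • T)) (D' := (0 : ℂ) • S + ((2 : ℂ) / (s : ℂ)) • T)
    (h.hasDerivAt hx)
    (fun p q => ((ha.mul_const (S p q)).add (hb.mul_const (T p q))).const_add ((1 - S) p q)) p q
  -- The explicit formula fails only at l = ±is, away from 0 because s ≠ 0.
  have hev : (fun l => newFrame ε E s W Z x l p q) =ᶠ[nhds 0] fun l => (E x l * (1 - S +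
    (((l ^ 2 - (s : ℂ) ^ 2) / (l ^ 2 + (s : ℂ) ^ 2)) • S +
        (2 * s * l / (l ^ 2 + (s : ℂ) ^ 2)) • T)) : Matrix (FIdx N k) (FIdx N k) ℂ) p q := by
    have c1 : ∀ᶠ l : ℂ in nhds 0, l - Complex.I * s ≠ 0 :=
      (continuous_id.sub continuous_const).continuousAt.eventually_ne (by simpa using hs)
    have c2 : ∀ᶠ l : ℂ in nhds 0, l + Complex.I * s ≠ 0 :=
      (continuous_id.add continuous_const).continuousAt.eventually_ne (by simpa using hs)
    filter_upwards [c1, c2] with l l1 l2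
    rw [h.newFrame_apply hε hx hW hZ h0 hw hz l1 l2]
  refine (h3.congr_of_eventuallyEq hev).congr_deriv ?_
  have e1 : ((0 : ℂ) ^ 2 - (s : ℂ) ^ 2) / (0 ^ 2 + (s : ℂ) ^ 2) = -1 := by
    field_simp; ring
  rw [e1, mul_zero, zero_div, zero_smul, zero_smul, add_zero, zero_add, cplx_sub, cplx_one,
    cplx_smul, cplx_smul, ← hS, ← hT]
  have e2 : 1 - S + (-1 : ℂ) • S = 1 - ((2 : ℝ) : ℂ) • S := by push_cast; module
  have e3 : (2 : ℂ) / (s : ℂ) = ((2 / s : ℝ) : ℂ) := by push_cast; rfl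
  rw [e2, e3]

include h hε hx hW hZ h0 hs hw hz in
-- The reflection 1 - 2S cancels in the old term, while T(1 - 2S) = -T in the new one. As the upper
-- block of T is -ŵẑᵗJ, the correction of X comes out positive.
theorem IsFrame.sym_newFrame : sym (newFrame ε E s W Z) x =
    cplx (Matrix.fromBlocks 0 (newX ε E s W Z (symBlock ε E) x)
      (-(Matrix.diagonal ε * (newX ε E s W Z (symBlock ε E) x)ᵀ)) 0) := by
  set S := poleReal ε (hatW E s W Z x) (hatZ ε E s W Z x) with hS
  set T := poleImag ε (hatW E s W Z x) (hatZ ε E s W Z x) with hT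
  have hJ := diagonal_sign_mul_self hε
  have hSS : S * S = S := poleReal_mul_poleReal hw hz
  have hTS : T * S = T := poleImag_mul_poleReal hw hz
  have hR := reflection_mul_self hSS
  have hTR : T * (1 - (2 : ℝ) • S) = -T := by
    rw [Matrix.mul_sub, Matrix.mul_one, Matrix.mul_smul, hTS]; module
  have hRc : cplx (1 - (2 : ℝ) • S) * cplx (1 - (2 : ℝ) • S) = 1 := by
    rw [← cplx_mul, hR, cplx_one]
  have hd : (Matrix.of fun p q => deriv (fun l => newFrame ε E s W Z x l p q) 0) =
      frameDeriv E x * cplx (1 - (2 : ℝ) • S) + E x 0 * cplx ((2 / s) • T) := by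
    ext p q
    exact (h.hasDerivAt_newFrame hε hx hW hZ h0 hs hw hz p q).deriv
  have hinv : (newFrame ε E s W Z x 0)⁻¹ = cplx (1 - (2 : ℝ) • S) * (E x 0)⁻¹ := by
    refine Matrix.inv_eq_left_inv ?_
    rw [h.newFrame_zero hε hx hW hZ h0 hs hw hz, ← hS, Matrix.mul_assoc,
      ← Matrix.mul_assoc (E x 0)⁻¹, (h.reality x hx).inv_mul hε, Matrix.one_mul, hRc]
  have e1 : sym (newFrame ε E s W Z) x = sym E x - E x 0 * cplx ((2 / s) • T) * (E x 0)⁻¹ := by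
    have es : sym E x = frameDeriv E x * (E x 0)⁻¹ := rfl
    have e2 : E x 0 * cplx ((2 / s) • T) * (cplx (1 - (2 : ℝ) • S) * (E x 0)⁻¹) =
        -(E x 0 * cplx ((2 / s) • T) * (E x 0)⁻¹) := by
      rw [← Matrix.mul_assoc, Matrix.mul_assoc (E x 0), ← cplx_mul, Matrix.smul_mul, hTR, smul_neg,
        cplx_neg, Matrix.mul_neg, Matrix.neg_mul]
    have e3 : frameDeriv E x * cplx (1 - (2 : ℝ) • S) * (cplx (1 - (2 : ℝ) • S) * (E x 0)⁻¹) =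
        frameDeriv E x * (E x 0)⁻¹ := by
      rw [Matrix.mul_assoc, ← Matrix.mul_assoc (cplx _), hRc, Matrix.one_mul]
    rw [sym, hd, hinv, Matrix.add_mul, e3, e2, es, ← sub_eq_add_neg]
  rw [e1, h.sym_eq hε hx, h.inv_zero hε hx, h.zero_eq hx, ← cplx_mul, ← cplx_mul, ← cplx_sub]
  congr 1
  rw [hT, poleImag, Matrix.fromBlocks_smul, Matrix.fromBlocks_multiply, Matrix.fromBlocks_multiply,
    sub_eq_add_neg, Matrix.fromBlocks_neg, Matrix.fromBlocks_add]
  congr 1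
  · simp
  · have e : blockA E x * (Matrix.vecMulVec (hatW E s W Z x) (hatZ ε E s W Z x) *
        Matrix.diagonal ε) * (Matrix.diagonal ε * (blockB E x)ᵀ * Matrix.diagonal ε) =
        blockA E x * Matrix.vecMulVec (hatW E s W Z x) (hatZ ε E s W Z x) *
          (blockB E x)ᵀ * Matrix.diagonal ε := by
      have : blockA E x * (Matrix.vecMulVec (hatW E s W Z x) (hatZ ε E s W Z x) *
        Matrix.diagonal ε) * (Matrix.diagonal ε * (blockB E x)ᵀ * Matrix.diagonal ε) =
          blockA E x * Matrix.vecMulVec (hatW E s W Z x) (hatZ ε E s W Z x) *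
          (Matrix.diagonal ε * Matrix.diagonal ε) * (blockB E x)ᵀ * Matrix.diagonal ε := by
        simp only [Matrix.mul_assoc]
      rw [this, hJ, Matrix.mul_one]
    simp only [newX, Matrix.zero_mul, Matrix.mul_zero, smul_zero, add_zero, zero_add, smul_neg,
      Matrix.mul_neg, Matrix.neg_mul, neg_neg, Matrix.mul_smul, Matrix.smul_mul]
    rw [e]
  · have e : Matrix.diagonal ε * (blockA E x * Matrix.vecMulVec (hatW E s W Z x)
        (hatZ ε E s W Z x) * (blockB E x)ᵀ * Matrix.diagonal ε)ᵀ =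
        blockB E x * Matrix.vecMulVec (hatZ ε E s W Z x) (hatW E s W Z x) * (blockA E x)ᵀ := by
      simp only [Matrix.transpose_mul, Matrix.transpose_transpose, Matrix.diagonal_transpose,
        Matrix.transpose_vecMulVec, ← Matrix.mul_assoc, hJ, Matrix.one_mul]
    simp only [newX, Matrix.transpose_add, Matrix.transpose_smul, Matrix.mul_add, Matrix.mul_smul,
      e, Matrix.zero_mul, Matrix.mul_zero, smul_zero, add_zero, zero_add, Matrix.smul_mul, neg_add]
  · simp

end NewFrame

/-! ### Frames differing by a reflection give Ribaucour transformations. -/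

section Ribaucour

variable {N k : ℕ}

/-- Moving by t along both lines changes their difference d n by -2ct n, so they meet at t = d/(2c);
for c = 0 they are parallel. -/
theorem meetEquidistant_of_sub {p v n : Amb N k} {c d : ℝ} (h : ‖v - (2 * c) • n‖ = ‖v‖) :
    MeetEquidistant p v (p + d • n) (v - (2 * c) • n) := by
  by_cases hc : c = 0
  · exact Or.inr ⟨1, one_ne_zero, by simp [hc]⟩
  · refine Or.inl ⟨d / (2 * c), d / (2 * c), ?_, ?_⟩
    · match_scalars <;> field_simp
      ring
    · rw [norm_smul, norm_smul, h]

theorem MeetEquidistant.smul {p v q w : Amb N k} (h : MeetEquidistant p v q w) {a b : ℝ}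
    (ha : a ≠ 0) (hb : b ≠ 0) : MeetEquidistant p (a • v) q (b • w) := by
  rcases h with ⟨t, t', h1, h2⟩ | ⟨c, hc, rfl⟩
  · refine Or.inl ⟨t / a, t' / b, ?_, ?_⟩
    · rw [smul_smul, smul_smul, div_mul_cancel₀ _ ha, div_mul_cancel₀ _ hb, h1]
    · rw [smul_smul, smul_smul, div_mul_cancel₀ _ ha, div_mul_cancel₀ _ hb, h2]
  · refine Or.inr ⟨b * c / a, div_ne_zero (mul_ne_zero hb hc) ha, ?_⟩
    rw [smul_smul, smul_smul, div_mul_cancel₀ _ ha]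

theorem frameMap_apply (A A' : (Fin N → ℝ) → Matrix (MIdx N k) (MIdx N k) ℝ) (x : Fin N → ℝ)
    (η : Amb N k) : frameMap A A' x η =
      ∑ a, inner ℝ (normalFrame A a x) η • normalFrame A' a x := by
  simp [frameMap]

variable {ε : Fin N → ℝ} {U : Set (Fin N → ℝ)}
  {F F' : (Fin N → ℝ) → Matrix (Fin N) (Fin N) ℝ}
  {G G' : (Fin N → ℝ) → Matrix (Fin k) (Fin N) ℝ}
  {B B' : (Fin N → ℝ) → Matrix (Fin N) (Fin N) ℝ}
  {A A' : (Fin N → ℝ) → Matrix (MIdx N k) (MIdx N k) ℝ}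
  {X X' : (Fin N → ℝ) → Matrix (MIdx N k) (Fin N) ℝ} {x : Fin N → ℝ}

theorem Corresponds.inner_normalFrame_normalFrame_sum (h : Corresponds ε U F G B A X) (hx : x ∈ U)
    (c : Fin k → ℝ) (a : Fin k) :
    inner ℝ (normalFrame A a x) (∑ b, c b • normalFrame A b x) = c a := by
  simp [inner_sum, inner_smul_right, normalFrame, h.inner_frame hx]

theorem Corresponds.norm_normalFrame_sum_sq (h : Corresponds ε U F G B A X) (hx : x ∈ U)
    (c : Fin k → ℝ) : ‖∑ b, c b • normalFrame A b x‖ ^ 2 = ∑ b, c b ^ 2 := by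
  rw [← real_inner_self_eq_norm_sq, sum_inner]
  refine Finset.sum_congr rfl fun a _ => ?_
  rw [real_inner_smul_left, h.inner_normalFrame_normalFrame_sum hx, sq]

theorem Corresponds.norm_frame (h : Corresponds ε U F G B A X) (hx : x ∈ U) (p : MIdx N k) :
    ‖colVec A p x‖ = 1 := by
  have h1 : ‖colVec A p x‖ ^ 2 = 1 := by
    rw [← real_inner_self_eq_norm_sq, h.inner_frame hx, if_pos rfl]
  exact (pow_eq_one_iff_of_nonneg (norm_nonneg _) two_ne_zero).1 h1

theorem Corresponds.fderiv_X_of_single (h : Corresponds ε U F G B A X) (hU : IsOpen U)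
    (hx : x ∈ U) (j : Fin N) {i : Fin N} {u : Fin N → ℝ} (hu : ∀ l, l ≠ i → u l = 0) :
    fderiv ℝ (colVec X j) x u = -(ε j * B x j i * u i) • colVec A (Sum.inl i) x := by
  rw [h.fderiv_X hU hx, Finset.sum_eq_single i]
  · intro l _ hl
    simp [hu l hl]
  · simp

theorem diagonal_mulVec_of_single {d u : Fin N → ℝ} {i : Fin N} (hu : ∀ l, l ≠ i → u l = 0) :
    Matrix.diagonal d *ᵥ u = d i • u := by
  ext l
  rw [Matrix.mulVec_diagonal, Pi.smul_apply, smul_eq_mul]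
  by_cases hl : l = i
  · rw [hl]
  · rw [hu l hl, mul_zero, mul_zero]

variable {j : Fin N}

theorem Corresponds.frameMap_smooth (h : Corresponds ε U F G B A X)
    (h' : Corresponds ε U F' G' B' A' X') : ContDiffOn ℝ ∞ (frameMap A A') U := by
  have e : frameMap A A' = fun y => ∑ a,
      (innerSL ℝ (normalFrame A a y)).smulRight (normalFrame A' a y) := rfl
  rw [e]
  exact ContDiffOn.sum fun a _ => ((innerSL ℝ).contDiff.comp_contDiffOn
    (contDiffOn_colVec h.smoothA (Sum.inr a))).smulRight (contDiffOn_colVec h'.smoothA (Sum.inr a))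

theorem Corresponds.frameMap_bijOn (h : Corresponds ε U F G B A X)
    (h' : Corresponds ε U F' G' B' A' X') (hU : IsOpen U) (hε : ∀ i, ε i * ε i = 1) (hx : x ∈ U)
    (hb : ∀ i, B x j i ≠ 0) (hb' : ∀ i, B' x j i ≠ 0) :
    Set.BijOn (frameMap A A' x) (normalSpace (colVec X j) x) (normalSpace (colVec X' j) x) := by
  refine ⟨fun η _ => ?_, fun η hη ζ hζ he => ?_, fun η hη => ?_⟩
  · rw [frameMap_apply]
    exact h'.normalFrame_sum_mem hU hx hε hb' _
  · rw [frameMap_apply, frameMap_apply] at he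
    rw [← h.sum_inner_normalFrame hU hx hε hb hη, ← h.sum_inner_normalFrame hU hx hε hb hζ]
    refine Finset.sum_congr rfl fun a _ => ?_
    have := congrArg (inner ℝ (normalFrame A' a x)) he
    rw [h'.inner_normalFrame_normalFrame_sum hx, h'.inner_normalFrame_normalFrame_sum hx] at this
    rw [this]
  · refine ⟨∑ a, inner ℝ (normalFrame A' a x) η • normalFrame A a x,
      h.normalFrame_sum_mem hU hx hε hb _, ?_⟩
    rw [frameMap_apply]
    simp only [h.inner_normalFrame_normalFrame_sum hx]
    exact h'.sum_inner_normalFrame hU hx hε hb' hη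

theorem Corresponds.inner_fderiv_normalFrame (h : Corresponds ε U F G B A X) (hU : IsOpen U)
    (hε : ∀ i, ε i * ε i = 1) (hx : x ∈ U) (hb : ∀ i, B x j i ≠ 0) {η : Amb N k}
    (hη : η ∈ normalSpace (colVec X j) x) (a : Fin k) (u : Fin N → ℝ) :
    inner ℝ (fderiv ℝ (normalFrame A a) x u) η = 0 := by
  rw [h.mem_normalSpace hU hx hε hb] at hη
  rw [h.fderiv_normalFrame hU hx, sum_inner]
  simp [real_inner_smul_left, hη]

/-- η and its image have the same coefficients in the parallel frames e_a and ẽ_a, and a normal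
field is parallel exactly when these have zero derivative. -/
theorem Corresponds.frameMap_parallel (h : Corresponds ε U F G B A X)
    (h' : Corresponds ε U F' G' B' A' X') (hU : IsOpen U) (hε : ∀ i, ε i * ε i = 1)
    (hb : ∀ x ∈ U, ∀ i, B x j i ≠ 0) (hb' : ∀ x ∈ U, ∀ i, B' x j i ≠ 0)
    {V : Set (Fin N → ℝ)} (hV : V ⊆ U) (hVo : IsOpen V) {η : (Fin N → ℝ) → Amb N k}
    (hη : IsParallelNormal V (colVec X j) η) :
    IsParallelNormal V (colVec X' j) fun x => frameMap A A' x (η x) := by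
  have hs : ContDiffOn ℝ ∞ (fun x => frameMap A A' x (η x)) V :=
    ((h.frameMap_smooth h').mono hV).clm_apply hη.1
  have hmem : ∀ x ∈ V, frameMap A A' x (η x) ∈ normalSpace (colVec X' j) x := fun x hx =>
    (h.frameMap_bijOn h' hU hε (hV hx) (hb x (hV hx)) (hb' x (hV hx))).mapsTo (hη.2 x hx).1
  refine ⟨hs, fun x hx => ⟨hmem x hx, fun u => ?_⟩⟩
  have hxU := hV hx
  rw [h'.starProjection_eq hU hxU hε (hb' x hxU)]
  refine Finset.sum_eq_zero fun a _ => ?_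
  have de : DifferentiableAt ℝ (normalFrame A a) x :=
    (contDiffOn_colVec h.smoothA _).differentiableAt_of_isOpen hU hxU
  have de' : DifferentiableAt ℝ (normalFrame A' a) x :=
    (contDiffOn_colVec h'.smoothA _).differentiableAt_of_isOpen hU hxU
  have h1 := fderiv_inner_apply ℝ de (hη.1.differentiableAt_of_isOpen hVo hx) u
  have h2 := fderiv_inner_apply ℝ de' (hs.differentiableAt_of_isOpen hVo hx) u
  have h3 : (fun y => inner ℝ (normalFrame A' a y) (frameMap A A' y (η y))) =ᶠ[nhds x]
      fun y => inner ℝ (normalFrame A a y) (η y) := by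
    filter_upwards [hVo.mem_nhds hx] with y hy
    rw [frameMap_apply, h'.inner_normalFrame_normalFrame_sum (hV hy)]
  have h4 : inner ℝ (normalFrame A a x) (fderiv ℝ η x u) = 0 := by
    have := (hη.2 x hx).2 u
    rw [h.starProjection_eq hU hxU hε (hb x hxU)] at this
    have h5 := congrArg (inner ℝ (normalFrame A a x)) this
    rwa [h.inner_normalFrame_normalFrame_sum hxU, inner_zero_right] at h5
  rw [h.inner_fderiv_normalFrame hU hε hxU (hb x hxU) (hη.2 x hx).1, h4, add_zero] at h1
  rw [h'.inner_fderiv_normalFrame hU hε hxU (hb' x hxU) (hmem x hx), h3.fderiv_eq, h1,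
    add_zero] at h2
  rw [← h2, zero_smul]

/-- Two corresponding families whose frames differ by a reflection and whose positions differ by a
multiple of the reflected vector are related by a Ribaucour transformation. -/
theorem Corresponds.isRibaucour (h : Corresponds ε U F G B A X)
    (h' : Corresponds ε U F' G' B' A' X') (hU : IsOpen U) (hε : ∀ i, ε i * ε i = 1)
    (hb : ∀ x ∈ U, ∀ i, B x j i ≠ 0) (hb' : ∀ x ∈ U, ∀ i, B' x j i ≠ 0)
    {n : (Fin N → ℝ) → Amb N k} {w : (Fin N → ℝ) → MIdx N k → ℝ} {d : (Fin N → ℝ) → ℝ}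
    (hA : ∀ x ∈ U, ∀ p, colVec A' p x = colVec A p x - (2 * w x p) • n x)
    (hX : ∀ x ∈ U, colVec X' j x = colVec X j x + d x • n x) :
    IsRibaucour U (colVec X j) (colVec X' j) (frameMap A A') := by
  have htan : ∀ x ∈ U, ∀ (i : Fin N) (u : Fin N → ℝ), u i ≠ 0 → (∀ l, l ≠ i → u l = 0) →
      MeetEquidistant (colVec X j x) (fderiv ℝ (colVec X j) x u) (colVec X' j x)
        (fderiv ℝ (colVec X' j) x u) := by
    intro x hx i u hui hu
    rw [h.fderiv_X_of_single hU hx j hu, h'.fderiv_X_of_single hU hx j hu, hX x hx,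
      hA x hx (Sum.inl i)]
    refine (meetEquidistant_of_sub ?_).smul
      (neg_ne_zero.2 (mul_ne_zero (mul_ne_zero (sign_ne_zero hε j) (hb x hx i)) hui))
      (neg_ne_zero.2 (mul_ne_zero (mul_ne_zero (sign_ne_zero hε j) (hb' x hx i)) hui))
    rw [← hA x hx, h'.norm_frame hx, h.norm_frame hx]
  refine
    { immersion := h.isImmersionOn hU hε hb
      immersion' := h'.isImmersionOn hU hε hb'
      smooth := h.frameMap_smooth h'
      bij := fun x hx => h.frameMap_bijOn h' hU hε hx (hb x hx) (hb' x hx)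
      parallel := fun V hV hVo η hη => h.frameMap_parallel h' hU hε hb hb' hV hVo hη
      normal_lines := fun x hx η hη _ => ?_
      principal := fun x hx η hη c u hu hcu hspan => ?_
      principal_basis := fun x hx => ?_ }
  · have e : frameMap A A' x η =
        η - (2 * ∑ a, inner ℝ (normalFrame A a x) η * w x (Sum.inr a)) • n x := by
      conv_rhs => rw [← h.sum_inner_normalFrame hU hx hε (hb x hx) hη]
      simp only [h.inner_normalFrame_normalFrame_sum hx]
      rw [frameMap_apply, Finset.mul_sum, Finset.sum_smul, ← Finset.sum_sub_distrib]
      refine Finset.sum_congr rfl fun a _ => ?_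
      have : normalFrame A' a x = normalFrame A a x - (2 * w x (Sum.inr a)) • n x :=
        hA x hx (Sum.inr a)
      rw [this]
      module
    -- Both norms are computed from the same coefficients in orthonormal frames.
    have hn : ‖frameMap A A' x η‖ = ‖η‖ := by
      refine (sq_eq_sq₀ (norm_nonneg _) (norm_nonneg _)).1 ?_
      conv_rhs => rw [← h.sum_inner_normalFrame hU hx hε (hb x hx) hη]
      rw [frameMap_apply, h.norm_normalFrame_sum_sq hx, h'.norm_normalFrame_sum_sq hx]
    rw [e] at hn ⊢
    rw [hX x hx]
    exact meetEquidistant_of_sub hn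
  · obtain ⟨i, hi⟩ := Function.ne_iff.1 hu
    have hi : u i ≠ 0 := hi
    rw [h.shape_eq hU hx hε (hb x hx)] at hcu hspan
    have hci := congrFun hcu i
    rw [Matrix.mulVec_diagonal, Pi.smul_apply, smul_eq_mul] at hci
    have hci' := mul_right_cancel₀ hi hci
    -- Where u_i ≠ 0, the eigenvalue is the i-th diagonal entry, so the i-th coordinate vector lies
    -- in the eigenspace. As u spans that space, u is a multiple of it.
    obtain ⟨r, hr⟩ := hspan (Pi.single i 1) (by
      rw [← hci']
      exact diagonal_mulVec_of_single fun l hl => by simp [hl])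
    have hr0 : r ≠ 0 := by
      rintro rfl
      have := congrFun hr i
      simp at this
    have hu0 : ∀ l, l ≠ i → u l = 0 := by
      intro l hl
      have := congrFun hr l
      simpa [hl, hr0] using this.symm
    refine ⟨?_, htan x hx i u hi hu0⟩
    rw [h'.shape_eq hU hx hε (hb' x hx)]
    exact ⟨_, diagonal_mulVec_of_single hu0⟩
  · have hsingle : ∀ i l : Fin N, l ≠ i → (Pi.basisFun ℝ (Fin N) i) l = 0 := by
      intro i l hl
      simp [hl]
    refine ⟨Pi.basisFun ℝ (Fin N), fun i l hil => ?_, fun i => ⟨fun η _ => ⟨?_, ?_⟩, ?_⟩⟩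
    · rw [h.firstForm_eq hU hx, h'.firstForm_eq hU hx]
      constructor <;>
      · refine Finset.sum_eq_zero fun r _ => ?_
        by_cases hri : r = i
        · rw [hsingle l r (by rw [hri]; exact hil), mul_zero]
        · rw [hsingle i r hri, mul_zero, zero_mul]
    · rw [h.shape_eq hU hx hε (hb x hx)]
      exact ⟨_, diagonal_mulVec_of_single (hsingle i)⟩
    · rw [h'.shape_eq hU hx hε (hb' x hx)]
      exact ⟨_, diagonal_mulVec_of_single (hsingle i)⟩
    · exact htan x hx i _ (by simp) (hsingle i)

end Ribaucour

end RibaucourDressing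

/-! ### Assembly of the theorem. -/

open RibaucourDressing in
theorem theorem10p6 {N k : ℕ} (ε : Fin N → ℝ) (hε : ε = euclideanSign N ∨ ε = lorentzSign N)
    (U : Set (Fin N → ℝ)) (hU : IsOpen U)
    (F : (Fin N → ℝ) → Matrix (Fin N) (Fin N) ℝ)
    (G : (Fin N → ℝ) → Matrix (Fin k) (Fin N) ℝ)
    (hFG : IsSystem ε U F G)
    (E : (Fin N → ℝ) → ℂ → Matrix (FIdx N k) (FIdx N k) ℂ)
    (hE : IsFrame ε U F G E)
    (s : ℝ) (hs : s ≠ 0)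
    (W : MIdx N k → ℝ) (hW : ∑ a, W a ^ 2 = 1)
    (Z : Fin N → ℝ) (hZ : ∑ j, ε j * Z j ^ 2 = 1)
    -- in the Lorentzian case, the projection `π̃(x)` is defined
    (hreg : ε = lorentzSign N → ∀ x ∈ U, tildeW E s W Z x ≠ 0) :
    -- the objects produced by the action of `g_{s,π}`
    (∀ x ∈ U,
      tildeVec E s W Z x = isoVec (tildeW E s W Z x) (tildeZ E s W Z x) ∧
      tildeW E s W Z x ≠ 0 ∧
      ∑ a, tildeW E s W Z x a ^ 2 = ∑ j, ε j * tildeZ E s W Z x j ^ 2 ∧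
      E x 0 = cplx (Matrix.fromBlocks (blockA E x) 0 0 (blockB E x)) ∧
      newFrame ε E s W Z x 0 =
        cplx (Matrix.fromBlocks (newA ε E s W Z x) 0 0 (newB ε E s W Z x)) ∧
      newA ε E s W Z x = blockA E x *
        (1 - (2 : ℝ) • Matrix.vecMulVec (hatW E s W Z x) (hatW E s W Z x)) ∧
      newB ε E s W Z x = blockB E x *
        (1 - (2 : ℝ) • Matrix.vecMulVec (hatZ ε E s W Z x) (hatZ ε E s W Z x) *
          Matrix.diagonal ε)) ∧
    -- `X` and `X̃` from the derivatives of the frames at `λ = 0`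
    (∃ X X' : (Fin N → ℝ) → Matrix (MIdx N k) (Fin N) ℝ,
      (∀ x ∈ U,
        sym E x = cplx (Matrix.fromBlocks 0 (X x) (-(Matrix.diagonal ε * (X x)ᵀ)) 0) ∧
        (∀ p q, DifferentiableAt ℂ (fun l => newFrame ε E s W Z x l p q) 0) ∧
        sym (newFrame ε E s W Z) x =
          cplx (Matrix.fromBlocks 0 (X' x) (-(Matrix.diagonal ε * (X' x)ᵀ)) 0) ∧
        X' x = newX ε E s W Z X x) ∧
      Corresponds ε U F G (blockB E) (blockA E) X) ∧
    -- every `X` corresponding to `(F, G, B)` and its transform `X̃ = X + (2/s) A Ŵ Ẑᵗ Bᵗ J`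
    (∀ X : (Fin N → ℝ) → Matrix (MIdx N k) (Fin N) ℝ,
      Corresponds ε U F G (blockB E) (blockA E) X →
      -- the solution of system II which corresponds to `X̃`
      Corresponds ε U (newF ε F E s W Z) (newG ε G E s W Z) (newB ε E s W Z) (newA ε E s W Z)
        (newX ε E s W Z X) ∧
      -- `X` and `X̃` are tuples with parallel normal frames `e_α` and `ẽ_α`
      (∀ V ⊆ U, IsOpen V → (∀ x ∈ V, ∀ j i, blockB E x j i ≠ 0) →
        IsPreTuple ε V (colVec X) (normalFrame (blockA E))
          (fun x => Matrix.diagonal ε * blockB E x) G ∧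
        (IsTuple ε V (colVec X) (normalFrame (blockA E))
            (fun x => Matrix.diagonal ε * blockB E x) G ↔
          ∀ x ∈ V, (G x).rank = N)) ∧
      (∀ V ⊆ U, IsOpen V → (∀ x ∈ V, ∀ j i, newB ε E s W Z x j i ≠ 0) →
        IsPreTuple ε V (colVec (newX ε E s W Z X)) (normalFrame (newA ε E s W Z))
          (fun x => Matrix.diagonal ε * newB ε E s W Z x) (newG ε G E s W Z) ∧
        (IsTuple ε V (colVec (newX ε E s W Z X)) (normalFrame (newA ε E s W Z))
            (fun x => Matrix.diagonal ε * newB ε E s W Z x) (newG ε G E s W Z) ↔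
          ∀ x ∈ V, (newG ε G E s W Z x).rank = N)) ∧
      -- `P(e_α) = ẽ_α` is a Ribaucour transformation covering `X_j ↦ X̃_j`
      (∀ j, ∀ V ⊆ U, IsOpen V →
        (∀ x ∈ V, ∀ i, blockB E x j i ≠ 0 ∧ newB ε E s W Z x j i ≠ 0) →
        IsRibaucour V (colVec X j) (colVec (newX ε E s W Z X) j)
          (frameMap (blockA E) (newA ε E s W Z))) ∧
      -- `X_j + φ_{ij} e_i = X̃_j + φ_{ij} ẽ_i`
      (∀ (i : MIdx N k) (j : Fin N),
        (∃ φ : (Fin N → ℝ) → ℝ,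
          ContDiffOn ℝ ∞ φ {x ∈ U | hatW E s W Z x i ≠ 0} ∧
          ∀ x ∈ U, hatW E s W Z x i ≠ 0 →
            colVec X j x + φ x • colVec (blockA E) i x =
              colVec (newX ε E s W Z X) j x + φ x • colVec (newA ε E s W Z) i x) ∧
        ∀ x ∈ U, hatW E s W Z x i = 0 →
          colVec (newA ε E s W Z) i x = colVec (blockA E) i x)) := by
  have hεs := sign_mul_self hε
  have h0 : ∀ x ∈ U, tildeW E s W Z x ≠ 0 := fun x hx =>
    hE.tildeW_ne_zero hε hx hW hZ fun he => hreg he x hx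
  have hp := hE.isPolePair (s := s) hεs hU hW hZ h0
  have hA' := fun x (hx : x ∈ U) =>
    hE.newA_eq hεs hx hW hZ (h0 x hx) hs (hp.norm_w x hx) (hp.norm_z x hx)
  have hB' := fun x (hx : x ∈ U) =>
    hE.newB_eq hεs hx hW hZ (h0 x hx) hs (hp.norm_w x hx) (hp.norm_z x hx)
  -- Without indices ⟨Z, Z⟩ would be an empty sum, not 1.
  have : Nonempty (Fin N) := by
    by_contra hN
    rw [not_nonempty_iff] at hN
    simp at hZ
  refine ⟨fun x hx => ⟨hE.tildeVec_eq hεs hx, h0 x hx, hE.sum_tildeW_sq hεs hx hW hZ,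
    hE.zero_eq hx, ?_, hA' x hx, hB' x hx⟩, ⟨symBlock ε E, newX ε E s W Z (symBlock ε E),
    fun x hx => ⟨hE.sym_eq hεs hx, fun p q => ?_, ?_, rfl⟩, hE.corresponds hFG hεs hU⟩,
    fun X hX => ?_⟩
  · rw [hA' x hx, hB' x hx]
    exact hE.newFrame_zero_eq hεs hx hW hZ (h0 x hx) hs (hp.norm_w x hx) (hp.norm_z x hx)
  · exact (hE.hasDerivAt_newFrame hεs hx hW hZ (h0 x hx) hs (hp.norm_w x hx) (hp.norm_z x hx)
      p q).differentiableAt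
  · exact hE.sym_newFrame hεs hx hW hZ (h0 x hx) hs (hp.norm_w x hx) (hp.norm_z x hx)
  have hX' : Corresponds ε U (newF ε F E s W Z) (newG ε G E s W Z) (newB ε E s W Z)
      (newA ε E s W Z) (newX ε E s W Z X) :=
    hp.corresponds hU hεs hs hX (fun x hx l => hE.pdMat_B hεs hU hx l) hA' hB'
  have hcolA : ∀ x ∈ U, ∀ p, colVec (newA ε E s W Z) p x = colVec (blockA E) p x -
      (2 * hatW E s W Z x p) • WithLp.toLp 2 (blockA E x *ᵥ hatW E s W Z x) := by
    intro x hx p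
    ext a
    simp only [colVec, hA' x hx, mul_reflection_apply, PiLp.sub_apply, PiLp.smul_apply,
      smul_eq_mul]
    ring
  have hcolX : ∀ x, ∀ j, colVec (newX ε E s W Z X) j x = colVec X j x +
      (2 / s * ((blockB E x *ᵥ hatZ ε E s W Z x) j * ε j)) •
        WithLp.toLp 2 (blockA E x *ᵥ hatW E s W Z x) := by
    intro x j
    ext a
    simp only [colVec, newX, Matrix.add_apply, Matrix.smul_apply, mul_vecMulVec_mul_apply,
      PiLp.add_apply, PiLp.smul_apply, smul_eq_mul]
    ring
  refine ⟨hX', fun V hV hVo hb => ?_, fun V hV hVo hb => ?_, fun j V hV hVo hb => ?_,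
    -- Solves 2 ŵ_i φ = (2/s) ε_j (Bẑ)_j, which equates the coefficients of n = Aŵ on the two sides.
    fun i j => ⟨⟨fun x => ε j * (blockB E x *ᵥ hatZ ε E s W Z x) j / (s * hatW E s W Z x i),
      ?_, fun x hx hi => ?_⟩, fun x hx hi => ?_⟩⟩
  · exact ⟨(hX.mono hV).isPreTuple hVo hεs hb, (hX.mono hV).isTuple_iff hVo hεs hb⟩
  · exact ⟨(hX'.mono hV).isPreTuple hVo hεs hb, (hX'.mono hV).isTuple_iff hVo hεs hb⟩
  · exact (hX.mono hV).isRibaucour (hX'.mono hV) hVo hεs (fun x hx i => (hb x hx i).1)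
      (fun x hx i => (hb x hx i).2) (fun x hx p => hcolA x (hV hx) p)
      fun x _ => hcolX x j
  · refine ContDiffOn.div ?_ ?_ fun x hx => mul_ne_zero hs hx.2
    · exact contDiffOn_const.mul ((smooth_mulVec hE.smoothB hp.smooth_z j).mono fun x hx => hx.1)
    · exact contDiffOn_const.mul ((hp.smooth_w i).mono fun x hx => hx.1)
  · rw [hcolA x hx, hcolX x j]
    match_scalars
    · ring
    · ring
    · field_simp
      ring
  · rw [hcolA x hx, hi, mul_zero, zero_smul, sub_zero]
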